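/- Let $n\ge 1$ be an integer and $N\in\mathbb C$. **The Brauer algebra.** For $r\ge 0$ the Brauer algebra $B(r,N)$ is the associative unital complex algebra with basis $b(\gamma)$, where $\gamma$ runs through the partitions of $\{1,\dots,r,\bar 1,\dots,\bar r\}$ into pairs (edges), and with product $b(\gamma)b(\gamma')=N^{q}\,b(\gamma\circ\gamma')$. Here the vertices $\bar 1,\dots,\bar r$ of $\gamma$ are identified with the vertices $1,\dots,r$ of $\gamma'$, $q$ is the number of closed loops of the resulting graph, and $\gamma\circ\gamma'$ is obtained by deleting the loops and replacing every other component by a single edge between its two terminal vertices. Adding vertical edges $\{k,\bar k\}$ gives inclusions $B(r,N)\subset B(r+1,N)\subset\cdots$. For $k\neq l$ let $(k,l)$ be the diagram with edges $\{k,\bar l\}$, $\{l,\bar k\}$ and all other edges vertical, and let $\overline{(k,l)}$ be the diagram with edges $\{k,l\}$, $\{\bar k,\bar l\}$ and all other edges vertical. Put $s_k=(k,k+1)$, $\bar s_k=\overline{(k,k+1)}$ and $$x_k=\frac{N-1}{2}+\sum_{l=1}^{k-1}\bigl((k,l)-\overline{(k,l)}\bigr).$$ **The affine Brauer algebra.**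 $A(n,N)$ is the associative unital complex algebra generated by the algebra $B(n,N)$, pairwise commuting elements $y_1,\dots,y_n$ and central elements $w_1,w_2,\dots$ (with $w_0=N$), subject to the relations $$s_ky_l=y_ls_k,\quad \bar s_ky_l=y_l\bar s_k\qquad (l\ne k,k+1),$$ $$s_ky_k-y_{k+1}s_k=\bar s_k-1,\quad s_ky_{k+1}-y_ks_k=1-\bar s_k,$$ $$\bar s_k(y_k+y_{k+1})=0,\quad (y_k+y_{k+1})\bar s_k=0$$ for $1\le k\le n-1$; if $n\ge 2$, $$\bar s_1y_1^i\bar s_1=w_i\bar s_1\qquad(i=1,2,\dots);$$ and $$-2w_i=w_{i-1}+\sum_{j=1}^{i}(-1)^jw_{i-j}w_{j-1}\qquad(i=1,3,5,\dots).$$ **Theorem.** For all $m\ge 0$ and $i\ge 0$ there is a unique element $z_{m+1}^{(i)}\in B(m,N)$ such that $\bar s_{m+1}x_{m+1}^i\bar s_{m+1}=z_{m+1}^{(i)}\bar s_{m+1}$ in $B(m+2,N)$. For every $m\ge 0$ there is a homomorphism of unital complex algebras $\pi_m:A(n,N)\to B(m+n,N)$ such that $$s_k\mapsto s_{m+k},\quad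 \bar s_k\mapsto\bar s_{m+k}\quad(1\le k\le n-1),\qquad y_k\mapsto x_{m+k}\quad(1\le k\le n),\qquad w_i\mapsto z_{m+1}^{(i)}\quad(i\ge 1).$$ The kernels of $\pi_0,\pi_1,\pi_2,\dots$ have zero intersection: $\bigcap_{m\ge 0}\ker\pi_m=0$. -/

import Mathlib

/-- A graph with `2n` vertices and `n` edges in which every vertex is incident with an edge, that is,
a partition of the vertices `1, …, n, 1̄, …, n̄` into pairs. The vertex `i` is `Sum.inl i`, the vertex
`ī` is `Sum.inr i` (indices start at `0`), and `pair a` is the other end of the edge at `a`. -/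
@[ext]
structure BrauerDiagram (n : ℕ) where
  pair : Fin n ⊕ Fin n → Fin n ⊕ Fin n
  pair_pair : ∀ a, pair (pair a) = a
  pair_ne : ∀ a, pair a ≠ a

namespace BrauerDiagram

variable {n : ℕ}

/-- The identity diagram: all edges are vertical. -/
def one (n : ℕ) : BrauerDiagram n where
  pair := Sum.swap
  pair_pair := by rintro (i | i) <;> rfl
  pair_ne := by rintro (i | i) <;> simp

/-! ### The composition of diagrams

Identifying the vertices `ī` of `γ` with the vertices `i` of `γ'` gives a graph on
top, middle and bottom vertices. -/

/-- The vertices of `γ` inside the glued graph. -/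
def upper : Fin n ⊕ Fin n → Fin n ⊕ (Fin n ⊕ Fin n) := Sum.map id Sum.inl

/-- The vertices of `γ'` inside the glued graph. -/
def lower : Fin n ⊕ Fin n → Fin n ⊕ (Fin n ⊕ Fin n) := Sum.inr

/-- The terminal vertices of the glued graph: top and bottom. -/
def outer : Fin n ⊕ Fin n → Fin n ⊕ (Fin n ⊕ Fin n) := Sum.map id Sum.inr

/-- The edges of the glued graph. -/
inductive GlueEdge (γ γ' : BrauerDiagram n) :
    Fin n ⊕ (Fin n ⊕ Fin n) → Fin n ⊕ (Fin n ⊕ Fin n) → Prop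
  | up (a : Fin n ⊕ Fin n) : GlueEdge γ γ' (upper a) (upper (γ.pair a))
  | low (a : Fin n ⊕ Fin n) : GlueEdge γ γ' (lower a) (lower (γ'.pair a))

/-- Two vertices of the glued graph are related when they lie in the same connected component. -/
def glued (γ γ' : BrauerDiagram n) : Setoid (Fin n ⊕ (Fin n ⊕ Fin n)) :=
  Relation.EqvGen.setoid (GlueEdge γ γ')

/-- The loops of the glued graph: the components without terminal vertices. -/
def Loop (γ γ' : BrauerDiagram n) : Type :=
  {c : Quotient (glued γ γ') // ∀ a, Quotient.mk (glued γ γ') (outer a) ≠ c}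

/-- The number of loops. -/
noncomputable def loops (γ γ' : BrauerDiagram n) : ℕ := Nat.card (Loop γ γ')

/-- A component of a union of two partial matchings that has one end has exactly one other end. -/
theorem exists_unique_end_aux {V : Type*} [Finite V] (s t : Equiv.Perm V)
    (hs : ∀ v, s (s v) = v) (ht : ∀ v, t (t v) = v) (hst : ∀ v, ¬ (s v = v ∧ t v = v))
    (r : Setoid V) (hrs : ∀ v, r v (s v)) (hrt : ∀ v, r v (t v))
    (hmin : ∀ P : V → Prop, (∀ v, P v → P (s v)) → (∀ v, P v → P (t v)) →
      ∀ u v, r u v → P u → P v)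
    (x : V) (hx : t x = x) : ∃! y, y ≠ x ∧ (s y = y ∨ t y = y) ∧ r x y := by
  set p : Equiv.Perm V := s * t with hp
  have htinv : t⁻¹ = t := by
    ext v; rw [Equiv.Perm.inv_eq_iff_eq, ht]
  have hsinv : s⁻¹ = s := by
    ext v; rw [Equiv.Perm.inv_eq_iff_eq, hs]
  have htp : t * p * t⁻¹ = p⁻¹ := by
    rw [hp, mul_inv_rev, htinv, hsinv]
    have : t * t = 1 := by ext v; simp [ht]
    rw [mul_assoc, mul_assoc, this, mul_one]
  have htk : ∀ k : ℤ, t ((p ^ k) x) = (p ^ (-k)) x := by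
    intro k
    have h : t * p ^ k * t⁻¹ = p ^ (-k) := by
      rw [← conj_zpow, htp, inv_zpow, zpow_neg]
    rw [← h]
    simp [htinv, hx]
  have hsk : ∀ k : ℤ, s ((p ^ k) x) = (p ^ (1 - k)) x := by
    intro k
    have h1 : s ((p ^ k) x) = p (t ((p ^ k) x)) := by simp [hp, ht]
    rw [h1, htk, sub_eq_add_neg, zpow_add, zpow_one]; rfl
  set d : ℕ := Function.minimalPeriod (fun v => p • v) x with hd
  have hdk : ∀ k : ℤ, (p ^ k) x = x ↔ (d : ℤ) ∣ k := fun k =>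
    MulAction.zpow_smul_eq_iff_minimalPeriod_dvd (a := p) (b := x) (n := k)
  have hdkl : ∀ k l : ℤ, (p ^ k) x = (p ^ l) x ↔ (d : ℤ) ∣ k - l := by
    intro k l
    rw [← hdk, sub_eq_neg_add, zpow_add, zpow_neg, Equiv.Perm.mul_apply,
      Equiv.Perm.inv_eq_iff_eq]
  have hdpos : 0 < d := by
    rcases Nat.eq_zero_or_pos d with h0 | h0
    · exfalso
      have hinj : Function.Injective (fun k : ℤ => (p ^ k) x) := by
        intro k l hkl
        have := (hdkl k l).1 hkl
        rw [h0] at this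
        simpa [sub_eq_zero] using this
      exact not_finite_iff_infinite.2 (Infinite.of_injective _ hinj) inferInstance
    · exact h0
  have hts : ∀ k : ℤ, t ((p ^ k) x) = (p ^ k) x ↔ (d : ℤ) ∣ 2 * k := by
    intro k
    rw [htk, hdkl, ← dvd_neg]; ring_nf
  have hss : ∀ k : ℤ, s ((p ^ k) x) = (p ^ k) x ↔ (d : ℤ) ∣ 2 * k - 1 := by
    intro k
    rw [hsk, hdkl, ← dvd_neg]; ring_nf
  have hrp : ∀ v, r v (p v) := fun v => r.trans' (hrt v) (hrs (t v))
  have hrk : ∀ k : ℕ, r x ((p ^ k) x) := by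
    intro k
    induction k with
    | zero => exact r.refl' x
    | succ k ih => rw [pow_succ']; exact r.trans' ih (hrp _)
  have horb : ∀ y, r x y → ∃ k : ℤ, (p ^ k) x = y := by
    intro y hy
    refine hmin (fun v => ∃ k : ℤ, (p ^ k) x = v) ?_ ?_ x y hy ⟨0, rfl⟩
    · rintro v ⟨k, rfl⟩; exact ⟨1 - k, (hsk k).symm⟩
    · rintro v ⟨k, rfl⟩; exact ⟨-k, (htk k).symm⟩
  rcases Nat.even_or_odd' d with ⟨e, he | he⟩
  · refine ⟨(p ^ e) x, ⟨?_, Or.inr ?_, hrk e⟩, ?_⟩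
    · intro h
      have := (hdk e).1 (by simpa using h)
      rw [Int.natCast_dvd_natCast] at this
      have := Nat.le_of_dvd (by omega) this
      omega
    · have := (hts e).2 (by rw [he]; push_cast; exact dvd_rfl)
      simpa using this
    · rintro y ⟨hyx, hy, hr⟩
      obtain ⟨k, rfl⟩ := horb y hr
      rw [hts, hss] at hy
      have hk : ¬ (d : ℤ) ∣ k := fun h => hyx ((hdk k).2 h)
      have h2 : (d : ℤ) ∣ 2 * k := by
        rcases hy with h | h
        · exfalso
          have : (2 : ℤ) ∣ 2 * k - 1 := dvd_trans ⟨e, by rw [he]; push_cast; ring⟩ h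
          omega
        · exact h
      have : (p ^ k) x = (p ^ (e : ℤ)) x := by
        rw [hdkl]
        obtain ⟨c, hc⟩ := h2
        have hkc : k = e * c := by
          rw [he] at hc; push_cast at hc; linarith
        rcases Int.even_or_odd' c with ⟨f, hf | hf⟩
        · exact absurd ⟨f, by rw [hkc, hf, he]; push_cast; ring⟩ hk
        · exact ⟨f, by rw [hkc, hf, he]; push_cast; ring⟩
      simpa using this
  · refine ⟨(p ^ (e + 1)) x, ⟨?_, Or.inl ?_, hrk (e + 1)⟩, ?_⟩
    · intro h
      have := (hdk ((e + 1 : ℕ) : ℤ)).1 (by rw [zpow_natCast]; exact h)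
      rw [Int.natCast_dvd_natCast] at this
      have := Nat.le_of_dvd (by omega) this
      have he0 : e = 0 := by omega
      subst he0
      refine hst x ⟨?_, hx⟩
      have := (hss 0).2 (by rw [he]; simp)
      simpa using this
    · have := (hss ((e + 1 : ℕ) : ℤ)).2 ⟨1, by rw [he]; push_cast; ring⟩
      rw [zpow_natCast] at this; exact this
    · rintro y ⟨hyx, hy, hr⟩
      obtain ⟨k, rfl⟩ := horb y hr
      rw [hts, hss] at hy
      have hk : ¬ (d : ℤ) ∣ k := fun h => hyx ((hdk k).2 h)
      have h2 : (d : ℤ) ∣ 2 * k - 1 := by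
        rcases hy with h | h
        · exact h
        · exfalso
          apply hk
          have h3 : (d : ℤ) ∣ (d : ℤ) * k - e * (2 * k) :=
            dvd_sub (dvd_mul_right _ _) (Dvd.dvd.mul_left h _)
          have h4 : (d : ℤ) * k - e * (2 * k) = k := by rw [he]; push_cast; ring
          rwa [h4] at h3
      have : (p ^ k) x = (p ^ ((e + 1 : ℕ) : ℤ)) x := by
        rw [hdkl]
        have h3 : (d : ℤ) ∣ (d : ℤ) * (k - 1) - e * (2 * k - 1) :=
          dvd_sub (dvd_mul_right _ _) (Dvd.dvd.mul_left h2 _)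
        have h4 : (d : ℤ) * (k - 1) - e * (2 * k - 1) = k - ((e + 1 : ℕ) : ℤ) := by
          rw [he]; push_cast; ring
        rwa [h4] at h3
      rw [zpow_natCast] at this; exact this

/-- The edges of `γ` in the glued graph, as an involution fixing the bottom vertices. -/
def upPerm (γ : BrauerDiagram n) : Equiv.Perm (Fin n ⊕ (Fin n ⊕ Fin n)) where
  toFun v := match v with
    | Sum.inl i => upper (γ.pair (Sum.inl i))
    | Sum.inr (Sum.inl i) => upper (γ.pair (Sum.inr i))
    | Sum.inr (Sum.inr i) => Sum.inr (Sum.inr i)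
  invFun v := match v with
    | Sum.inl i => upper (γ.pair (Sum.inl i))
    | Sum.inr (Sum.inl i) => upper (γ.pair (Sum.inr i))
    | Sum.inr (Sum.inr i) => Sum.inr (Sum.inr i)
  left_inv := by
    rintro (i | i | i)
    · have h := γ.pair_pair (Sum.inl i)
      rcases hj : γ.pair (Sum.inl i) with j | j <;> rw [hj] at h <;> simp [upper, hj, h]
    · have h := γ.pair_pair (Sum.inr i)
      rcases hj : γ.pair (Sum.inr i) with j | j <;> rw [hj] at h <;> simp [upper, hj, h]
    · rfl
  right_inv := by
    rintro (i | i | i)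
    · have h := γ.pair_pair (Sum.inl i)
      rcases hj : γ.pair (Sum.inl i) with j | j <;> rw [hj] at h <;> simp [upper, hj, h]
    · have h := γ.pair_pair (Sum.inr i)
      rcases hj : γ.pair (Sum.inr i) with j | j <;> rw [hj] at h <;> simp [upper, hj, h]
    · rfl

/-- The edges of `γ'` in the glued graph, as an involution fixing the top vertices. -/
def lowPerm (γ' : BrauerDiagram n) : Equiv.Perm (Fin n ⊕ (Fin n ⊕ Fin n)) where
  toFun := Sum.map id γ'.pair
  invFun := Sum.map id γ'.pair
  left_inv := by rintro (i | i) <;> simp [γ'.pair_pair]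
  right_inv := by rintro (i | i) <;> simp [γ'.pair_pair]

theorem upPerm_upper (γ : BrauerDiagram n) (a : Fin n ⊕ Fin n) :
    γ.upPerm (upper a) = upper (γ.pair a) := by
  rcases a with i | i <;> rfl

theorem upper_injective : Function.Injective (upper (n := n)) := by
  rintro (i | i) (j | j) h <;> simp_all [upper]

theorem outer_injective : Function.Injective (outer (n := n)) := by
  rintro (i | i) (j | j) h <;> simp_all [outer]

/-- Every terminal vertex is joined in the glued graph with exactly one other terminal vertex. -/
theorem exists_unique_end (γ γ' : BrauerDiagram n) (a : Fin n ⊕ Fin n) :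
    ∃! b, b ≠ a ∧ glued γ γ' (outer a) (outer b) := by
  have hup : ∀ v, γ.upPerm (γ.upPerm v) = v := γ.upPerm.left_inv
  have hlow : ∀ v, γ'.lowPerm (γ'.lowPerm v) = v := γ'.lowPerm.left_inv
  have hfixup : ∀ v, γ.upPerm v = v ↔ ∃ i, v = Sum.inr (Sum.inr i) := by
    rintro (i | i | i)
    · have : γ.upPerm (Sum.inl i) = upper (γ.pair (Sum.inl i)) := rfl
      rw [this]
      constructor
      · intro h; exact absurd (upper_injective (a₁ := γ.pair (Sum.inl i)) (a₂ := Sum.inl i) h)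
          (γ.pair_ne _)
      · rintro ⟨j, hj⟩; simp at hj
    · have : γ.upPerm (Sum.inr (Sum.inl i)) = upper (γ.pair (Sum.inr i)) := rfl
      rw [this]
      constructor
      · intro h; exact absurd (upper_injective (a₁ := γ.pair (Sum.inr i)) (a₂ := Sum.inr i) h)
          (γ.pair_ne _)
      · rintro ⟨j, hj⟩; simp at hj
    · exact ⟨fun _ => ⟨i, rfl⟩, fun _ => rfl⟩
  have hfixlow : ∀ v, γ'.lowPerm v = v ↔ ∃ i, v = Sum.inl i := by
    rintro (i | i)
    · exact ⟨fun _ => ⟨i, rfl⟩, fun _ => rfl⟩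
    · constructor
      · intro h; exact absurd (Sum.inr_injective h) (γ'.pair_ne i)
      · rintro ⟨j, hj⟩; simp at hj
  have hrup : ∀ v, glued γ γ' v (γ.upPerm v) := by
    rintro (i | i | i)
    · exact Relation.EqvGen.rel _ _ (GlueEdge.up (Sum.inl i))
    · exact Relation.EqvGen.rel _ _ (GlueEdge.up (Sum.inr i))
    · exact (glued γ γ').refl' _
  have hrlow : ∀ v, glued γ γ' v (γ'.lowPerm v) := by
    rintro (i | i)
    · exact (glued γ γ').refl' _
    · exact Relation.EqvGen.rel _ _ (GlueEdge.low i)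
  have hmin : ∀ P : Fin n ⊕ (Fin n ⊕ Fin n) → Prop, (∀ v, P v → P (γ.upPerm v)) →
      (∀ v, P v → P (γ'.lowPerm v)) → ∀ u v, glued γ γ' u v → P u → P v := by
    intro P h1 h2 u v huv
    suffices P u ↔ P v from this.1
    change Relation.EqvGen (GlueEdge γ γ') u v at huv
    induction huv with
    | rel u v h =>
      rcases h with a | a
      · rw [← upPerm_upper]
        exact ⟨h1 _, fun h => by simpa [hup] using h1 _ h⟩
      · exact ⟨h2 (lower a), fun h => by
          have := h2 _ h
          change P (lower (γ'.pair (γ'.pair a))) at this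
          rwa [γ'.pair_pair] at this⟩
    | refl => rfl
    | symm _ _ _ ih => exact ih.symm
    | trans _ _ _ _ _ ih1 ih2 => exact ih1.trans ih2
  have hno : ∀ v, ¬ (γ.upPerm v = v ∧ γ'.lowPerm v = v) := by
    intro v ⟨h1, h2⟩
    obtain ⟨i, rfl⟩ := (hfixup v).1 h1
    obtain ⟨j, hj⟩ := (hfixlow _).1 h2
    simp at hj
  have hout : ∀ v, (γ.upPerm v = v ∨ γ'.lowPerm v = v) ↔ ∃ b, outer b = v := by
    intro v
    rw [hfixup, hfixlow]
    constructor
    · rintro (⟨i, rfl⟩ | ⟨i, rfl⟩)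
      · exact ⟨Sum.inr i, rfl⟩
      · exact ⟨Sum.inl i, rfl⟩
    · rintro ⟨i | i, rfl⟩
      · exact Or.inr ⟨i, rfl⟩
      · exact Or.inl ⟨i, rfl⟩
  have key : ∃! y, y ≠ outer a ∧ (γ.upPerm y = y ∨ γ'.lowPerm y = y) ∧
      glued γ γ' (outer a) y := by
    rcases (hout (outer a)).2 ⟨a, rfl⟩ with h | h
    · have := exists_unique_end_aux γ'.lowPerm γ.upPerm hlow hup
        (fun v hv => hno v hv.symm) (glued γ γ') hrlow hrup
        (fun P h1 h2 => hmin P h2 h1) (outer a) h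
      simpa only [or_comm] using this
    · exact exists_unique_end_aux γ.upPerm γ'.lowPerm hup hlow hno (glued γ γ') hrup hrlow
        hmin (outer a) h
  obtain ⟨y, ⟨hy1, hy2, hy3⟩, huniq⟩ := key
  obtain ⟨b, rfl⟩ := (hout y).1 hy2
  refine ⟨b, ⟨fun h => hy1 (by rw [h]), hy3⟩, ?_⟩
  rintro c ⟨hc1, hc2⟩
  exact outer_injective (huniq (outer c)
    ⟨fun h => hc1 (outer_injective h), (hout _).2 ⟨c, rfl⟩, hc2⟩)

/-- The composition `γ ∘ γ'`: the loops of the glued graph are removed and every other component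
is replaced by a single edge between its two terminal vertices. -/
noncomputable def comp (γ γ' : BrauerDiagram n) : BrauerDiagram n where
  pair a := (exists_unique_end γ γ' a).choose
  pair_pair a := by
    have ha := (exists_unique_end γ γ' a).choose_spec.1
    have hb := (exists_unique_end γ γ' (exists_unique_end γ γ' a).choose).choose_spec
    exact (hb.2 a ⟨ha.1.symm, (glued γ γ').symm' ha.2⟩).symm
  pair_ne a := (exists_unique_end γ γ' a).choose_spec.1.1

theorem comp_pair_glued (γ γ' : BrauerDiagram n) (a : Fin n ⊕ Fin n) :
    glued γ γ' (outer a) (outer ((comp γ γ').pair a)) :=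
  (exists_unique_end γ γ' a).choose_spec.1.2

theorem comp_pair_eq (γ γ' : BrauerDiagram n) {a b : Fin n ⊕ Fin n} (hne : b ≠ a)
    (h : glued γ γ' (outer a) (outer b)) : (comp γ γ').pair a = b :=
  ((exists_unique_end γ γ' a).choose_spec.2 b ⟨hne, h⟩).symm

/-! ### Associativity

Colourings of the vertices by two colours, constant along the edges, turn composition of
diagrams into multiplication of matrices. -/

/-- A colouring of the vertices that is constant along the edges. -/
def Compat (γ : BrauerDiagram n) (c : Fin n ⊕ Fin n → Bool) : Prop := ∀ a, c (γ.pair a) = c a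

open Classical in
/-- The matrix of a diagram, indexed by colourings of the top and the bottom vertices. -/
noncomputable def mat (γ : BrauerDiagram n) : Matrix (Fin n → Bool) (Fin n → Bool) ℕ :=
  fun x y => if Compat γ (Sum.elim x y) then 1 else 0

theorem glued_compat (γ γ' : BrauerDiagram n) (x y z : Fin n → Bool) :
    (Compat γ (Sum.elim x y) ∧ Compat γ' (Sum.elim y z)) ↔
      ∀ u v, glued γ γ' u v → Sum.elim x (Sum.elim y z) u = Sum.elim x (Sum.elim y z) v := by
  have hu : ∀ a, Sum.elim x (Sum.elim y z) (upper a) = Sum.elim x y a := by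
    rintro (i | i) <;> rfl
  constructor
  · rintro ⟨h1, h2⟩ u v huv
    change Relation.EqvGen (GlueEdge γ γ') u v at huv
    induction huv with
    | rel u v h =>
      rcases h with a | a
      · rw [hu, hu, h1]
      · exact (h2 a).symm
    | refl => rfl
    | symm _ _ _ ih => exact ih.symm
    | trans _ _ _ _ _ ih1 ih2 => exact ih1.trans ih2
  · intro h
    refine ⟨fun a => ?_, fun a => ?_⟩
    · rw [← hu, ← hu]
      exact (h _ _ (Relation.EqvGen.rel _ _ (GlueEdge.up a))).symm
    · exact (h _ _ (Relation.EqvGen.rel _ _ (GlueEdge.low a))).symm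

theorem comp_compat (γ γ' : BrauerDiagram n) (c : Fin n ⊕ Fin n → Bool) :
    Compat (comp γ γ') c ↔ ∀ a b, glued γ γ' (outer a) (outer b) → c a = c b := by
  constructor
  · intro h a b hab
    by_cases hne : b = a
    · rw [hne]
    · rw [← h a, comp_pair_eq γ γ' hne hab]
  · intro h a
    exact (h _ _ (comp_pair_glued γ γ' a)).symm

open Classical in
theorem card_middle (γ γ' : BrauerDiagram n) (x z : Fin n → Bool)
    (h : Compat (comp γ γ') (Sum.elim x z)) :
    Nat.card {y : Fin n → Bool // Compat γ (Sum.elim x y) ∧ Compat γ' (Sum.elim y z)} =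
      2 ^ loops γ γ' := by
  rw [comp_compat] at h
  have hfin : Finite (Loop γ γ') := Subtype.finite
  have hout : ∀ (y : Fin n → Bool) a, Sum.elim x (Sum.elim y z) (outer a) = Sum.elim x z a := by
    rintro y (i | i) <;> rfl
  have e : {y : Fin n → Bool // Compat γ (Sum.elim x y) ∧ Compat γ' (Sum.elim y z)} ≃
      (Loop γ γ' → Bool) :=
    Equiv.ofBijective
      (fun y c => Quotient.lift (Sum.elim x (Sum.elim y.1 z))
        ((glued_compat γ γ' x y.1 z).1 y.2) c.1) (by
      constructor
      · rintro ⟨y, hy⟩ ⟨y', hy'⟩ hyy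
        have hg := (glued_compat γ γ' x y z).1 hy
        have hg' := (glued_compat γ γ' x y' z).1 hy'
        ext i
        change y i = y' i
        by_cases hi : ∃ a, glued γ γ' (outer a) (Sum.inr (Sum.inl i))
        · obtain ⟨a, ha⟩ := hi
          have h1 := hg _ _ ha
          have h2 := hg' _ _ ha
          rw [hout] at h1 h2
          exact h1.symm.trans h2
        · have hc : ∀ a, Quotient.mk (glued γ γ') (outer a) ≠
              Quotient.mk (glued γ γ') (Sum.inr (Sum.inl i)) :=
            fun a ha => hi ⟨a, Quotient.exact ha⟩
          exact congrFun hyy ⟨_, hc⟩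
      · intro f
        let F : Quotient (glued γ γ') → Bool := fun c =>
          if hc : ∃ a, Quotient.mk (glued γ γ') (outer a) = c then Sum.elim x z hc.choose
          else f ⟨c, fun a ha => hc ⟨a, ha⟩⟩
        have hF : ∀ a, F (Quotient.mk _ (outer a)) = Sum.elim x z a := by
          intro a
          have hc : ∃ b, Quotient.mk (glued γ γ') (outer b) = Quotient.mk _ (outer a) := ⟨a, rfl⟩
          simp only [F]
          rw [dif_pos hc]
          exact h _ _ (Quotient.exact hc.choose_spec)
        let y : Fin n → Bool := fun i => F (Quotient.mk _ (Sum.inr (Sum.inl i)))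
        have hy : ∀ v, Sum.elim x (Sum.elim y z) v = F (Quotient.mk _ v) := by
          rintro (i | i | i)
          · exact (hF (Sum.inl i)).symm
          · rfl
          · exact (hF (Sum.inr i)).symm
        refine ⟨⟨y, (glued_compat γ γ' x y z).2 fun u v huv => ?_⟩, ?_⟩
        · rw [hy, hy]; exact congrArg F (Quotient.sound huv)
        · funext c
          obtain ⟨c, hc⟩ := c
          induction c using Quotient.ind with
          | _ v =>
            change Sum.elim x (Sum.elim y z) v = _
            rw [hy]
            simp only [F]
            rw [dif_neg]
            rintro ⟨a, ha⟩
            exact hc a ha)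
  have : Fintype (Loop γ γ') := Fintype.ofFinite _
  rw [Nat.card_congr e, Nat.card_fun, loops]
  simp

theorem mat_mul (γ γ' : BrauerDiagram n) :
    mat γ * mat γ' = 2 ^ loops γ γ' • mat (comp γ γ') := by
  classical
  ext x z
  rw [Matrix.mul_apply, Matrix.smul_apply]
  have h1 : ∀ y, mat γ x y * mat γ' y z =
      if (Compat γ (Sum.elim x y) ∧ Compat γ' (Sum.elim y z)) then 1 else 0 := by
    intro y
    simp only [mat]
    split_ifs <;> simp_all
  simp only [h1, Finset.sum_boole, Nat.cast_id]
  by_cases h : Compat (comp γ γ') (Sum.elim x z)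
  · have := card_middle γ γ' x z h
    rw [Nat.card_eq_fintype_card, Fintype.card_subtype] at this
    simp [this, mat, h]
  · have : ∀ y, ¬ (Compat γ (Sum.elim x y) ∧ Compat γ' (Sum.elim y z)) := by
      intro y hy
      apply h
      rw [comp_compat]
      intro a b hab
      have := (glued_compat γ γ' x y z).1 hy _ _ hab
      rcases a with i | i <;> rcases b with j | j <;> exact this
    simp [this, mat, h]

theorem mat_one : mat (one n) = 1 := by
  classical
  ext x y
  rw [Matrix.one_apply, mat]
  congr 1
  rw [eq_iff_iff]
  constructor
  · intro h; funext i; exact (h (Sum.inr i))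
  · rintro rfl (i | i) <;> rfl

/-- The matrix determines the diagram, even up to a power of two. -/
theorem mat_inj {k l : ℕ} {γ γ' : BrauerDiagram n} (h : 2 ^ k • mat γ = 2 ^ l • mat γ') :
    k = l ∧ γ = γ' := by
  classical
  have hkl : k = l := by
    have h0 := congrFun (congrFun h fun _ => true) fun _ => true
    have hc : ∀ δ : BrauerDiagram n, Compat δ (Sum.elim (fun _ => true) fun _ => true) := by
      intro δ a
      rcases δ.pair a with i | i <;> rcases a with j | j <;> rfl
    simp only [Matrix.smul_apply, mat, hc, if_true, smul_eq_mul, mul_one] at h0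
    exact Nat.pow_right_injective le_rfl h0
  refine ⟨hkl, ?_⟩
  subst hkl
  have hC : ∀ c, Compat γ c ↔ Compat γ' c := by
    intro c
    have h0 := congrFun (congrFun h (c ∘ Sum.inl)) (c ∘ Sum.inr)
    simp only [Matrix.smul_apply, mat, Sum.elim_comp_inl_inr, smul_eq_mul] at h0
    have h1 := Nat.eq_of_mul_eq_mul_left (by positivity) h0
    by_cases h2 : Compat γ c <;> by_cases h3 : Compat γ' c <;> simp [h2, h3] at h1 ⊢
  ext1
  funext a
  let c : Fin n ⊕ Fin n → Bool := fun b => decide (b = a ∨ b = γ'.pair a)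
  have hc' : Compat γ' c := by
    intro b
    have : (γ'.pair b = a ∨ γ'.pair b = γ'.pair a) ↔ (b = a ∨ b = γ'.pair a) := by
      constructor
      · rintro (h | h)
        · right; rw [← h, γ'.pair_pair]
        · left; rw [← γ'.pair_pair b, h, γ'.pair_pair]
      · rintro (h | h)
        · right; rw [h]
        · left; rw [h, γ'.pair_pair]
    simp only [c, this]
  have hc := (hC c).2 hc' a
  have : γ.pair a = a ∨ γ.pair a = γ'.pair a := by
    simpa [c] using hc
  exact this.resolve_left (γ.pair_ne a)

theorem comp_assoc (γ₁ γ₂ γ₃ : BrauerDiagram n) :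
    loops γ₁ γ₂ + loops (comp γ₁ γ₂) γ₃ = loops γ₂ γ₃ + loops γ₁ (comp γ₂ γ₃) ∧
      comp (comp γ₁ γ₂) γ₃ = comp γ₁ (comp γ₂ γ₃) := by
  apply mat_inj
  rw [pow_add, pow_add, mul_smul, mul_smul, ← mat_mul, ← mat_mul, ← smul_mul_assoc,
    ← mul_smul_comm, ← mat_mul, ← mat_mul, mul_assoc]

theorem one_comp (γ : BrauerDiagram n) : loops (one n) γ = 0 ∧ comp (one n) γ = γ := by
  apply mat_inj
  rw [← mat_mul, mat_one, one_mul, pow_zero, one_smul]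

theorem comp_one (γ : BrauerDiagram n) : loops γ (one n) = 0 ∧ comp γ (one n) = γ := by
  apply mat_inj
  rw [← mat_mul, mat_one, mul_one, pow_zero, one_smul]

/-! ### Particular diagrams -/

/-- The diagram of the transposition `(k, l)`: its edges are `{(k, l)(i), ī}`. -/
def transp (k l : Fin n) : BrauerDiagram n where
  pair := Sum.elim (fun i => Sum.inr (Equiv.swap k l i)) (fun i => Sum.inl (Equiv.swap k l i))
  pair_pair := by rintro (i | i) <;> simp
  pair_ne := by rintro (i | i) <;> simp

/-- For `k ≠ l`, the diagram whose only non-vertical edges are `{k, l}` and `{k̄, l̄}`.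
(For `k = l`, which is never used, it is the identity diagram.) -/
def cupcap (k l : Fin n) : BrauerDiagram n where
  pair := Sum.elim
    (fun i => if Equiv.swap k l i = i then Sum.inr i else Sum.inl (Equiv.swap k l i))
    (fun i => if Equiv.swap k l i = i then Sum.inl i else Sum.inr (Equiv.swap k l i))
  pair_pair := by
    rintro (i | i) <;> by_cases h : Equiv.swap k l i = i <;> simp [h, eq_comm (a := i)]
  pair_ne := by
    rintro (i | i) <;> by_cases h : Equiv.swap k l i = i <;> simp [h]

/-- The diagram with `m + r` strands obtained from `γ` by adding the last `r` vertical edges. -/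
def extend {m : ℕ} (r : ℕ) (γ : BrauerDiagram m) : BrauerDiagram (m + r) where
  pair := Sum.elim
    (Fin.addCases
      (fun i => Sum.map (Fin.castAdd r) (Fin.castAdd r) (γ.pair (Sum.inl i)))
      (fun j => Sum.inr (Fin.natAdd m j)))
    (Fin.addCases
      (fun i => Sum.map (Fin.castAdd r) (Fin.castAdd r) (γ.pair (Sum.inr i)))
      (fun j => Sum.inl (Fin.natAdd m j)))
  pair_pair := by
    rintro (i | i)
    · induction i using Fin.addCases with
      | left i =>
        have h := γ.pair_pair (Sum.inl i)
        rcases hj : γ.pair (Sum.inl i) with j | j <;> rw [hj] at h <;> simp [hj, h]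
      | right j => simp
    · induction i using Fin.addCases with
      | left i =>
        have h := γ.pair_pair (Sum.inr i)
        rcases hj : γ.pair (Sum.inr i) with j | j <;> rw [hj] at h <;> simp [hj, h]
      | right j => simp
  pair_ne := by
    rintro (i | i)
    · induction i using Fin.addCases with
      | left i =>
        have h := γ.pair_ne (Sum.inl i)
        rcases hj : γ.pair (Sum.inl i) with j | j <;> simp_all
      | right j => simp
    · induction i using Fin.addCases with
      | left i =>
        have h := γ.pair_ne (Sum.inr i)
        rcases hj : γ.pair (Sum.inr i) with j | j <;> simp_all
      | right j => simp

end BrauerDiagram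

/-- The Brauer algebra `B(n, N)`: the complex vector space with basis the diagrams. -/
def BrauerAlgebra (n : ℕ) (_N : ℂ) : Type := BrauerDiagram n →₀ ℂ

namespace BrauerAlgebra

variable {n : ℕ} {N : ℂ}

noncomputable instance : AddCommGroup (BrauerAlgebra n N) :=
  inferInstanceAs (AddCommGroup (BrauerDiagram n →₀ ℂ))

noncomputable instance : Module ℂ (BrauerAlgebra n N) :=
  inferInstanceAs (Module ℂ (BrauerDiagram n →₀ ℂ))

/-- The basis element `b(γ)`. -/
noncomputable def b (γ : BrauerDiagram n) : BrauerAlgebra n N :=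
  Finsupp.single γ (1 : ℂ)

/-- The linear map with prescribed values on the basis. -/
noncomputable def lift {M : Type*} [AddCommGroup M] [Module ℂ M] (f : BrauerDiagram n → M) :
    BrauerAlgebra n N →ₗ[ℂ] M :=
  Finsupp.linearCombination ℂ f

theorem lift_b {M : Type*} [AddCommGroup M] [Module ℂ M] (f : BrauerDiagram n → M)
    (γ : BrauerDiagram n) : lift (N := N) f (b γ) = f γ := by
  unfold lift b
  exact (Finsupp.linearCombination_single ℂ (1 : ℂ) γ).trans (one_smul ℂ _)

theorem ext_b {M : Type*} [AddCommGroup M] [Module ℂ M] {f g : BrauerAlgebra n N →ₗ[ℂ] M}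
    (h : ∀ γ, f (b γ) = g (b γ)) : f = g :=
  Finsupp.lhom_ext' fun γ => LinearMap.ext_ring (h γ)

/-- The product: bilinear, with `b(γ) b(γ') = N ^ q • b(γ ∘ γ')`, `q` the number of loops. -/
noncomputable def mulLin : BrauerAlgebra n N →ₗ[ℂ] BrauerAlgebra n N →ₗ[ℂ] BrauerAlgebra n N :=
  lift fun γ => lift fun γ' => N ^ BrauerDiagram.loops γ γ' • b (BrauerDiagram.comp γ γ')

noncomputable instance : Mul (BrauerAlgebra n N) := ⟨fun f g => mulLin f g⟩

noncomputable instance : One (BrauerAlgebra n N) := ⟨b (BrauerDiagram.one n)⟩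

theorem mul_def (f g : BrauerAlgebra n N) : f * g = mulLin f g := rfl

theorem one_def : (1 : BrauerAlgebra n N) = b (BrauerDiagram.one n) := rfl

theorem b_mul_b (γ γ' : BrauerDiagram n) : (b γ * b γ' : BrauerAlgebra n N) =
    N ^ BrauerDiagram.loops γ γ' • b (BrauerDiagram.comp γ γ') := by
  rw [mul_def, mulLin, lift_b, lift_b]

theorem mul_assoc_aux (f g h : BrauerAlgebra n N) : f * g * h = f * (g * h) := by
  have key : ∀ γ₁ γ₂ γ₃ : BrauerDiagram n,
      (b γ₁ * b γ₂ * b γ₃ : BrauerAlgebra n N) = b γ₁ * (b γ₂ * b γ₃) := by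
    intro γ₁ γ₂ γ₃
    obtain ⟨h1, h2⟩ := BrauerDiagram.comp_assoc γ₁ γ₂ γ₃
    rw [b_mul_b, b_mul_b, mul_def, mul_def, map_smul, LinearMap.smul_apply, map_smul, ← mul_def,
      ← mul_def, b_mul_b, b_mul_b, smul_smul, smul_smul, ← pow_add, ← pow_add, h1, h2]
  have h1 : (LinearMap.compr₂ mulLin mulLin :
      BrauerAlgebra n N →ₗ[ℂ] BrauerAlgebra n N →ₗ[ℂ] BrauerAlgebra n N →ₗ[ℂ] _) =
      LinearMap.compl₂ (LinearMap.llcomp ℂ _ _ _ ∘ₗ mulLin) mulLin := by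
    refine ext_b fun γ₁ => ext_b fun γ₂ => ext_b fun γ₃ => ?_
    exact key γ₁ γ₂ γ₃
  exact LinearMap.congr_fun (LinearMap.congr_fun (LinearMap.congr_fun h1 f) g) h

noncomputable instance : Ring (BrauerAlgebra n N) :=
  { (inferInstance : AddCommGroup (BrauerAlgebra n N)),
    (inferInstance : Mul (BrauerAlgebra n N)),
    (inferInstance : One (BrauerAlgebra n N)) with
    left_distrib := fun f g h => map_add (mulLin f) g h
    right_distrib := fun f g h => by
      rw [mul_def, mul_def, mul_def, map_add, LinearMap.add_apply]
    zero_mul := fun f => by rw [mul_def, map_zero, LinearMap.zero_apply]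
    mul_zero := fun f => map_zero (mulLin f)
    mul_assoc := mul_assoc_aux
    one_mul := fun f => by
      have : mulLin (1 : BrauerAlgebra n N) = LinearMap.id := ext_b fun γ => by
        obtain ⟨h1, h2⟩ := BrauerDiagram.one_comp γ
        rw [← mul_def, one_def, b_mul_b, h1, h2, pow_zero, one_smul]; rfl
      exact LinearMap.congr_fun this f
    mul_one := fun f => by
      have : mulLin.flip (1 : BrauerAlgebra n N) = LinearMap.id := ext_b fun γ => by
        obtain ⟨h1, h2⟩ := BrauerDiagram.comp_one γ
        rw [LinearMap.flip_apply, ← mul_def, one_def, b_mul_b, h1, h2, pow_zero, one_smul]; rfl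
      exact LinearMap.congr_fun this f }

noncomputable instance : Algebra ℂ (BrauerAlgebra n N) :=
  Algebra.ofModule
    (fun c f g => by
      change mulLin (c • f) g = c • mulLin f g
      rw [map_smul, LinearMap.smul_apply])
    (fun c f g => map_smul (mulLin f) c g)

/-- The inclusion `B(m, N) ⊂ B(m + r, N)`, which adds vertical edges to the diagrams. -/
noncomputable def incl (m r : ℕ) (N : ℂ) : BrauerAlgebra m N →ₗ[ℂ] BrauerAlgebra (m + r) N :=
  lift fun γ => b (γ.extend r)

/-- The element `s` with index `k`, the transposition of the strands `k` and `k + 1`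
(strands are numbered from `0`). -/
noncomputable def s (N : ℂ) (k : ℕ) (hk : k + 1 < n) : BrauerAlgebra n N :=
  b (BrauerDiagram.transp ⟨k, Nat.lt_of_succ_lt hk⟩ ⟨k + 1, hk⟩)

/-- The element `s̄` with index `k`, on the strands `k` and `k + 1`
(strands are numbered from `0`). -/
noncomputable def sbar (N : ℂ) (k : ℕ) (hk : k + 1 < n) : BrauerAlgebra n N :=
  b (BrauerDiagram.cupcap ⟨k, Nat.lt_of_succ_lt hk⟩ ⟨k + 1, hk⟩)

/-- The Jucys–Murphy element `x` with index `k` (strands are numbered from `0`). -/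
noncomputable def x (N : ℂ) (k : Fin n) : BrauerAlgebra n N :=
  algebraMap ℂ (BrauerAlgebra n N) ((N - 1) / 2) +
    ∑ l ∈ Finset.Iio k, (b (BrauerDiagram.transp k l) - b (BrauerDiagram.cupcap k l))

/-- With strands numbered from `0`, the equation `s̄_m * x_m ^ i * s̄_m = c * s̄_m` in
`B(m + 2, N)` for an element `c` of the subalgebra `B(m, N)`. -/
def IsZ (m i : ℕ) (c : BrauerAlgebra m N) : Prop :=
  sbar (n := m + 2) N m (Nat.lt_succ_self _) * x N (⟨m, by omega⟩ : Fin (m + 2)) ^ i *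
      sbar (n := m + 2) N m (Nat.lt_succ_self _) =
    incl m 2 N c * sbar (n := m + 2) N m (Nat.lt_succ_self _)

end BrauerAlgebra

/-- The generators of the affine Brauer algebra: the elements of `B(n, N)`, then `y_1, …, y_n`
(indexed from `0`), and `w_1, w_2, …` (`w i` stands for `w_{i + 1}`). -/
inductive AffineBrauerGen (n : ℕ) (N : ℂ) : Type
  | b : BrauerAlgebra n N → AffineBrauerGen n N
  | y : Fin n → AffineBrauerGen n N
  | w : ℕ → AffineBrauerGen n N

namespace AffineBrauerGen

variable {n : ℕ} {N : ℂ}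

/-- An element of `B(n, N)` as a generator. -/
noncomputable def B (a : BrauerAlgebra n N) : FreeAlgebra ℂ (AffineBrauerGen n N) :=
  FreeAlgebra.ι ℂ (AffineBrauerGen.b a)

/-- The generator `y` with index `k`. -/
noncomputable def Y (N : ℂ) (k : Fin n) : FreeAlgebra ℂ (AffineBrauerGen n N) :=
  FreeAlgebra.ι ℂ (AffineBrauerGen.y k)

/-- The elements `w_0 = N` and `w_1, w_2, …`. -/
noncomputable def W (n : ℕ) (N : ℂ) : ℕ → FreeAlgebra ℂ (AffineBrauerGen n N)
  | 0 => algebraMap ℂ _ N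
  | i + 1 => FreeAlgebra.ι ℂ (AffineBrauerGen.w i)

end AffineBrauerGen

open AffineBrauerGen BrauerAlgebra in
/-- The defining relations of the affine Brauer algebra. -/
inductive AffineBrauerRel (n : ℕ) (N : ℂ) :
    FreeAlgebra ℂ (AffineBrauerGen n N) → FreeAlgebra ℂ (AffineBrauerGen n N) → Prop
  -- the algebra structure of `B(n, N)`
  | b_algebraMap (c : ℂ) :
      AffineBrauerRel n N (B (algebraMap ℂ _ c)) (algebraMap ℂ _ c)
  | b_add (f g : BrauerAlgebra n N) : AffineBrauerRel n N (B (f + g)) (B f + B g)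
  | b_mul (f g : BrauerAlgebra n N) : AffineBrauerRel n N (B (f * g)) (B f * B g)
  -- the `y_k` commute pairwise, the `w_i` are central
  | y_comm (k l : Fin n) : AffineBrauerRel n N (Y N k * Y N l) (Y N l * Y N k)
  | w_b (i : ℕ) (f : BrauerAlgebra n N) : AffineBrauerRel n N (W n N i * B f) (B f * W n N i)
  | w_y (i : ℕ) (k : Fin n) : AffineBrauerRel n N (W n N i * Y N k) (Y N k * W n N i)
  | w_w (i j : ℕ) : AffineBrauerRel n N (W n N i * W n N j) (W n N j * W n N i)
  -- relations between `s_k`, `s̄_k` and `y_l`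
  | s_y (k : ℕ) (hk : k + 1 < n) (l : Fin n) (h : (l : ℕ) ≠ k) (h' : (l : ℕ) ≠ k + 1) :
      AffineBrauerRel n N (B (s N k hk) * Y N l) (Y N l * B (s N k hk))
  | sbar_y (k : ℕ) (hk : k + 1 < n) (l : Fin n) (h : (l : ℕ) ≠ k) (h' : (l : ℕ) ≠ k + 1) :
      AffineBrauerRel n N (B (sbar N k hk) * Y N l) (Y N l * B (sbar N k hk))
  | s_y_left (k : ℕ) (hk : k + 1 < n) :
      AffineBrauerRel n N
        (B (s N k hk) * Y N ⟨k, Nat.lt_of_succ_lt hk⟩ - Y N ⟨k + 1, hk⟩ * B (s N k hk))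
        (B (sbar N k hk) - 1)
  | s_y_right (k : ℕ) (hk : k + 1 < n) :
      AffineBrauerRel n N
        (B (s N k hk) * Y N ⟨k + 1, hk⟩ - Y N ⟨k, Nat.lt_of_succ_lt hk⟩ * B (s N k hk))
        (1 - B (sbar N k hk))
  | sbar_y_left (k : ℕ) (hk : k + 1 < n) :
      AffineBrauerRel n N
        (B (sbar N k hk) * (Y N ⟨k, Nat.lt_of_succ_lt hk⟩ + Y N ⟨k + 1, hk⟩)) 0
  | sbar_y_right (k : ℕ) (hk : k + 1 < n) :
      AffineBrauerRel n N
        ((Y N ⟨k, Nat.lt_of_succ_lt hk⟩ + Y N ⟨k + 1, hk⟩) * B (sbar N k hk)) 0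
  -- `s̄_1 y_1 ^ i s̄_1 = w_i s̄_1`, present for `n ≥ 2`
  | sbar_y_sbar (i : ℕ) (hi : 1 ≤ i) (hn : 0 + 1 < n) :
      AffineBrauerRel n N
        (B (sbar N 0 hn) * Y N ⟨0, Nat.lt_of_succ_lt hn⟩ ^ i * B (sbar N 0 hn))
        (W n N i * B (sbar N 0 hn))
  -- `-2 w_i = w_{i-1} + ∑_{j=1}^{i} (-1)^j w_{i-j} w_{j-1}` for odd `i`; the other relations imply
  -- this only after multiplication by `s̄_1`
  | w_odd (i : ℕ) (hi : Odd i) :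
      AffineBrauerRel n N (-2 * W n N i)
        (W n N (i - 1) + ∑ j ∈ Finset.Icc 1 i, (-1) ^ j * (W n N (i - j) * W n N (j - 1)))

/-- The affine Brauer algebra `A(n, N)`. -/
abbrev AffineBrauerAlgebra (n : ℕ) (N : ℂ) : Type := RingQuot (AffineBrauerRel n N)

namespace AffineBrauerAlgebra

variable {n : ℕ} {N : ℂ}

/-- The image of an element of `B(n, N)` in `A(n, N)`. -/
noncomputable def ofBrauer (a : BrauerAlgebra n N) : AffineBrauerAlgebra n N :=
  RingQuot.mkAlgHom ℂ (AffineBrauerRel n N) (AffineBrauerGen.B a)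

/-- The element `y` with index `k` (indices start at `0`). -/
noncomputable def y (N : ℂ) (k : Fin n) : AffineBrauerAlgebra n N :=
  RingQuot.mkAlgHom ℂ (AffineBrauerRel n N) (AffineBrauerGen.Y N k)

/-- The elements `w_0 = N` and `w_1, w_2, …`. -/
noncomputable def w (n : ℕ) (N : ℂ) (i : ℕ) : AffineBrauerAlgebra n N :=
  RingQuot.mkAlgHom ℂ (AffineBrauerRel n N) (AffineBrauerGen.W n N i)

end AffineBrauerAlgebra

/-! The elements z and the homomorphisms π_m come from diagram calculus. An element of B(m+1, N)
placed between two copies of s̄_{m+1} has its last strand closed up, which leaves an element of B(m,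
N) times s̄_{m+1} (`exists_c_mul_inc_mul_c`). The map g ↦ g s̄_{m+1} is injective on B(m, N),
because it sends distinct diagrams to distinct diagrams (`inc_mul_c_injective`). This gives
existence and uniqueness of z. It also allows s̄ to be cancelled: the centrality of z and the
quadratic relations for odd i are proved first after multiplication by s̄ (`z_commute`,
`odd_relation`). The other relations are those of the Jucys–Murphy elements.

For the kernels, filter A(n, N) by giving y_k degree 1, w_i degree i and B(n, N) degree 0. Filter
B(m+n, N) by the number of the first m strands that are not vertical edges of a diagram. Then π_m
respects the filtrations (`proj_mem_Deg`).

Upper bound on A(n, N). Modulo lower degrees, a y at one end of an edge of a diagram can be moved to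
the other end up to a sign (`slide_add_slide_mem`), w_i with i odd vanishes (`w_odd_mem`), and s̄_k
y_k^r s̄_k is w_r s̄_k for every k (`c_y_pow_c_sub_mem`). Hence each degree is spanned, modulo lower
ones, by the regular monomials y^a w^h b(γ) y^c, with exponents only at the first end of every edge
of γ and only even positive indices in h (`F_succ_le_K`).

Independence of the leading terms. In top degree, each factor x_{m+k} leads the edge at k through
one further strand among the first m. So a diagram of top degree remembers γ and the total exponent
on each edge of γ (`HasType`, `proj_mono_mem_Typ`). The indices h are remembered by cycle types: for
odd j, the leading part of z^{(j+1)} is 2 ∑_l (∑_{l' ≠ l} ((l,l') - c_{ll'}))^j (`z_sub_mem`), with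
c_{ll'} the diagram of the horizontal edges at l and l'. Its permutations of largest support are
(j+1)-cycles with nonnegative coefficients, so in a product of z's nothing cancels and the cycle
type is h (`cycleType_of_coeff_zprod`, `exists_coeff_zprod_pos`).

With m = d there are enough strands for degree d, and every regular monomial of degree d has a
diagram at which no other one has a nonzero coefficient (`exists_separating`). Thus an element of
degree at most d in all kernels has degree less than d (`mem_F_of_proj_eq_zero`), and descent ends
at 0. -/

namespace BrauerDiagram

/-! ### Explicit composition with permutations and with the diagrams s̄, and embeddings of strands.
-/

variable {n : ℕ}

/-! ### Operations on diagrams -/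

theorem pair_injective (γ : BrauerDiagram n) : Function.Injective γ.pair := fun a b h => by
  rw [← γ.pair_pair a, h, γ.pair_pair]

theorem pair_eq_iff (γ : BrauerDiagram n) {a b : Fin n ⊕ Fin n} : γ.pair a = b ↔ a = γ.pair b :=
  ⟨fun h => by rw [← h, γ.pair_pair], fun h => by rw [h, γ.pair_pair]⟩

/-- The diagram obtained by moving the vertices of `γ` by `τ`. -/
def conj (τ : Equiv.Perm (Fin n ⊕ Fin n)) (γ : BrauerDiagram n) : BrauerDiagram n where
  pair v := τ (γ.pair (τ.symm v))
  pair_pair v := by simp [γ.pair_pair]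
  pair_ne v h := γ.pair_ne (τ.symm v) (by rw [Equiv.eq_symm_apply]; exact h)

@[simp]
theorem conj_pair (τ : Equiv.Perm (Fin n ⊕ Fin n)) (γ : BrauerDiagram n) (v : Fin n ⊕ Fin n) :
    (conj τ γ).pair v = τ (γ.pair (τ.symm v)) := rfl

/-- The permutation of the vertices that moves the top vertices by `σ`. -/
def topPerm (σ : Equiv.Perm (Fin n)) : Equiv.Perm (Fin n ⊕ Fin n) := Equiv.sumCongr σ 1

@[simp] theorem topPerm_inl (σ : Equiv.Perm (Fin n)) (i : Fin n) :
    topPerm σ (Sum.inl i) = Sum.inl (σ i) := rfl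

@[simp] theorem topPerm_inr (σ : Equiv.Perm (Fin n)) (i : Fin n) :
    topPerm σ (Sum.inr i) = Sum.inr i := rfl

@[simp] theorem topPerm_symm_inl (σ : Equiv.Perm (Fin n)) (i : Fin n) :
    (topPerm σ).symm (Sum.inl i) = Sum.inl (σ.symm i) := rfl

@[simp] theorem topPerm_symm_inr (σ : Equiv.Perm (Fin n)) (i : Fin n) :
    (topPerm σ).symm (Sum.inr i) = Sum.inr i := rfl

/-- The diagram without horizontal edges that belongs to a permutation. -/
def ofPerm (σ : Equiv.Perm (Fin n)) : BrauerDiagram n := conj (topPerm σ) (one n)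

@[simp] theorem ofPerm_pair_inl (σ : Equiv.Perm (Fin n)) (i : Fin n) :
    (ofPerm σ).pair (Sum.inl i) = Sum.inr (σ.symm i) := rfl

@[simp] theorem ofPerm_pair_inr (σ : Equiv.Perm (Fin n)) (i : Fin n) :
    (ofPerm σ).pair (Sum.inr i) = Sum.inl (σ i) := rfl

theorem transp_eq_ofPerm (k l : Fin n) : transp k l = ofPerm (Equiv.swap k l) := by
  ext1; funext v
  rcases v with i | i <;> simp [transp]

/-- The diagram in which `a` is joined with `b`, and the former partners of `a` and `b` are joined
with each other. -/
def join (a b : Fin n ⊕ Fin n) (hab : a ≠ b) (γ : BrauerDiagram n) : BrauerDiagram n where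
  pair v := if v = a then b else if v = b then a else if v = γ.pair a then γ.pair b
    else if v = γ.pair b then γ.pair a else γ.pair v
  pair_pair v := by
    have h1 := γ.pair_pair; have h2 := γ.pair_ne
    grind
  pair_ne v := by
    have h1 := γ.pair_pair; have h2 := γ.pair_ne
    grind

theorem join_pair (a b : Fin n ⊕ Fin n) (hab : a ≠ b) (γ : BrauerDiagram n) (v : Fin n ⊕ Fin n) :
    (join a b hab γ).pair v = if v = a then b else if v = b then a else if v = γ.pair a then γ.pair b
    else if v = γ.pair b then γ.pair a else γ.pair v := rfl

theorem join_eq_self {a b : Fin n ⊕ Fin n} (hab : a ≠ b) {γ : BrauerDiagram n}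
    (h : γ.pair a = b) : join a b hab γ = γ := by
  ext1; funext v
  have h1 := γ.pair_pair
  rw [join_pair]
  grind

theorem inl_ne_inl {k l : Fin n} (h : k ≠ l) : (Sum.inl k : Fin n ⊕ Fin n) ≠ Sum.inl l := by
  simpa using h

/-- The reflection of a diagram that exchanges top and bottom. -/
def flip (γ : BrauerDiagram n) : BrauerDiagram n where
  pair v := (γ.pair v.swap).swap
  pair_pair v := by simp [γ.pair_pair]
  pair_ne v h := γ.pair_ne v.swap (by rw [← Sum.swap_swap (γ.pair v.swap), h])

@[simp] theorem flip_pair (γ : BrauerDiagram n) (v : Fin n ⊕ Fin n) :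
    (flip γ).pair v = (γ.pair v.swap).swap := rfl

@[simp] theorem flip_flip (γ : BrauerDiagram n) : flip (flip γ) = γ := by
  ext1; funext v; simp

@[simp] theorem flip_transp (k l : Fin n) : flip (transp k l) = transp k l := by
  ext1; funext v
  rcases v with i | i <;> simp [transp]

@[simp] theorem flip_cupcap (k l : Fin n) : flip (cupcap k l) = cupcap k l := by
  ext1; funext v
  rcases v with i | i <;> simp only [cupcap, flip_pair, Sum.swap_inl, Sum.swap_inr, Sum.elim_inl,
    Sum.elim_inr] <;> split_ifs <;> rfl

@[simp] theorem flip_one : flip (one n) = one n := by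
  ext1; funext v; simp [one]

/-! ### Composition with particular diagrams -/

theorem compat_flip (γ : BrauerDiagram n) (x y : Fin n → Bool) :
    Compat (flip γ) (Sum.elim x y) ↔ Compat γ (Sum.elim y x) := by
  have h : ∀ v, Sum.elim x y v.swap = Sum.elim y x v := by rintro (i | i) <;> rfl
  constructor
  · intro hc a
    have := hc a.swap
    rwa [flip_pair, Sum.swap_swap, h, h] at this
  · intro hc a
    have := hc a.swap
    rw [← h, ← h, Sum.swap_swap] at this
    exact this

theorem mat_flip (γ : BrauerDiagram n) : mat (flip γ) = (mat γ).transpose := by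
  classical
  ext x y
  simp only [mat, Matrix.transpose_apply, compat_flip]

/-- Reflection transposes the matrix of a diagram, and `mat_inj` recovers both the composition and
the number of loops from a product of matrices. The same comparison of matrices gives `ofPerm_comp`
and `cupcap_comp`, with no inspection of glued graphs. -/
theorem comp_flip (γ γ' : BrauerDiagram n) :
    loops (flip γ) (flip γ') = loops γ' γ ∧ comp (flip γ) (flip γ') = flip (comp γ' γ) := by
  apply mat_inj
  rw [← mat_mul, mat_flip, mat_flip, ← Matrix.transpose_mul, mat_mul, mat_flip,
    Matrix.transpose_smul]

theorem compat_ofPerm (σ : Equiv.Perm (Fin n)) (x y : Fin n → Bool) :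
    Compat (ofPerm σ) (Sum.elim x y) ↔ y = x ∘ σ := by
  constructor
  · intro h; funext i; exact (h (Sum.inr i)).symm
  · rintro rfl (i | i) <;> simp

theorem compat_conj_topPerm (σ : Equiv.Perm (Fin n)) (γ : BrauerDiagram n) (x y : Fin n → Bool) :
    Compat (conj (topPerm σ) γ) (Sum.elim x y) ↔ Compat γ (Sum.elim (x ∘ σ) y) := by
  have h : ∀ v, Sum.elim x y (topPerm σ v) = Sum.elim (x ∘ σ) y v := by rintro (i | i) <;> rfl
  constructor
  · intro hc a
    have := hc (topPerm σ a)
    rwa [conj_pair, Equiv.symm_apply_apply, h, h] at this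
  · intro hc a
    have := hc ((topPerm σ).symm a)
    rwa [← h, ← h, Equiv.apply_symm_apply] at this

theorem ofPerm_comp (σ : Equiv.Perm (Fin n)) (γ : BrauerDiagram n) :
    loops (ofPerm σ) γ = 0 ∧ comp (ofPerm σ) γ = conj (topPerm σ) γ := by
  classical
  apply mat_inj
  rw [← mat_mul, pow_zero, one_smul]
  ext x z
  rw [Matrix.mul_apply, Finset.sum_eq_single (x ∘ σ)]
  · simp [mat, compat_ofPerm, compat_conj_topPerm]
  · intro y _ hy
    simp [mat, compat_ofPerm, hy]
  · simp

theorem compat_cupcap {k l : Fin n} (hkl : k ≠ l) (x y : Fin n → Bool) :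
    Compat (cupcap k l) (Sum.elim x y) ↔ x k = x l ∧ ∃ c, y = fun i =>
      if i = k ∨ i = l then c else x i := by
  have hs : ∀ i, Equiv.swap k l i = i ↔ ¬ (i = k ∨ i = l) := by
    intro i
    by_cases hk : i = k
    · subst hk; simp [hkl.symm]
    · by_cases hl : i = l
      · subst hl; simp [hkl]
      · simp [hk, hl, Equiv.swap_apply_of_ne_of_ne]
  constructor
  · intro h
    refine ⟨?_, y k, ?_⟩
    · have := h (Sum.inl l)
      simpa [cupcap, hkl] using this
    · funext i
      by_cases hi : i = k ∨ i = l
      · simp only [hi, if_true]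
        rcases hi with rfl | rfl
        · rfl
        · have := h (Sum.inr k)
          simpa [cupcap, hkl.symm] using this
      · have := h (Sum.inl i)
        simp only [cupcap, Sum.elim_inl, (hs i).2 hi, if_true, Sum.elim_inr] at this
        simp [hi, this]
  · rintro ⟨h, c, rfl⟩ (i | i)
    · by_cases hi : i = k ∨ i = l
      · have := (hs i).not_left.2 hi
        simp only [cupcap, Sum.elim_inl, this, if_false]
        rcases hi with rfl | rfl <;> simp [h]
      · simp [cupcap, (hs i).2 hi, hi]
    · by_cases hi : i = k ∨ i = l
      · have := (hs i).not_left.2 hi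
        simp only [cupcap, Sum.elim_inr, this, if_false]
        rcases hi with rfl | rfl <;> simp
      · simp [cupcap, (hs i).2 hi, hi]

theorem compat_join {a b : Fin n ⊕ Fin n} (hab : a ≠ b) {γ : BrauerDiagram n} (h : γ.pair a ≠ b)
    (w : Fin n ⊕ Fin n → Bool) :
    Compat (join a b hab γ) w ↔ w a = w b ∧ w (γ.pair a) = w (γ.pair b) ∧
      ∀ v, v ≠ a → v ≠ b → v ≠ γ.pair a → v ≠ γ.pair b → w (γ.pair v) = w v := by
  have h1 := γ.pair_pair; have h2 := γ.pair_ne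
  constructor
  · intro hc
    refine ⟨?_, ?_, ?_⟩
    · have := hc a; rw [join_pair] at this; grind
    · have := hc (γ.pair a); rw [join_pair] at this; grind
    · intro v _ _ _ _
      have := hc v; rw [join_pair] at this; grind
  · rintro ⟨hc1, hc2, hc3⟩ v
    rw [join_pair]
    grind

-- The left side counts the colours of the lower horizontal edge of `cupcap k l` that are compatible
-- with `γ`. If `γ` also joins `k` and `l`, this edge closes to a loop and both colours do or
-- neither. Otherwise the colour is forced to be that of the partner of `k` in `γ`.
open Classical in
theorem cupcap_comp_aux {k l : Fin n} (hkl : k ≠ l) (γ : BrauerDiagram n) (w : Fin n ⊕ Fin n → Bool)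
    (hw : w (Sum.inl k) = w (Sum.inl l)) :
    (if Compat γ (fun v => if v = Sum.inl k ∨ v = Sum.inl l then true else w v) then 1 else 0) +
    (if Compat γ (fun v => if v = Sum.inl k ∨ v = Sum.inl l then false else w v) then 1 else 0) =
    (if γ.pair (Sum.inl k) = Sum.inl l then 2 else 1) *
      if Compat (join _ _ (inl_ne_inl hkl) γ) w then 1 else 0 := by
  have h1 := γ.pair_pair; have h2 := γ.pair_ne
  by_cases h : γ.pair (Sum.inl k) = Sum.inl l
  · have hc : ∀ c, Compat γ (fun v => if v = Sum.inl k ∨ v = Sum.inl l then c else w v) ↔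
        Compat γ w := by
      intro c
      refine forall_congr' fun v => ?_
      grind
    rw [hc, hc, join_eq_self _ h, if_pos h]
    split_ifs <;> rfl
  · have hc : ∀ c, Compat γ (fun v => if v = Sum.inl k ∨ v = Sum.inl l then c else w v) ↔
        (w (γ.pair (Sum.inl k)) = c ∧ Compat (join _ _ (inl_ne_inl hkl) γ) w) := by
      intro c
      rw [compat_join _ h]
      have hkl' := inl_ne_inl hkl
      constructor
      · intro hc
        have e1 := hc (Sum.inl k)
        have e2 := hc (Sum.inl l)
        refine ⟨by grind, hw, by grind, fun v _ _ _ _ => ?_⟩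
        have e3 := hc v
        grind
      · rintro ⟨e1, -, e2, e3⟩ v
        have := e3 v
        by_cases a1 : v = γ.pair (Sum.inl k)
        · grind
        · by_cases a2 : v = γ.pair (Sum.inl l) <;> grind
    rw [hc, hc, if_neg h]
    cases w (γ.pair (Sum.inl k)) <;> simp

theorem cupcap_comp {k l : Fin n} (hkl : k ≠ l) (γ : BrauerDiagram n) :
    loops (cupcap k l) γ = (if γ.pair (Sum.inl k) = Sum.inl l then 1 else 0) ∧
      comp (cupcap k l) γ = join _ _ (inl_ne_inl hkl) γ := by
  classical
  apply mat_inj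
  rw [← mat_mul]
  ext x z
  have hu : ∀ c : Bool, Sum.elim (fun i => if i = k ∨ i = l then c else x i) z =
      fun v => if v = Sum.inl k ∨ v = Sum.inl l then c else Sum.elim x z v := by
    intro c; funext v; rcases v with i | i <;> simp
  have hpow : (2 : ℕ) ^ (if γ.pair (Sum.inl k) = Sum.inl l then 1 else 0) =
      if γ.pair (Sum.inl k) = Sum.inl l then 2 else 1 := by split_ifs <;> rfl
  rw [Matrix.mul_apply, Matrix.smul_apply, hpow, smul_eq_mul]
  by_cases hx : x k = x l
  -- The middle colouring agrees with `x` off `k`, `l` and is constant on these two strands, so only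
  -- two summands survive.
  · rw [Finset.sum_eq_add (fun i => if i = k ∨ i = l then true else x i)
      (fun i => if i = k ∨ i = l then false else x i)]
    · have h0 : ∀ c, mat (cupcap k l) x (fun i => if i = k ∨ i = l then c else x i) = 1 := by
        intro c; rw [mat, if_pos]; exact (compat_cupcap hkl _ _).2 ⟨hx, c, rfl⟩
      rw [h0, h0, one_mul, one_mul]
      have := cupcap_comp_aux hkl γ (Sum.elim x z) hx
      rw [← hu, ← hu] at this
      exact this
    · intro h
      have := congrFun h k
      simp at this
    · intro y _ hy
      rw [mat, if_neg, zero_mul]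
      rw [compat_cupcap hkl]
      rintro ⟨-, c, rfl⟩
      cases c
      · exact hy.2 rfl
      · exact hy.1 rfl
    · simp
    · simp
  · rw [Finset.sum_eq_zero]
    · suffices h : mat (join _ _ (inl_ne_inl hkl) γ) x z = 0 by rw [h, mul_zero]
      rw [mat, if_neg]
      intro hc
      have := hc (Sum.inl l)
      rw [join_pair] at this
      simp only [inl_ne_inl (Ne.symm hkl), if_true, if_false] at this
      exact hx this
    · intro y _
      rw [mat, if_neg, zero_mul]
      rw [compat_cupcap hkl]
      exact fun h => hx h.1

theorem ofPerm_mul (σ τ : Equiv.Perm (Fin n)) : comp (ofPerm σ) (ofPerm τ) = ofPerm (σ * τ) := by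
  rw [(ofPerm_comp _ _).2]
  ext1; funext v
  rcases v with i | i <;> rfl

theorem flip_ofPerm (σ : Equiv.Perm (Fin n)) : flip (ofPerm σ) = ofPerm σ⁻¹ := by
  ext1; funext v
  rcases v with i | i <;> rfl

/-- The permutation of the vertices that moves the bottom vertices by `σ`. -/
def botPerm (σ : Equiv.Perm (Fin n)) : Equiv.Perm (Fin n ⊕ Fin n) := Equiv.sumCongr 1 σ

@[simp] theorem botPerm_inl (σ : Equiv.Perm (Fin n)) (i : Fin n) :
    botPerm σ (Sum.inl i) = Sum.inl i := rfl

@[simp] theorem botPerm_inr (σ : Equiv.Perm (Fin n)) (i : Fin n) :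
    botPerm σ (Sum.inr i) = Sum.inr (σ i) := rfl

@[simp] theorem botPerm_symm_inl (σ : Equiv.Perm (Fin n)) (i : Fin n) :
    (botPerm σ).symm (Sum.inl i) = Sum.inl i := rfl

@[simp] theorem botPerm_symm_inr (σ : Equiv.Perm (Fin n)) (i : Fin n) :
    (botPerm σ).symm (Sum.inr i) = Sum.inr (σ.symm i) := rfl

theorem comp_ofPerm (σ : Equiv.Perm (Fin n)) (γ : BrauerDiagram n) :
    loops γ (ofPerm σ) = 0 ∧ comp γ (ofPerm σ) = conj (botPerm σ⁻¹) γ := by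
  have h2 := ofPerm_comp σ⁻¹ (flip γ)
  have h3 := comp_flip (flip γ) (ofPerm σ⁻¹)
  rw [flip_flip, flip_ofPerm, inv_inv] at h3
  refine ⟨h3.1.trans h2.1, h3.2.trans ?_⟩
  rw [h2.2]
  have hs : ∀ u : Fin n ⊕ Fin n, (topPerm σ⁻¹ u.swap).swap = botPerm σ⁻¹ u := by
    rintro (i | i) <;> rfl
  ext1; funext v
  rcases v with i | i <;> exact hs _

theorem transp_comp (k l : Fin n) (γ : BrauerDiagram n) :
    loops (transp k l) γ = 0 ∧ comp (transp k l) γ = conj (topPerm (Equiv.swap k l)) γ := by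
  rw [transp_eq_ofPerm]; exact ofPerm_comp _ _

theorem comp_transp (k l : Fin n) (γ : BrauerDiagram n) :
    loops γ (transp k l) = 0 ∧ comp γ (transp k l) = conj (botPerm (Equiv.swap k l)) γ := by
  rw [transp_eq_ofPerm]
  have := comp_ofPerm (Equiv.swap k l) γ
  rwa [Equiv.swap_inv] at this

/-! ### Adding vertical edges -/

section Embed

variable {p q : ℕ} (f : Fin p ↪ Fin q)

theorem map_map_injective : Function.Injective (Sum.map f f) :=
  Sum.map_injective.2 ⟨f.injective, f.injective⟩

/-- The diagram on the strands of `f` that is copied from `γ`; the other strands are vertical. -/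
noncomputable def embed (γ : BrauerDiagram p) : BrauerDiagram q :=
  open Classical in
  { pair := fun v => if h : ∃ u, Sum.map f f u = v then Sum.map f f (γ.pair h.choose) else v.swap
    pair_pair := by
      intro v
      by_cases h : ∃ u, Sum.map f f u = v
      · have h' : ∃ u, Sum.map f f u = Sum.map f f (γ.pair h.choose) := ⟨_, rfl⟩
        rw [dif_pos h, dif_pos h', map_map_injective f h'.choose_spec, γ.pair_pair, h.choose_spec]
      · have h' : ¬ ∃ u, Sum.map f f u = v.swap := by
          rintro ⟨u, hu⟩
          exact h ⟨u.swap, by rw [← Sum.swap_swap v, ← hu]; cases u <;> rfl⟩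
        rw [dif_neg h, dif_neg h', Sum.swap_swap]
    pair_ne := by
      intro v
      by_cases h : ∃ u, Sum.map f f u = v
      · rw [dif_pos h]
        intro h'
        have := h.choose_spec
        exact γ.pair_ne _ (map_map_injective f (h'.trans this.symm))
      · rw [dif_neg h]
        cases v <;> simp }

@[simp] theorem embed_pair_map (γ : BrauerDiagram p) (u : Fin p ⊕ Fin p) :
    (embed f γ).pair (Sum.map f f u) = Sum.map f f (γ.pair u) := by
  classical
  have h : ∃ u', Sum.map f f u' = Sum.map f f u := ⟨u, rfl⟩
  change (if h : ∃ u', Sum.map f f u' = Sum.map f f u then _ else _) = _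
  rw [dif_pos h, map_map_injective f h.choose_spec]

@[simp] theorem embed_pair_inl (γ : BrauerDiagram p) (i : Fin p) :
    (embed f γ).pair (Sum.inl (f i)) = Sum.map f f (γ.pair (Sum.inl i)) :=
  embed_pair_map f γ (Sum.inl i)

theorem embed_pair_off (γ : BrauerDiagram p) {v : Fin q ⊕ Fin q}
    (h : ∀ u, Sum.map f f u ≠ v) : (embed f γ).pair v = v.swap := by
  change (if h : ∃ u', Sum.map f f u' = v then _ else _) = _
  rw [dif_neg]
  rintro ⟨u, hu⟩
  exact h u hu

theorem exists_map_or (v : Fin q ⊕ Fin q) :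
    (∃ u, Sum.map f f u = v) ∨ ((∀ u, Sum.map f f u ≠ v) ∧ ∀ u, Sum.map f f u ≠ v.swap) := by
  by_cases h : ∃ u, Sum.map f f u = v
  · exact Or.inl h
  · refine Or.inr ⟨fun u hu => h ⟨u, hu⟩, fun u hu => h ⟨u.swap, ?_⟩⟩
    rw [← Sum.swap_swap v, ← hu]; cases u <;> rfl

theorem eq_embed {δ : BrauerDiagram q} {γ : BrauerDiagram p}
    (h1 : ∀ u, δ.pair (Sum.map f f u) = Sum.map f f (γ.pair u))
    (h2 : ∀ v, (∀ u, Sum.map f f u ≠ v) → δ.pair v = v.swap) : δ = embed f γ := by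
  ext1; funext v
  rcases exists_map_or f v with ⟨u, rfl⟩ | h
  · rw [h1, embed_pair_map]
  · rw [h2 v h.1, embed_pair_off f γ h.1]

@[simp] theorem embed_one : embed f (one p) = one q := by
  refine (eq_embed f (fun u => ?_) fun v _ => rfl).symm
  rcases u with i | i <;> rfl

theorem embed_conj_swap (k l : Fin p) (γ : BrauerDiagram p) :
    embed f (conj (topPerm (Equiv.swap k l)) γ) =
      conj (topPerm (Equiv.swap (f k) (f l))) (embed f γ) := by
  have key : ∀ u, topPerm (Equiv.swap (f k) (f l)) (Sum.map f f u) =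
      Sum.map f f (topPerm (Equiv.swap k l) u) := by
    rintro (i | i)
    · simp [Function.Embedding.swap_apply]
    · rfl
  have key' : ∀ u, (topPerm (Equiv.swap (f k) (f l))).symm (Sum.map f f u) =
      Sum.map f f ((topPerm (Equiv.swap k l)).symm u) := by
    intro u
    rw [Equiv.symm_apply_eq, key, Equiv.apply_symm_apply]
  have off : ∀ v, (∀ u, Sum.map f f u ≠ v) → topPerm (Equiv.swap (f k) (f l)) v = v := by
    rintro (i | i) hv
    · rw [topPerm_inl, Equiv.swap_apply_of_ne_of_ne]
      · exact fun h => hv (Sum.inl k) (by simp [h])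
      · exact fun h => hv (Sum.inl l) (by simp [h])
    · rfl
  refine (eq_embed f (fun u => ?_) fun v hv => ?_).symm
  · rw [conj_pair, key', embed_pair_map, key, conj_pair]
  · have hv' : ∀ u, Sum.map f f u ≠ v.swap := by
      rcases exists_map_or f v with ⟨u, hu⟩ | h
      · exact absurd hu (hv u)
      · exact h.2
    have e : (topPerm (Equiv.swap (f k) (f l))).symm v = v := by
      rw [Equiv.symm_apply_eq, off v hv]
    rw [conj_pair, e, embed_pair_off f γ hv, off _ hv']

theorem embed_join {a b : Fin p ⊕ Fin p} (hab : a ≠ b) (γ : BrauerDiagram p) :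
    embed f (join a b hab γ) =
      join (Sum.map f f a) (Sum.map f f b) ((map_map_injective f).ne hab) (embed f γ) := by
  have hinj := map_map_injective f
  refine (eq_embed f (fun u => ?_) fun v hv => ?_).symm
  · simp only [join_pair, embed_pair_map, hinj.eq_iff]
    split_ifs <;> rfl
  · simp only [join_pair, embed_pair_map, fun u => (hv u).symm, if_false, embed_pair_off f γ hv]

theorem embed_transp (k l : Fin p) : embed f (transp k l) = transp (f k) (f l) := by
  rw [transp_eq_ofPerm, ofPerm, embed_conj_swap, embed_one, transp_eq_ofPerm, ofPerm]

theorem cupcap_eq_join {k l : Fin n} (h : k ≠ l) :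
    cupcap k l = join _ _ (inl_ne_inl h) (one n) := by
  rw [← (cupcap_comp h (one n)).2, (comp_one _).2]

theorem embed_cupcap {k l : Fin p} (h : k ≠ l) : embed f (cupcap k l) = cupcap (f k) (f l) := by
  rw [cupcap_eq_join h, embed_join, embed_one, cupcap_eq_join (f.injective.ne h)]
  rfl

end Embed

theorem extend_eq_embed {m : ℕ} (r : ℕ) (γ : BrauerDiagram m) :
    γ.extend r = embed (Fin.castAddEmb r) γ := by
  refine eq_embed _ ?_ ?_
  · rintro (i | i) <;> simp [extend]
  · rintro (i | i) h
    · induction i using Fin.addCases with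
      | left i => exact absurd rfl (h (Sum.inl i))
      | right i => simp [extend]
    · induction i using Fin.addCases with
      | left i => exact absurd rfl (h (Sum.inr i))
      | right i => simp [extend]

end BrauerDiagram

/-! ### Every diagram is a product of s_k and s̄_k in which no loops arise. -/

namespace BrauerDiagram

variable {n : ℕ}

/-! ### Generation by the diagrams of neighbouring strands -/

/-- The diagrams that are obtained from the identity by composition on the left with `s_k`, `s̄_k`
without producing loops. -/
inductive Generated : BrauerDiagram n → Prop
  | one : Generated (one n)
  | transp (k : ℕ) (hk : k + 1 < n) (γ : BrauerDiagram n) (h : Generated γ) :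
      Generated (conj (topPerm (Equiv.swap ⟨k, Nat.lt_of_succ_lt hk⟩ ⟨k + 1, hk⟩)) γ)
  | cupcap (k : ℕ) (hk : k + 1 < n) (γ : BrauerDiagram n) (h : Generated γ)
      (hl : γ.pair (Sum.inl ⟨k, Nat.lt_of_succ_lt hk⟩) ≠ Sum.inl ⟨k + 1, hk⟩) :
      Generated (join (Sum.inl ⟨k, Nat.lt_of_succ_lt hk⟩) (Sum.inl ⟨k + 1, hk⟩) (by simp) γ)

/-- Associativity moves the generators of `γ` onto the product one at a time. A factor s̄_k that
would close a loop leaves the diagram unchanged, so it is omitted. -/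
theorem Generated.comp {γ γ' : BrauerDiagram n} (h : Generated γ) (h' : Generated γ') :
    Generated (comp γ γ') := by
  induction h with
  | one => rwa [(one_comp _).2]
  | transp k hk γ _ ih =>
    rw [← (transp_comp _ _ _).2, (comp_assoc _ _ _).2, (transp_comp _ _ _).2]
    exact ih.transp k hk _
  | cupcap k hk γ _ _ ih =>
    have hne : (⟨k, Nat.lt_of_succ_lt hk⟩ : Fin n) ≠ ⟨k + 1, hk⟩ := by simp
    rw [← (cupcap_comp hne _).2, (comp_assoc _ _ _).2, (cupcap_comp hne _).2]
    by_cases hl : (BrauerDiagram.comp γ γ').pair (Sum.inl ⟨k, Nat.lt_of_succ_lt hk⟩) =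
        Sum.inl ⟨k + 1, hk⟩
    · rwa [join_eq_self _ hl]
    · exact ih.cupcap k hk _ hl

theorem generated_ofPerm (σ : Equiv.Perm (Fin n)) : Generated (ofPerm σ) := by
  have h1 : ofPerm (1 : Equiv.Perm (Fin n)) = one n := by
    ext1; funext v; rcases v with i | i <;> rfl
  rcases n with _ | n
  · rw [Subsingleton.elim σ 1, h1]; exact .one
  · have hσ : σ ∈ Submonoid.closure (Set.range fun i : Fin n => Equiv.swap i.castSucc i.succ) := by
      rw [Equiv.Perm.mclosure_swap_castSucc_succ]; trivial
    induction hσ using Submonoid.closure_induction with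
    | mem σ h =>
      obtain ⟨i, rfl⟩ := h
      exact Generated.one.transp i (by omega) _
    | one => rw [h1]; exact .one
    | mul σ τ _ _ hs ht => rw [← ofPerm_mul]; exact hs.comp ht

theorem exists_perm_two {i j : Fin n} {i' j' : Fin n} (h : i ≠ j) (h' : i' ≠ j') :
    ∃ σ : Equiv.Perm (Fin n), σ i = i' ∧ σ j = j' := by
  refine ⟨Equiv.swap (Equiv.swap i i' j) j' * Equiv.swap i i', ?_, ?_⟩
  · rw [Equiv.Perm.mul_apply, Equiv.swap_apply_left, Equiv.swap_apply_of_ne_of_ne _ h']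
    intro h1
    have h2 : Equiv.swap i i' i = Equiv.swap i i' j := by rw [Equiv.swap_apply_left, ← h1]
    exact h ((Equiv.swap i i').injective h2)
  · simp

theorem conj_join (τ : Equiv.Perm (Fin n ⊕ Fin n)) {a b : Fin n ⊕ Fin n} (hab : a ≠ b)
    (γ : BrauerDiagram n) :
    conj τ (join a b hab γ) = join (τ a) (τ b) (τ.injective.ne hab) (conj τ γ) := by
  ext1; funext v
  obtain ⟨u, rfl⟩ := τ.surjective v
  simp only [conj_pair, join_pair, Equiv.symm_apply_apply, τ.injective.eq_iff]
  split_ifs <;> rfl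

theorem conj_comp_cupcap (σ : Equiv.Perm (Fin n)) {k l : Fin n} (h : k ≠ l) :
    comp (ofPerm σ) (cupcap k l) = comp (cupcap (σ k) (σ l)) (ofPerm σ) := by
  rw [(ofPerm_comp _ _).2, (cupcap_comp (σ.injective.ne h) _).2, cupcap_eq_join h, conj_join]
  rfl

/-- All the diagrams `cupcap i j` are conjugate under permutations to the one on the first two
strands. -/
theorem generated_cupcap {i j : Fin n} (h : i ≠ j) : Generated (cupcap i j) := by
  rcases n with _ | _ | n
  · exact i.elim0
  · exact absurd (Fin.ext (by omega)) h
  · have h01 : (⟨0, by omega⟩ : Fin (n + 2)) ≠ ⟨1, by omega⟩ := by simp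
    obtain ⟨σ, h1, h2⟩ := exists_perm_two h01 h
    have hg : Generated (cupcap (⟨0, by omega⟩ : Fin (n + 2)) ⟨1, by omega⟩) := by
      rw [cupcap_eq_join h01]
      exact Generated.one.cupcap 0 (by omega) _ (by simp [one])
    have := ((generated_ofPerm σ).comp hg).comp (generated_ofPerm σ⁻¹)
    rw [conj_comp_cupcap σ h01, h1, h2, (comp_assoc _ _ _).2, ofPerm_mul, mul_inv_cancel] at this
    have e : ofPerm (1 : Equiv.Perm (Fin (n + 2))) = one (n + 2) := by
      ext1; funext v; rcases v with i | i <;> rfl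
    rwa [e, (comp_one _).2] at this

theorem Generated.embed_castSucc {γ : BrauerDiagram n} (h : Generated γ) :
    Generated (embed Fin.castSuccEmb γ) := by
  induction h with
  | one => rw [embed_one]; exact .one
  | transp k hk γ _ ih =>
    rw [embed_conj_swap]
    exact ih.transp k (by omega) _
  | cupcap k hk γ _ hl ih =>
    rw [embed_join]
    refine ih.cupcap k (by omega) _ ?_
    rw [show (⟨k, by omega⟩ : Fin (n + 1)) = Fin.castSuccEmb ⟨k, Nat.lt_of_succ_lt hk⟩ from rfl,
      show (⟨k + 1, by omega⟩ : Fin (n + 1)) = Fin.castSuccEmb ⟨k + 1, hk⟩ from rfl,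
      embed_pair_inl]
    intro h
    exact hl (map_map_injective Fin.castSuccEmb h)

/-! ### Splitting off the last strand -/

theorem exists_embed_of_vertical {δ : BrauerDiagram (n + 1)}
    (h : δ.pair (Sum.inl (Fin.last n)) = Sum.inr (Fin.last n)) :
    ∃ γ, δ = embed Fin.castSuccEmb γ := by
  have h' : δ.pair (Sum.inr (Fin.last n)) = Sum.inl (Fin.last n) := by
    rw [← h, δ.pair_pair]
  have hlast : ∀ v : Fin (n + 1) ⊕ Fin (n + 1), (∃ u, Sum.map Fin.castSuccEmb Fin.castSuccEmb u = v)
      ∨ v = Sum.inl (Fin.last n) ∨ v = Sum.inr (Fin.last n) := by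
    rintro (i | i)
    · induction i using Fin.lastCases with
      | last => simp
      | cast i => exact Or.inl ⟨Sum.inl i, rfl⟩
    · induction i using Fin.lastCases with
      | last => simp
      | cast i => exact Or.inl ⟨Sum.inr i, rfl⟩
  have hno : ∀ u : Fin n ⊕ Fin n, Sum.map Fin.castSuccEmb Fin.castSuccEmb u ≠
      (Sum.inl (Fin.last n) : Fin (n + 1) ⊕ Fin (n + 1)) ∧
      Sum.map Fin.castSuccEmb Fin.castSuccEmb u ≠
      (Sum.inr (Fin.last n) : Fin (n + 1) ⊕ Fin (n + 1)) := by
    rintro (i | i) <;> simp [Fin.castSucc_ne_last]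
  have hex : ∀ u : Fin n ⊕ Fin n, ∃ u', Sum.map Fin.castSuccEmb Fin.castSuccEmb u' =
      δ.pair (Sum.map Fin.castSuccEmb Fin.castSuccEmb u) := by
    intro u
    rcases hlast (δ.pair (Sum.map Fin.castSuccEmb Fin.castSuccEmb u)) with h1 | h1 | h1
    · exact h1
    · rw [pair_eq_iff, h] at h1; exact absurd h1 (hno u).2
    · rw [pair_eq_iff, h'] at h1; exact absurd h1 (hno u).1
  choose g hg using hex
  have hinj := map_map_injective (Fin.castSuccEmb (n := n))
  refine ⟨⟨g, fun a => hinj ?_, fun a ha => ?_⟩, eq_embed _ (fun u => (hg u).symm) fun v hv => ?_⟩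
  · rw [hg, hg, δ.pair_pair]
  · exact δ.pair_ne _ ((hg a).symm.trans (by rw [ha]))
  · rcases hlast v with ⟨u, hu⟩ | rfl | rfl
    · exact absurd hu (hv u)
    · exact h
    · exact h'

/-- The cases are distinguished by the partners of the two last vertices; one transposition or one
pair of horizontal edges makes the last strand vertical. This serves the induction in `generated`
and the closing of the last strand in `exists_c_mul_inc_mul_c`. -/
theorem last_strand_cases (δ : BrauerDiagram (n + 1)) : ∃ γ : BrauerDiagram n,
    δ = embed Fin.castSuccEmb γ ∨
    (∃ j : Fin n, δ = comp (transp (Fin.last n) j.castSucc) (embed Fin.castSuccEmb γ)) ∨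
    (∃ j : Fin n, δ = comp (embed Fin.castSuccEmb γ) (transp (Fin.last n) j.castSucc)) ∨
    (∃ j : Fin n, δ = comp (cupcap (Fin.last n) j.castSucc) (embed Fin.castSuccEmb γ)) := by
  have hcast : ∀ j : Fin (n + 1), j ≠ Fin.last n → ∃ i : Fin n, j = i.castSucc := by
    intro j hj
    exact ⟨j.castPred hj, by simp⟩
  rcases h : δ.pair (Sum.inl (Fin.last n)) with j | j
  · rcases h' : δ.pair (Sum.inr (Fin.last n)) with i | i
    · have hi : i ≠ Fin.last n := by
        rintro rfl
        rw [pair_eq_iff, h] at h'; simp at h'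
      obtain ⟨i, rfl⟩ := hcast i hi
      obtain ⟨γ, hγ⟩ := exists_embed_of_vertical
        (δ := conj (topPerm (Equiv.swap (Fin.last n) i.castSucc)) δ) (by
          rw [pair_eq_iff] at h'
          simp [← h'])
      refine ⟨γ, Or.inr (Or.inl ⟨i, ?_⟩)⟩
      rw [(transp_comp _ _ _).2, ← hγ]
      ext1; funext v
      rcases v with v | v <;> simp only [conj_pair, topPerm_symm_inl, topPerm_symm_inr,
        Equiv.symm_swap, Equiv.swap_apply_self]
      all_goals rcases δ.pair _ <;> simp
    · have hi : i ≠ Fin.last n := by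
        rintro rfl
        exact δ.pair_ne _ h'
      have hj : j ≠ Fin.last n := by
        rintro rfl
        exact δ.pair_ne _ h
      obtain ⟨j, rfl⟩ := hcast j hj
      have hne : (Sum.inl (Fin.last n) : Fin (n + 1) ⊕ Fin (n + 1)) ≠ Sum.inr (Fin.last n) := by
        simp
      -- The last top vertex is joined with the top of `j` and the last bottom vertex with the
      -- bottom of `i`. Joining the two last vertices makes `{j, ī}` an edge, and the horizontal
      -- edge at `last`, `j` undoes this.
      obtain ⟨γ, hγ⟩ := exists_embed_of_vertical (δ := join _ _ hne δ) (by simp [join_pair])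
      refine ⟨γ, Or.inr (Or.inr (Or.inr ⟨j, ?_⟩))⟩
      rw [(cupcap_comp (Ne.symm (Fin.castSucc_ne_last j)) _).2, ← hγ]
      have h1 := δ.pair_pair
      have h2 : (Sum.inl (Fin.last n) : Fin (n + 1) ⊕ Fin (n + 1)) ≠ Sum.inl j.castSucc := by
        simpa using (Ne.symm (Fin.castSucc_ne_last j))
      ext1; funext v
      simp only [join_pair]
      grind
  · by_cases hj : j = Fin.last n
    · subst hj
      obtain ⟨γ, hγ⟩ := exists_embed_of_vertical h
      exact ⟨γ, Or.inl hγ⟩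
    · obtain ⟨j, rfl⟩ := hcast j hj
      obtain ⟨γ, hγ⟩ := exists_embed_of_vertical
        (δ := conj (botPerm (Equiv.swap (Fin.last n) j.castSucc)) δ) (by simp [h])
      refine ⟨γ, Or.inr (Or.inr (Or.inl ⟨j, ?_⟩))⟩
      rw [(comp_transp _ _ _).2, ← hγ]
      ext1; funext v
      rcases v with v | v <;> simp only [conj_pair, botPerm_symm_inl, botPerm_symm_inr,
        Equiv.symm_swap, Equiv.swap_apply_self]
      all_goals rcases δ.pair _ <;> simp

theorem generated (δ : BrauerDiagram n) : Generated δ := by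
  induction n with
  | zero =>
    have : δ = one 0 := by
      ext1; funext v; rcases v with i | i <;> exact i.elim0
    rw [this]; exact .one
  | succ n ih =>
    obtain ⟨γ, h | ⟨j, h⟩ | ⟨j, h⟩ | ⟨j, h⟩⟩ := last_strand_cases δ <;> subst h
    · exact (ih γ).embed_castSucc
    · rw [transp_eq_ofPerm]; exact (generated_ofPerm _).comp (ih γ).embed_castSucc
    · rw [transp_eq_ofPerm]; exact (ih γ).embed_castSucc.comp (generated_ofPerm _)
    · exact (generated_cupcap (Ne.symm (Fin.castSucc_ne_last j))).comp (ih γ).embed_castSucc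

end BrauerDiagram

/-! ### Multiplication of basis elements by generators, and induction principles. -/

namespace BrauerAlgebra

open BrauerDiagram

variable {n : ℕ} {N : ℂ}

/-- The element of a transposition. -/
noncomputable def t (N : ℂ) (k l : Fin n) : BrauerAlgebra n N := b (transp k l)

/-- The element of the diagram with horizontal edges `{k, l}`, `{k̄, l̄}`. -/
noncomputable def c (N : ℂ) (k l : Fin n) : BrauerAlgebra n N := b (cupcap k l)

theorem t_mul_b (k l : Fin n) (γ : BrauerDiagram n) :
    t N k l * b γ = b (conj (topPerm (Equiv.swap k l)) γ) := by
  rw [t, b_mul_b, (transp_comp _ _ _).1, (transp_comp _ _ _).2, pow_zero, one_smul]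

theorem c_mul_b {k l : Fin n} (h : k ≠ l) (γ : BrauerDiagram n) :
    c N k l * b γ = N ^ (if γ.pair (Sum.inl k) = Sum.inl l then 1 else 0) •
      b (join _ _ (inl_ne_inl h) γ) := by
  rw [c, b_mul_b, (cupcap_comp h _).1, (cupcap_comp h _).2]

theorem c_mul_b_of_ne {k l : Fin n} (h : k ≠ l) {γ : BrauerDiagram n}
    (hγ : γ.pair (Sum.inl k) ≠ Sum.inl l) :
    c N k l * b γ = b (join _ _ (inl_ne_inl h) γ) := by
  rw [c_mul_b h, if_neg hγ, pow_zero, one_smul]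

theorem c_mul_b_of_eq {k l : Fin n} (h : k ≠ l) {γ : BrauerDiagram n}
    (hγ : γ.pair (Sum.inl k) = Sum.inl l) : c N k l * b γ = N • b γ := by
  rw [c_mul_b h, if_pos hγ, pow_one, join_eq_self _ hγ]

/-- Induction on diagrams by multiplication on the left with `s_k` and `s̄_k`. -/
theorem b_induction {P : BrauerAlgebra n N → Prop} (h1 : P 1)
    (ht : ∀ (k : ℕ) (hk : k + 1 < n) (γ : BrauerDiagram n), P (b γ) → P (s N k hk * b γ))
    (hc : ∀ (k : ℕ) (hk : k + 1 < n) (γ : BrauerDiagram n), P (b γ) → P (sbar N k hk * b γ))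
    (γ : BrauerDiagram n) : P (b γ) := by
  induction generated γ with
  | one => exact h1
  | transp k hk γ _ ih =>
    have := ht k hk γ ih
    rwa [s, ← t, t_mul_b] at this
  | cupcap k hk γ _ hl ih =>
    have := hc k hk γ ih
    rwa [sbar, ← c, c_mul_b_of_ne (by simp) hl] at this

theorem span_induction {P : BrauerAlgebra n N → Prop} (hb : ∀ γ, P (b γ))
    (hadd : ∀ f g, P f → P g → P (f + g)) (hsmul : ∀ (a : ℂ) f, P f → P (a • f))
    (f : BrauerAlgebra n N) : P f := by
  refine Finsupp.induction_linear (motive := P) f ?_ hadd fun γ a => ?_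
  · have := hsmul 0 _ (hb (one n))
    rwa [zero_smul] at this
  · have := hsmul a _ (hb γ)
    have e : a • (b γ : BrauerAlgebra n N) = Finsupp.single γ a :=
      (Finsupp.smul_single a γ (1 : ℂ)).trans (by rw [smul_eq_mul, mul_one])
    rwa [e] at this

end BrauerAlgebra

set_option linter.unusedSimpArgs false

/-! ### Jucys–Murphy elements and homomorphisms given by embeddings of strands. -/

namespace BrauerAlgebra

open BrauerDiagram

variable {n : ℕ} {N : ℂ}

/-! ### Coefficients and the reflection -/

/-- The coefficient of a diagram. -/
noncomputable def coeff (γ : BrauerDiagram n) : BrauerAlgebra n N →ₗ[ℂ] ℂ := Finsupp.lapply γ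

open Classical in
theorem coeff_b (γ γ' : BrauerDiagram n) :
    coeff γ (b γ' : BrauerAlgebra n N) = if γ' = γ then 1 else 0 := by
  unfold coeff b
  exact Finsupp.single_apply

theorem ext_coeff {f g : BrauerAlgebra n N} (h : ∀ γ, coeff γ f = coeff γ g) : f = g :=
  Finsupp.ext h

theorem coeff_lift_b {p : ℕ} {g : BrauerDiagram p → BrauerDiagram n} (hg : Function.Injective g)
    (γ : BrauerDiagram p) (f : BrauerAlgebra p N) :
    coeff (g γ) (lift (fun γ' => (b (g γ') : BrauerAlgebra n N)) f) = coeff γ f := by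
  classical
  have : (coeff (g γ) ∘ₗ lift (fun γ' => (b (g γ') : BrauerAlgebra n N)) :
      BrauerAlgebra p N →ₗ[ℂ] ℂ) = coeff γ :=
    ext_b fun γ' => by
      rw [LinearMap.comp_apply, lift_b, coeff_b, coeff_b]
      simp only [hg.eq_iff]
  exact LinearMap.congr_fun this f

theorem lift_b_injective {p : ℕ} {g : BrauerDiagram p → BrauerDiagram n}
    (hg : Function.Injective g) :
    Function.Injective (lift (N := N) (fun γ' => (b (g γ') : BrauerAlgebra n N))) := by
  intro f f' h
  exact ext_coeff fun γ => by rw [← coeff_lift_b hg, h, coeff_lift_b hg]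

/-- The reflection of diagrams, an anti-automorphism. -/
noncomputable def flipL : BrauerAlgebra n N →ₗ[ℂ] BrauerAlgebra n N := lift fun γ => b (flip γ)

@[simp] theorem flipL_b (γ : BrauerDiagram n) :
    flipL (b γ : BrauerAlgebra n N) = b (flip γ) := lift_b _ _

theorem flipL_mul (f g : BrauerAlgebra n N) : flipL (f * g) = flipL g * flipL f := by
  induction f using span_induction with
  | hadd f f' h h' => rw [add_mul, map_add, h, h', map_add, mul_add]
  | hsmul a f h => rw [smul_mul_assoc, map_smul, h, map_smul, mul_smul_comm]
  | hb γ =>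
    induction g using span_induction with
    | hadd f f' h h' => rw [mul_add, map_add, h, h', map_add, add_mul]
    | hsmul a f h => rw [mul_smul_comm, map_smul, h, map_smul, smul_mul_assoc]
    | hb γ' =>
      rw [b_mul_b, map_smul, flipL_b, flipL_b, flipL_b, b_mul_b, (comp_flip _ _).1,
        (comp_flip _ _).2]

@[simp] theorem flipL_flipL (f : BrauerAlgebra n N) : flipL (flipL f) = f := by
  have : (flipL ∘ₗ flipL : BrauerAlgebra n N →ₗ[ℂ] _) = LinearMap.id := ext_b fun γ => by simp
  exact LinearMap.congr_fun this f

@[simp] theorem flipL_one : flipL (1 : BrauerAlgebra n N) = 1 := by rw [one_def, flipL_b, flip_one]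

@[simp] theorem flipL_t (k l : Fin n) : flipL (t N k l) = t N k l := by rw [t, flipL_b, flip_transp]

@[simp] theorem flipL_c (k l : Fin n) : flipL (c N k l) = c N k l := by rw [c, flipL_b, flip_cupcap]

theorem flipL_injective : Function.Injective (flipL (n := n) (N := N)) :=
  fun f g h => by rw [← flipL_flipL f, h, flipL_flipL]

/-! ### Relations between the diagrams of two strands -/

theorem t_comm (k l : Fin n) : t N k l = t N l k := by
  rw [t, t, transp_eq_ofPerm, Equiv.swap_comm, transp_eq_ofPerm]

theorem c_comm (k l : Fin n) : c N k l = c N l k := by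
  rw [c, c, cupcap, cupcap]
  congr 2
  simp only [Equiv.swap_comm l k]

theorem t_mul_t_self (k l : Fin n) : t N k l * t N k l = 1 := by
  nth_rewrite 2 [t]
  rw [t_mul_b, transp_eq_ofPerm, one_def]
  congr 1
  ext1; funext v
  rcases v with i | i <;> simp [one]

theorem t_mul_t (k l i j : Fin n) :
    t N k l * t N i j = t N (Equiv.swap k l i) (Equiv.swap k l j) * t N k l := by
  rw [t, t, t, transp_eq_ofPerm, transp_eq_ofPerm, transp_eq_ofPerm, b_mul_b, b_mul_b,
    (ofPerm_comp _ _).1, (ofPerm_comp _ _).1, ofPerm_mul, ofPerm_mul, Equiv.mul_swap_eq_swap_mul]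

theorem t_mul_c (k l : Fin n) {i j : Fin n} (h : i ≠ j) :
    t N k l * c N i j = c N (Equiv.swap k l i) (Equiv.swap k l j) * t N k l := by
  rw [t, c, c, transp_eq_ofPerm, b_mul_b, b_mul_b, (ofPerm_comp _ _).1, (comp_ofPerm _ _).1,
    conj_comp_cupcap _ h]

theorem c_mul_c_self {k l : Fin n} (h : k ≠ l) : c N k l * c N k l = N • c N k l := by
  nth_rewrite 2 [c]
  rw [c_mul_b_of_eq h, c]
  simp [cupcap, h.symm]

theorem t_mul_c_self {k l : Fin n} (h : k ≠ l) : t N k l * c N k l = c N k l := by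
  rw [c, t_mul_b, cupcap_eq_join h]
  congr 1
  rw [conj_join]
  ext1; funext v
  have := inl_ne_inl h
  rcases v with i | i <;> simp [join_pair, one]
  · grind
  · grind

theorem c_mul_t_self {k l : Fin n} (h : k ≠ l) : c N k l * t N k l = c N k l := by
  apply flipL_injective
  rw [flipL_mul, flipL_t, flipL_c, t_mul_c_self h]

/-- Both products are the diagram with top edge `{i, j}`, bottom edge `{j, k}` and an edge from the
top of `k` to the bottom of `i`. -/
theorem c_mul_t {i j k : Fin n} (hij : i ≠ j) (hik : i ≠ k) (hjk : j ≠ k) :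
    c N i j * t N i k = c N i j * c N j k := by
  rw [t, c_mul_b_of_ne hij, c, c, ← c, c_mul_b_of_ne hij]
  · congr 1
    rw [cupcap_eq_join hjk]
    ext1; funext v
    rcases v with v | v
    · simp only [join_pair, transp, one, Sum.swap_inl, Sum.swap_inr, Sum.elim_inl, Sum.elim_inr,
        Equiv.swap_apply_def, Sum.inl.injEq, Sum.inr.injEq, reduceCtorEq]
      grind
    · simp only [join_pair, transp, one, Sum.swap_inl, Sum.swap_inr, Sum.elim_inl, Sum.elim_inr,
        Equiv.swap_apply_def, Sum.inl.injEq, Sum.inr.injEq, reduceCtorEq]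
      grind
  · simp [cupcap, Equiv.swap_apply_of_ne_of_ne hij hik]
  · simp [transp]

theorem c_mul_c_mul_c {i j k : Fin n} (hij : i ≠ j) (hik : i ≠ k) (hjk : j ≠ k) :
    c N i j * c N j k * c N i j = c N i j := by
  rw [mul_assoc]
  nth_rewrite 3 [c]
  rw [c_mul_b_of_ne hjk, c_mul_b_of_ne hij, c]
  · congr 1
    rw [cupcap_eq_join hij]
    ext1; funext v
    rcases v with v | v
    · simp only [join_pair, one, Sum.swap_inl, Sum.swap_inr, Sum.inl.injEq, Sum.inr.injEq,
        reduceCtorEq]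
      grind
    · simp only [join_pair, one, Sum.swap_inl, Sum.swap_inr, Sum.inl.injEq, Sum.inr.injEq,
        reduceCtorEq]
      grind
  · simp only [join_pair, cupcap_eq_join hij, one, Sum.swap_inl, Sum.swap_inr, Sum.inl.injEq,
      Sum.inr.injEq, reduceCtorEq]
    grind
  · simp only [cupcap_eq_join hij, join_pair, one, Sum.swap_inl, Sum.swap_inr, Sum.inl.injEq,
      Sum.inr.injEq, reduceCtorEq]
    grind

theorem c_mul_t_mul_c {i j k : Fin n} (hij : i ≠ j) (hik : i ≠ k) (hjk : j ≠ k) :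
    c N i j * t N i k * c N i j = c N i j := by
  rw [c_mul_t hij hik hjk, c_mul_c_mul_c hij hik hjk]

theorem c_mul_c_mul_c' {i j k : Fin n} (hij : i ≠ j) (hik : i ≠ k) (hjk : j ≠ k) :
    c N i j * c N i k * c N i j = c N i j := by
  rw [c_comm i j, c_mul_c_mul_c hij.symm hjk hik]

section Disjoint

variable {i j k l : Fin n} (hik : i ≠ k) (hil : i ≠ l) (hjk : j ≠ k) (hjl : j ≠ l)

include hik hil hjk hjl

theorem t_commute_t : Commute (t N i j) (t N k l) := by
  rw [Commute, SemiconjBy, t_mul_t, Equiv.swap_apply_of_ne_of_ne hik.symm hjk.symm,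
    Equiv.swap_apply_of_ne_of_ne hil.symm hjl.symm]

theorem t_commute_c (hkl : k ≠ l) : Commute (t N i j) (c N k l) := by
  rw [Commute, SemiconjBy, t_mul_c _ _ hkl, Equiv.swap_apply_of_ne_of_ne hik.symm hjk.symm,
    Equiv.swap_apply_of_ne_of_ne hil.symm hjl.symm]

theorem c_commute_c (hij : i ≠ j) (hkl : k ≠ l) : Commute (c N i j) (c N k l) := by
  rw [Commute, SemiconjBy]
  nth_rewrite 2 [c]
  nth_rewrite 3 [c]
  rw [c_mul_b_of_ne hij, c_mul_b_of_ne hkl]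
  · congr 1
    rw [cupcap_eq_join hij, cupcap_eq_join hkl]
    ext1; funext v
    rcases v with v | v
    · simp only [join_pair, one, Sum.swap_inl, Sum.swap_inr, Sum.inl.injEq, Sum.inr.injEq,
        reduceCtorEq]
      grind
    · simp only [join_pair, one, Sum.swap_inl, Sum.swap_inr, Sum.inl.injEq, Sum.inr.injEq,
        reduceCtorEq]
      grind
  · simp only [join_pair, cupcap_eq_join hij, one, Sum.swap_inl, Sum.swap_inr, Sum.inl.injEq,
      Sum.inr.injEq, reduceCtorEq]
    grind
  · simp only [join_pair, cupcap_eq_join hkl, one, Sum.swap_inl, Sum.swap_inr, Sum.inl.injEq,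
      Sum.inr.injEq, reduceCtorEq]
    grind

end Disjoint

/-! ### The Jucys–Murphy elements -/

/-- The difference of the two diagrams of a pair of strands. -/
noncomputable def d (N : ℂ) (k l : Fin n) : BrauerAlgebra n N := t N k l - c N k l

theorem x_eq (k : Fin n) :
    x N k = algebraMap ℂ _ ((N - 1) / 2) + ∑ l ∈ Finset.Iio k, d N k l := rfl

theorem t_mul_d (k l : Fin n) {i j : Fin n} (h : i ≠ j) :
    t N k l * d N i j = d N (Equiv.swap k l i) (Equiv.swap k l j) * t N k l := by
  rw [d, d, mul_sub, sub_mul, t_mul_t, t_mul_c _ _ h]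

/-- By `c_mul_t` the transposition with `i` cancels the horizontal pair with `j`, and conversely.
This cancellation is behind the relations between s̄ and the Jucys–Murphy elements. -/
theorem c_mul_d_add_d {i j k : Fin n} (hij : i ≠ j) (hik : i ≠ k) (hjk : j ≠ k) :
    c N i j * (d N k i + d N k j) = 0 := by
  simp only [d]
  rw [t_comm k i, t_comm k j, c_comm k i, c_comm k j, mul_add, mul_sub, mul_sub,
    c_mul_t hij hik hjk, c_comm i j, c_mul_t hij.symm hjk hik]
  abel

theorem d_add_d_mul_c {i j k : Fin n} (hij : i ≠ j) (hik : i ≠ k) (hjk : j ≠ k) :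
    (d N k i + d N k j) * c N i j = 0 := by
  apply flipL_injective
  have : ∀ k l : Fin n, flipL (d N k l) = d N k l := by
    intro k l; rw [d, map_sub, flipL_t, flipL_c]
  rw [flipL_mul, map_add, this, this, flipL_c, c_mul_d_add_d hij hik hjk, map_zero]

theorem t_commute_sum_d {i j k : Fin n} (S : Finset (Fin n)) (hi : i ∈ S) (hj : j ∈ S)
    (hk : k ∉ S) : Commute (t N i j) (∑ l ∈ S, d N k l) := by
  have hik : k ≠ i := by rintro rfl; exact hk hi
  have hjk : k ≠ j := by rintro rfl; exact hk hj
  rw [Commute, SemiconjBy, Finset.mul_sum, Finset.sum_mul]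
  refine Finset.sum_equiv (Equiv.swap i j) (fun l => ?_) fun l hl => ?_
  · rw [Equiv.swap_apply_def]
    split_ifs with h1 h2
    · simp [h1, hi, hj]
    · simp [h2, hi, hj]
    · rfl
  · rw [t_mul_d _ _ (by rintro rfl; exact hk hl), Equiv.swap_apply_of_ne_of_ne hik hjk]

/-- The summands at `i` and `j` together are annihilated from both sides, and every other summand
lives on strands disjoint from `i`, `j`. -/
theorem c_commute_sum_d {i j k : Fin n} (hij : i ≠ j) (S : Finset (Fin n)) (hi : i ∈ S)
    (hj : j ∈ S) (hk : k ∉ S) : Commute (c N i j) (∑ l ∈ S, d N k l) := by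
  have hik : i ≠ k := by rintro rfl; exact hk hi
  have hjk : j ≠ k := by rintro rfl; exact hk hj
  have hj' : j ∈ S.erase i := Finset.mem_erase.2 ⟨hij.symm, hj⟩
  rw [← Finset.add_sum_erase S _ hi, ← Finset.add_sum_erase _ _ hj', ← add_assoc]
  refine Commute.add_right ?_ (Commute.sum_right _ _ _ fun l hl => ?_)
  · rw [Commute, SemiconjBy, c_mul_d_add_d hij hik hjk, d_add_d_mul_c hij hik hjk]
  · simp only [Finset.mem_erase] at hl
    have hkl : k ≠ l := by rintro rfl; exact hk hl.2.2
    exact ((t_commute_c hik.symm hjk.symm hl.2.1 hl.1 hij).symm).sub_right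
      (c_commute_c hik hl.2.1.symm hjk hl.1.symm hij hkl)

theorem t_commute_x_of_lt {i j k : Fin n} (hi : i < k) (hj : j < k) :
    Commute (t N i j) (x N k) := by
  rw [x_eq]
  exact (Algebra.commute_algebraMap_right _ _).add_right (t_commute_sum_d _ (Finset.mem_Iio.2 hi)
    (Finset.mem_Iio.2 hj) (by simp))

theorem c_commute_x_of_lt {i j k : Fin n} (hij : i ≠ j) (hi : i < k) (hj : j < k) :
    Commute (c N i j) (x N k) := by
  rw [x_eq]
  exact (Algebra.commute_algebraMap_right _ _).add_right (c_commute_sum_d hij _ (Finset.mem_Iio.2 hi)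
    (Finset.mem_Iio.2 hj) (by simp))

theorem commute_x {k : Fin n} {f : BrauerAlgebra n N} (ht : ∀ l < k, Commute f (t N k l))
    (hc : ∀ l < k, Commute f (c N k l)) : Commute f (x N k) := by
  rw [x_eq]
  refine (Algebra.commute_algebraMap_right _ _).add_right (Commute.sum_right _ _ _ fun l hl => ?_)
  rw [Finset.mem_Iio] at hl
  exact (ht l hl).sub_right (hc l hl)

theorem x_commute_x (k l : Fin n) : Commute (x N k) (x N l) := by
  wlog h : k < l generalizing k l
  · rcases lt_trichotomy k l with h1 | rfl | h1
    · exact this _ _ h1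
    · exact Commute.refl _
    · exact (this _ _ h1).symm
  exact (commute_x (fun i hi => (t_commute_x_of_lt h (hi.trans h)).symm)
    fun i hi => (c_commute_x_of_lt hi.ne' h (hi.trans h)).symm).symm

section Neighbours

variable {k k' : Fin n} (h : (k' : ℕ) = k + 1)

include h

theorem ne_of_succ : k ≠ k' := by rintro rfl; omega

theorem x_succ : x N k' = algebraMap ℂ _ ((N - 1) / 2) + ∑ l ∈ Finset.Iio k, d N k' l
    + d N k k' := by
  have : Finset.Iio k' = insert k (Finset.Iio k) := by
    ext l; simp only [Finset.mem_Iio, Finset.mem_insert, Fin.lt_def, Fin.ext_iff]; omega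
  have hd : d N k k' = d N k' k := by rw [d, d, t_comm, c_comm]
  rw [x_eq, this, Finset.sum_insert (by simp), hd]
  abel

/-- Conjugation by the transposition carries the summands of `x N k` to those of `x N k'`. The one
summand left over is `d N k k'`, and its product with the transposition is `1 - c N k k'`. -/
theorem t_mul_x : t N k k' * x N k - x N k' * t N k k' = c N k k' - 1 := by
  have hk := ne_of_succ h
  rw [x_succ h, x_eq, mul_add, add_mul, add_mul, Finset.mul_sum, Finset.sum_mul,
    Algebra.commutes]
  have : ∀ l ∈ Finset.Iio k, t N k k' * d N k l = d N k' l * t N k k' := by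
    intro l hl
    rw [Finset.mem_Iio] at hl
    have h1 : l ≠ k' := by rintro rfl; rw [Fin.lt_def] at hl; omega
    rw [t_mul_d _ _ hl.ne', Equiv.swap_apply_left, Equiv.swap_apply_of_ne_of_ne hl.ne h1]
  rw [Finset.sum_congr rfl this, d, sub_mul, t_mul_t_self, c_mul_t_self hk]
  abel

theorem t_mul_x' : t N k k' * x N k' - x N k * t N k k' = 1 - c N k k' := by
  have hk := ne_of_succ h
  have h1 := congrArg (fun f => t N k k' * f * t N k k') (t_mul_x (N := N) h)
  simp only [mul_sub, sub_mul, ← mul_assoc, t_mul_t_self, one_mul, mul_one, t_mul_c_self hk,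
    c_mul_t_self hk] at h1
  rw [mul_assoc (t N k k' * x N k'), t_mul_t_self, mul_one] at h1
  rw [← neg_sub, h1, neg_sub]

/-- The summands at a strand `l` below `k` cancel by `c_mul_d_add_d`. The remaining `d N k k'`
contributes `1 - N` times `c N k k'`, which the two constants `(N - 1) / 2` compensate. -/
theorem c_mul_x_add_x : c N k k' * (x N k + x N k') = 0 := by
  have hk := ne_of_succ h
  have h1 : ∀ l ∈ Finset.Iio k, c N k k' * (d N k l + d N k' l) = 0 := by
    intro l hl
    rw [Finset.mem_Iio] at hl
    have h1 : l ≠ k' := by rintro rfl; rw [Fin.lt_def] at hl; omega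
    have := c_mul_d_add_d (N := N) hk hl.ne' h1.symm
    rwa [d, d, t_comm l, t_comm l, c_comm l, c_comm l] at this
  have h2 : c N k k' * ∑ l ∈ Finset.Iio k, (d N k l + d N k' l) = 0 := by
    rw [Finset.mul_sum, Finset.sum_eq_zero h1]
  rw [x_succ h, x_eq]
  rw [Finset.sum_add_distrib] at h2
  have h3 : c N k k' * d N k k' = c N k k' - N • c N k k' := by
    rw [d, mul_sub, c_mul_t_self hk, c_mul_c_self hk]
  have e : algebraMap ℂ (BrauerAlgebra n N) ((N - 1) / 2) + ∑ l ∈ Finset.Iio k, d N k l +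
      (algebraMap ℂ (BrauerAlgebra n N) ((N - 1) / 2) + ∑ l ∈ Finset.Iio k, d N k' l + d N k k') =
      algebraMap ℂ (BrauerAlgebra n N) (N - 1) +
      (∑ l ∈ Finset.Iio k, d N k l + ∑ l ∈ Finset.Iio k, d N k' l) + d N k k' := by
    have : algebraMap ℂ (BrauerAlgebra n N) (N - 1) = algebraMap ℂ (BrauerAlgebra n N) ((N - 1) / 2)
        + algebraMap ℂ (BrauerAlgebra n N) ((N - 1) / 2) := by
      rw [← map_add, add_halves]
    rw [this]; abel
  rw [e, mul_add, mul_add, h2, h3, ← Algebra.commutes, ← Algebra.smul_def, sub_smul, one_smul]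
  abel

end Neighbours

@[simp] theorem flipL_x (k : Fin n) : flipL (x N k) = x N k := by
  have h1 : ∀ a : ℂ, flipL (algebraMap ℂ (BrauerAlgebra n N) a) = algebraMap ℂ _ a := by
    intro a; rw [Algebra.algebraMap_eq_smul_one, map_smul, flipL_one]
  rw [x_eq, map_add, h1, map_sum]
  congr 1
  refine Finset.sum_congr rfl fun l _ => ?_
  rw [d, map_sub, flipL_t, flipL_c]

theorem x_add_x_mul_c {k k' : Fin n} (h : (k' : ℕ) = k + 1) :
    (x N k + x N k') * c N k k' = 0 := by
  apply flipL_injective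
  rw [flipL_mul, map_add, flipL_x, flipL_x, flipL_c, c_mul_x_add_x h, map_zero]

/-! ### Homomorphisms given by embeddings of strands -/

section Embed

variable {p q : ℕ} (f : Fin p ↪ Fin q)

/-- The linear map given by `embed`. -/
noncomputable def embedL (N : ℂ) : BrauerAlgebra p N →ₗ[ℂ] BrauerAlgebra q N :=
  lift fun γ => b (embed f γ)

theorem embedL_b (γ : BrauerDiagram p) : embedL f N (b γ) = b (embed f γ) := lift_b _ _

theorem embedL_t_mul_b (k l : Fin p) (γ : BrauerDiagram p) :
    embedL f N (t N k l * b γ) = t N (f k) (f l) * embedL f N (b γ) := by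
  rw [t_mul_b, embedL_b, embedL_b, t_mul_b, embed_conj_swap]

theorem embedL_c_mul_b {k l : Fin p} (h : k ≠ l) (γ : BrauerDiagram p) :
    embedL f N (c N k l * b γ) = c N (f k) (f l) * embedL f N (b γ) := by
  rw [c_mul_b h, map_smul, embedL_b, embedL_b, c_mul_b (f.injective.ne h), embed_join,
    embed_pair_inl]
  congr 2
  exact if_congr ((map_map_injective f).eq_iff (b := Sum.inl l)).symm rfl rfl

theorem embedL_mul_left {f' : BrauerAlgebra p N} {g' : BrauerAlgebra q N}
    (h : ∀ γ, embedL f N (f' * b γ) = g' * embedL f N (b γ)) (g : BrauerAlgebra p N) :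
    embedL f N (f' * g) = g' * embedL f N g := by
  induction g using span_induction with
  | hb γ => exact h γ
  | hadd g g' h h' => rw [mul_add, map_add, map_add, h, h', mul_add]
  | hsmul a g h => rw [mul_smul_comm, map_smul, map_smul, h, mul_smul_comm]

theorem embedL_one : embedL f N 1 = 1 := by rw [one_def, embedL_b, embed_one, ← one_def]

theorem embedL_t (k l : Fin p) : embedL f N (t N k l) = t N (f k) (f l) := by
  rw [t, embedL_b, embed_transp, t]

theorem embedL_c {k l : Fin p} (h : k ≠ l) : embedL f N (c N k l) = c N (f k) (f l) := by
  rw [c, embedL_b, embed_cupcap f h, c]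

/-- It suffices to treat left factors s_k and s̄_k, for which the product is explicit and visibly
compatible with adding vertical strands. -/
theorem embedL_mul (g h : BrauerAlgebra p N) :
    embedL f N (g * h) = embedL f N g * embedL f N h := by
  induction g using span_induction with
  | hadd g g' h h' => rw [add_mul, map_add, map_add, h, h', add_mul]
  | hsmul a g h => rw [smul_mul_assoc, map_smul, map_smul, h, smul_mul_assoc]
  | hb γ =>
    refine b_induction (P := fun g => embedL f N (g * h) = embedL f N g * embedL f N h) ?_
      (fun k hk γ ih => ?_) (fun k hk γ ih => ?_) γ
    · rw [one_mul, embedL_one, one_mul]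
    · rw [s, ← t, mul_assoc, embedL_mul_left f (embedL_t_mul_b f _ _), ih,
        embedL_mul_left f (embedL_t_mul_b f _ _), mul_assoc]
    · rw [sbar, ← c, mul_assoc, embedL_mul_left f (embedL_c_mul_b f (by simp)), ih,
        embedL_mul_left f (embedL_c_mul_b f (by simp)), mul_assoc]

/-- The homomorphism of Brauer algebras given by an embedding of strands. -/
noncomputable def emb (N : ℂ) : BrauerAlgebra p N →ₐ[ℂ] BrauerAlgebra q N :=
  AlgHom.ofLinearMap (embedL f N) (embedL_one f) (embedL_mul f)

theorem emb_b (γ : BrauerDiagram p) : emb f N (b γ) = b (embed f γ) := embedL_b f γ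

theorem emb_t (k l : Fin p) : emb f N (t N k l) = t N (f k) (f l) := embedL_t f k l

theorem emb_c {k l : Fin p} (h : k ≠ l) : emb f N (c N k l) = c N (f k) (f l) := embedL_c f h

/-- The hypotheses say that the strands below `f k` are exactly the images of the strands below `k`,
so both sums run over the same pairs. -/
theorem emb_x {k : Fin p} (h1 : ∀ i : Fin p, i < k ↔ f i < f k)
    (h2 : ∀ j : Fin q, j < f k → ∃ i, f i = j) :
    emb f N (x N k) = x N (f k) := by
  have hS : Finset.Iio (f k) = (Finset.Iio k).map f := by
    ext j
    simp only [Finset.mem_Iio, Finset.mem_map]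
    constructor
    · intro hj
      obtain ⟨i, rfl⟩ := h2 j hj
      exact ⟨i, (h1 i).2 hj, rfl⟩
    · rintro ⟨i, hi, rfl⟩; exact (h1 i).1 hi
  rw [x_eq, x_eq, map_add, AlgHom.commutes, map_sum, hS, Finset.sum_map]
  congr 1
  refine Finset.sum_congr rfl fun l hl => ?_
  rw [Finset.mem_Iio] at hl
  rw [d, map_sub, emb_t, emb_c f hl.ne', d]

/-- An element that commutes with the diagrams of two strands of `f` commutes with the image of
`emb f`. -/
theorem commute_emb {u : BrauerAlgebra q N} (ht : ∀ k l, Commute u (t N (f k) (f l)))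
    (hc : ∀ k l, k ≠ l → Commute u (c N (f k) (f l))) (g : BrauerAlgebra p N) :
    Commute u (emb f N g) := by
  induction g using span_induction with
  | hadd g g' h h' => rw [map_add]; exact h.add_right h'
  | hsmul a g h => rw [map_smul]; exact h.smul_right a
  | hb γ =>
    refine b_induction (P := fun g => Commute u (emb f N g)) ?_
      (fun k hk γ ih => ?_) (fun k hk γ ih => ?_) γ
    · rw [map_one]; exact Commute.one_right _
    · rw [s, ← t, map_mul, emb_t]; exact (ht _ _).mul_right ih
    · rw [sbar, ← c, map_mul, emb_c f (by simp)]
      exact (hc _ _ (by simp)).mul_right ih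

theorem emb_commute_emb {p' : ℕ} (f' : Fin p' ↪ Fin q) (hf : ∀ i j, f i ≠ f' j)
    (g : BrauerAlgebra p N) (g' : BrauerAlgebra p' N) : Commute (emb f N g) (emb f' N g') := by
  refine commute_emb f' (fun k l => ?_) (fun k l hkl => ?_) g'
  · refine (commute_emb f (fun i j => ?_) (fun i j hij => ?_) g).symm
    · exact (t_commute_t (hf _ _) (hf _ _) (hf _ _) (hf _ _)).symm
    · exact t_commute_c (hf _ _).symm (hf _ _).symm (hf _ _).symm (hf _ _).symm
        (f.injective.ne hij)
  · refine (commute_emb f (fun i j => ?_) (fun i j hij => ?_) g).symm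
    · exact (t_commute_c (hf _ _) (hf _ _) (hf _ _) (hf _ _) (f'.injective.ne hkl)).symm
    · exact (c_commute_c (hf _ _) (hf _ _) (hf _ _) (hf _ _) (f.injective.ne hij)
        (f'.injective.ne hkl)).symm

end Embed

theorem incl_eq_emb (m r : ℕ) (g : BrauerAlgebra m N) :
    incl m r N g = emb (Fin.castAddEmb r) N g := by
  have : incl m r N = embedL (Fin.castAddEmb r) N := by
    rw [incl, embedL]; simp only [extend_eq_embed]
  exact LinearMap.congr_fun this g

end BrauerAlgebra

/-! ### The elements z: existence, uniqueness, centrality and the relations for odd index. -/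

namespace BrauerAlgebra

open BrauerDiagram

variable {n : ℕ} {N : ℂ}

/-! ### The elements `z` -/

theorem embed_embed {p q r : ℕ} (f : Fin p ↪ Fin q) (g : Fin q ↪ Fin r) (γ : BrauerDiagram p) :
    embed g (embed f γ) = embed (f.trans g) γ := by
  have h : ∀ u, Sum.map (f.trans g) (f.trans g) u = Sum.map g g (Sum.map f f u) := by
    rintro (i | i) <;> rfl
  refine eq_embed _ (fun u => ?_) fun v hv => ?_
  · rw [h, h, embed_pair_map, embed_pair_map]
  · rcases exists_map_or g v with ⟨u, rfl⟩ | h1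
    · rw [embed_pair_map, embed_pair_off f γ]
      · cases u <;> rfl
      · intro u' hu'
        exact hv u' (by rw [h, hu'])
    · exact embed_pair_off g _ h1.1

theorem emb_emb {p q r : ℕ} (f : Fin p ↪ Fin q) (g : Fin q ↪ Fin r) (h : BrauerAlgebra p N) :
    emb g N (emb f N h) = emb (f.trans g) N h := by
  have : embedL g N ∘ₗ embedL f N = embedL (f.trans g) N := ext_b fun γ => by
    rw [LinearMap.comp_apply, embedL_b, embedL_b, embedL_b, embed_embed]
  exact LinearMap.congr_fun this h

/-- The inclusion of `B(p, N)` in `B(q, N)` on the first strands. -/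
noncomputable def inc {p q : ℕ} (h : p ≤ q) (N : ℂ) : BrauerAlgebra p N →ₐ[ℂ] BrauerAlgebra q N :=
  emb (Fin.castLEEmb h) N

theorem incl_eq_inc (m r : ℕ) (g : BrauerAlgebra m N) :
    incl m r N g = inc (Nat.le_add_right m r) N g := incl_eq_emb m r g

theorem inc_inc {p q r : ℕ} (h : p ≤ q) (h' : q ≤ r) (g : BrauerAlgebra p N) :
    inc h' N (inc h N g) = inc (h.trans h') N g := emb_emb _ _ g

theorem inc_t {p q : ℕ} (h : p ≤ q) (k l : Fin p) :
    inc h N (t N k l) = t N (Fin.castLE h k) (Fin.castLE h l) := emb_t _ k l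

theorem inc_c {p q : ℕ} (h : p ≤ q) {k l : Fin p} (hkl : k ≠ l) :
    inc h N (c N k l) = c N (Fin.castLE h k) (Fin.castLE h l) := emb_c _ hkl

theorem inc_x {p q : ℕ} (h : p ≤ q) (k : Fin p) : inc h N (x N k) = x N (Fin.castLE h k) :=
  emb_x _ (fun _ => Iff.rfl) fun j hj => ⟨⟨j, lt_trans hj k.2⟩, rfl⟩

/-- The elements on the first `p` strands commute with the diagrams on two other strands. -/
theorem commute_inc_c {p q : ℕ} (h : p ≤ q) {k l : Fin q} (hkl : k ≠ l) (hk : p ≤ k) (hl : p ≤ l)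
    (g : BrauerAlgebra p N) : Commute (c N k l) (inc h N g) := by
  have hne : ∀ (i : Fin p) (j : Fin q), p ≤ j → j ≠ Fin.castLE h i := by
    rintro i j hj rfl
    exact absurd i.2 (not_lt.2 hj)
  refine commute_emb _ (fun i j => ?_) (fun i j hij => ?_) g
  · exact (t_commute_c (hne _ _ hk).symm (hne _ _ hl).symm (hne _ _ hk).symm (hne _ _ hl).symm
      hkl).symm
  · exact c_commute_c (hne _ _ hk) (hne _ _ hk) (hne _ _ hl) (hne _ _ hl) hkl
      ((Fin.castLEEmb h).injective.ne hij)

theorem commute_inc_x {p q : ℕ} (h : p ≤ q) {k : Fin q} (hk : p ≤ k) (g : BrauerAlgebra p N) :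
    Commute (x N k) (inc h N g) := by
  have hlt : ∀ i : Fin p, Fin.castLE h i < k := fun i => Fin.lt_def.2 <| lt_of_lt_of_le i.2 (show p ≤ (k : ℕ) from hk)
  exact commute_emb _ (fun i j => (t_commute_x_of_lt (hlt i) (hlt j)).symm)
    (fun i j hij => (c_commute_x_of_lt ((Fin.castLEEmb h).injective.ne hij) (hlt i) (hlt j)).symm) g

section Z

variable (m : ℕ)

theorem le_add_two : m ≤ m + 2 := Nat.le_add_right m 2

/-- The two last strands of `B(m + 2, N)`. -/
def pen : Fin (m + 2) := ⟨m, by omega⟩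

/-- The last strand of `B(m + 2, N)`. -/
def ult : Fin (m + 2) := ⟨m + 1, by omega⟩

theorem pen_ne_ult : pen m ≠ ult m := by simp [pen, ult]

theorem ult_eq : ((ult m : Fin (m + 2)) : ℕ) = pen m + 1 := rfl

theorem isZ_iff (i : ℕ) (g : BrauerAlgebra m N) : IsZ m i g ↔
    c N (pen m) (ult m) * x N (pen m) ^ i * c N (pen m) (ult m) =
      inc (le_add_two m) N g * c N (pen m) (ult m) := by
  rw [IsZ, incl_eq_inc]; rfl

/-- The diagram of `γ` followed by the horizontal edges on the two last strands. -/
noncomputable def addCap (γ : BrauerDiagram m) : BrauerDiagram (m + 2) :=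
  join _ _ (inl_ne_inl (pen_ne_ult m)) (embed (Fin.castLEEmb (le_add_two m)) γ)

theorem castLE_ne_pen (i : Fin m) : (Fin.castLE (le_add_two m) i) ≠ pen m := by
  intro h
  have := congrArg Fin.val h
  simp [pen] at this
  omega

theorem castLE_ne_ult (i : Fin m) : (Fin.castLE (le_add_two m) i) ≠ ult m := by
  intro h
  have := congrArg Fin.val h
  simp [ult] at this
  omega

theorem embed_pair_pen (γ : BrauerDiagram m) :
    (embed (Fin.castLEEmb (le_add_two m)) γ).pair (Sum.inl (pen m)) = Sum.inr (pen m) := by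
  refine embed_pair_off _ _ ?_
  rintro (i | i)
  · simpa using castLE_ne_pen m i
  · simp

theorem embed_pair_ult (γ : BrauerDiagram m) :
    (embed (Fin.castLEEmb (le_add_two m)) γ).pair (Sum.inl (ult m)) = Sum.inr (ult m) := by
  refine embed_pair_off _ _ ?_
  rintro (i | i)
  · simpa using castLE_ne_ult m i
  · simp

theorem addCap_pair_map (γ : BrauerDiagram m) (u : Fin m ⊕ Fin m) :
    (addCap m γ).pair (Sum.map (Fin.castLE (le_add_two m)) (Fin.castLE (le_add_two m)) u) =
      Sum.map (Fin.castLE (le_add_two m)) (Fin.castLE (le_add_two m)) (γ.pair u) := by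
  have h := embed_pair_map (Fin.castLEEmb (le_add_two m)) γ u
  rw [addCap, join_pair, embed_pair_pen, embed_pair_ult]
  rw [if_neg, if_neg, if_neg, if_neg]
  · exact h
  all_goals rcases u with i | i
  all_goals simp [castLE_ne_pen, castLE_ne_ult]

theorem addCap_injective : Function.Injective (addCap m) := by
  intro γ γ' h
  ext1; funext u
  apply map_map_injective (Fin.castLEEmb (le_add_two m))
  have := addCap_pair_map m γ u
  rw [h, addCap_pair_map] at this
  exact this.symm

theorem inc_mul_c (g : BrauerAlgebra m N) :
    inc (le_add_two m) N g * c N (pen m) (ult m) = lift (fun γ => b (addCap m γ)) g := by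
  induction g using span_induction with
  | hadd f g hf hg => rw [map_add, map_add, add_mul, hf, hg]
  | hsmul a f hf => rw [map_smul, map_smul, smul_mul_assoc, hf]
  | hb γ =>
    rw [← (commute_inc_c (le_add_two m) (pen_ne_ult m) (Nat.le_refl m) (Nat.le_succ m) _).eq, lift_b,
      inc, emb_b, c_mul_b_of_ne (pen_ne_ult m), addCap]
    rw [embed_pair_pen]; simp

/-- Multiplication by the horizontal edges sends diagrams to diagrams and `γ` can be read off from
`addCap m γ`. This is the uniqueness of z and the tool for cancelling s̄. -/
theorem inc_mul_c_injective {g g' : BrauerAlgebra m N}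
    (h : inc (le_add_two m) N g * c N (pen m) (ult m) =
      inc (le_add_two m) N g' * c N (pen m) (ult m)) : g = g' := by
  rw [inc_mul_c, inc_mul_c] at h
  exact lift_b_injective (addCap_injective m) h

/-- The part of a diagram on the first `m` strands commutes with s̄ and can be pulled out. A
vertical last strand closes to a loop and gives `N`; in the other cases `c t c = c` or `c c c = c`
straightens the strand. -/
theorem exists_c_mul_inc_mul_c (g : BrauerAlgebra (m + 1) N) : ∃ g' : BrauerAlgebra m N,
    c N (pen m) (ult m) * inc (Nat.le_succ (m + 1)) N g * c N (pen m) (ult m) =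
      inc (le_add_two m) N g' * c N (pen m) (ult m) := by
  have hc := fun g => (commute_inc_c (N := N) (le_add_two m) (pen_ne_ult m) (Nat.le_refl m)
    (Nat.le_succ m) g).eq
  have hup := (pen_ne_ult m)
  induction g using span_induction with
  | hadd f g hf hg =>
    obtain ⟨f', hf⟩ := hf
    obtain ⟨g', hg⟩ := hg
    exact ⟨f' + g', by rw [map_add, map_add, mul_add, add_mul, hf, hg, add_mul]⟩
  | hsmul a f hf =>
    obtain ⟨f', hf⟩ := hf
    exact ⟨a • f', by
      rw [map_smul, map_smul, mul_smul_comm, smul_mul_assoc, hf, smul_mul_assoc]⟩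
  | hb δ =>
    have hcast : (fun γ => (b (embed Fin.castSuccEmb γ) : BrauerAlgebra (m + 1) N)) =
        fun γ => inc (Nat.le_succ m) N (b γ) := by
      funext γ; rw [inc, emb_b]; rfl
    have hpen : Fin.castLE (Nat.le_succ (m + 1)) (Fin.last m) = pen m := rfl
    have hj : ∀ j : Fin m, Fin.castLE (Nat.le_succ (m + 1)) j.castSucc =
        Fin.castLE (le_add_two m) j := fun j => rfl
    obtain ⟨γ, h | ⟨j, h⟩ | ⟨j, h⟩ | ⟨j, h⟩⟩ := last_strand_cases δ
    · refine ⟨N • b γ, ?_⟩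
      rw [h, congrFun hcast γ, inc_inc, hc, mul_assoc, c_mul_c_self hup, map_smul, mul_smul_comm,
        smul_mul_assoc]
    · refine ⟨b γ, ?_⟩
      have e : (b δ : BrauerAlgebra (m + 1) N) =
          t N (Fin.last m) j.castSucc * inc (Nat.le_succ m) N (b γ) := by
        rw [← congrFun hcast γ, t, b_mul_b, (transp_comp _ _ _).1, pow_zero, one_smul, h]
      rw [e, map_mul, inc_inc, inc_t, hpen, hj, mul_assoc, mul_assoc, ← hc, ← mul_assoc,
        ← mul_assoc, c_mul_t_mul_c hup (castLE_ne_pen m j).symm (castLE_ne_ult m j).symm, hc]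
    · refine ⟨b γ, ?_⟩
      have e : (b δ : BrauerAlgebra (m + 1) N) =
          inc (Nat.le_succ m) N (b γ) * t N (Fin.last m) j.castSucc := by
        rw [← congrFun hcast γ, t, b_mul_b, (comp_transp _ _ _).1, pow_zero, one_smul, h]
      rw [e, map_mul, inc_inc, inc_t, hpen, hj, ← mul_assoc, hc, mul_assoc, mul_assoc,
        ← mul_assoc (c N (pen m) (ult m)),
        c_mul_t_mul_c hup (castLE_ne_pen m j).symm (castLE_ne_ult m j).symm]
    · refine ⟨b γ, ?_⟩
      have e : (b δ : BrauerAlgebra (m + 1) N) =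
          c N (Fin.last m) j.castSucc * inc (Nat.le_succ m) N (b γ) := by
        rw [← congrFun hcast γ, c, b_mul_b, (cupcap_comp (Fin.castSucc_ne_last j).symm _).1, if_neg,
          pow_zero, one_smul, h]
        rw [embed_pair_off]
        · simp
        · rintro (i | i)
          · simp
          · simp
      rw [e, map_mul, inc_inc, inc_c _ (Fin.castSucc_ne_last j).symm, hpen, hj, mul_assoc,
        mul_assoc, ← hc, ← mul_assoc, ← mul_assoc,
        c_mul_c_mul_c' hup (castLE_ne_pen m j).symm (castLE_ne_ult m j).symm, hc]

theorem exists_isZ (N : ℂ) (i : ℕ) : ∃ g : BrauerAlgebra m N, IsZ m i g := by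
  obtain ⟨g, hg⟩ := exists_c_mul_inc_mul_c m (x N (Fin.last m) ^ i)
  refine ⟨g, (isZ_iff m i g).2 ?_⟩
  rw [map_pow, inc_x] at hg
  exact hg

/-- The element `z_{m + 1}^{(i)}`. -/
noncomputable def z (N : ℂ) (i : ℕ) : BrauerAlgebra m N := (exists_isZ m N i).choose

theorem isZ_z (N : ℂ) (i : ℕ) : IsZ m i (z m N i) := (exists_isZ m N i).choose_spec

theorem isZ_iff_eq (i : ℕ) (g : BrauerAlgebra m N) : IsZ m i g ↔ g = z m N i := by
  constructor
  · intro h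
    apply inc_mul_c_injective
    rw [← (isZ_iff m i g).1 h, ← (isZ_iff m i _).1 (isZ_z m N i)]
  · rintro rfl; exact isZ_z m N i

theorem c_mul_x_pow_mul_c (i : ℕ) :
    c N (pen m) (ult m) * x N (pen m) ^ i * c N (pen m) (ult m) =
      inc (le_add_two m) N (z m N i) * c N (pen m) (ult m) := (isZ_iff m i _).1 (isZ_z m N i)

theorem z_zero : z m N 0 = algebraMap ℂ _ N := by
  refine ((isZ_iff_eq m 0 _).1 ((isZ_iff m 0 _).2 ?_)).symm
  rw [pow_zero, mul_one, c_mul_c_self (pen_ne_ult m), AlgHom.commutes, Algebra.smul_def]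

/-- Both s̄_{m+1} and x_{m+1} commute with B(m, N), hence so does the left side of the equation
defining z; s̄ is then cancelled. -/
theorem z_commute (i : ℕ) (g : BrauerAlgebra m N) : Commute (z m N i) g := by
  have hc := fun g => (commute_inc_c (N := N) (le_add_two m) (pen_ne_ult m) (Nat.le_refl m)
    (Nat.le_succ m) g)
  apply inc_mul_c_injective
  rw [map_mul, map_mul, mul_assoc, ← (hc g).eq, ← mul_assoc, ← c_mul_x_pow_mul_c, mul_assoc,
    (hc g).eq, mul_assoc, ← mul_assoc (_ ^ i),
    ((commute_inc_x (le_add_two m) (Nat.le_refl m) g).pow_left i).eq, mul_assoc, ← mul_assoc,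
    (hc g).eq, mul_assoc, ← mul_assoc (c N _ _), c_mul_x_pow_mul_c, mul_assoc]

end Z

/-- The relations of two strands imply relations between the `z i`. -/
theorem odd_relation {R : Type*} [Ring R] {s e X Y : R} {z : ℕ → R} (hes : e * s = e)
    (hse : s * e = e) (hs : s * X - Y * s = e - 1) (he : e * (X + Y) = 0) (hXY : Commute X Y)
    (hz : ∀ i j, Commute (z i) (z j)) (hez : ∀ i, e * X ^ i * e = z i * e) {i : ℕ} (hi : Odd i) :
    (-2 * z i) * e =
      (z (i - 1) + ∑ j ∈ Finset.Icc 1 i, (-1) ^ j * (z (i - j) * z (j - 1))) * e := by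
  have hY : ∀ j, e * Y ^ j = (-1) ^ j * (e * X ^ j) := by
    intro j
    induction j with
    | zero => simp
    | succ j ih =>
      have h1 : e * Y = -(e * X) := by rw [mul_add] at he; exact eq_neg_of_add_eq_zero_right he
      rw [pow_succ', ← mul_assoc, h1, neg_mul, mul_assoc, (hXY.pow_right j).eq, ← mul_assoc, ih,
        pow_succ, pow_succ]
      simp [mul_assoc]
  -- Each time `s` passes a factor `X` it turns it into `Y` and leaves `e - 1` behind.
  have hsX : ∀ i, s * X ^ i = Y ^ i * s +
      ∑ j ∈ Finset.range i, Y ^ j * (e - 1) * X ^ (i - 1 - j) := by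
    intro i
    induction i with
    | zero => simp
    | succ i ih =>
      have h1 : s * X = Y * s + (e - 1) := by rw [← hs]; abel
      rw [pow_succ', ← mul_assoc, h1, add_mul, mul_assoc, ih, Finset.sum_range_succ', mul_add,
        Finset.mul_sum, pow_succ', mul_assoc, add_assoc]
      congr 2
      · refine Finset.sum_congr rfl fun j _ => ?_
        rw [pow_succ', show i + 1 - 1 - (j + 1) = i - 1 - j by omega]
        simp only [mul_assoc]
      · simp
  -- This is `hsX` between two factors `e`: `s` is absorbed by `e`, powers of `Y` become signed
  -- powers of `X`, and `e - 1` splits each term into a product of two z's and `z (i - 1)`.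
  have h1 : z i * e = (-1) ^ i * (z i * e) + ∑ j ∈ Finset.range i,
      (-1) ^ j * (z j * z (i - 1 - j) * e - z (i - 1) * e) := by
    have h2 : e * (s * X ^ i) * e = e * (Y ^ i * s) * e +
        ∑ j ∈ Finset.range i, e * (Y ^ j * (e - 1) * X ^ (i - 1 - j)) * e := by
      rw [hsX, mul_add, add_mul, Finset.mul_sum, Finset.sum_mul]
    have h3 : e * (s * X ^ i) * e = z i * e := by rw [← mul_assoc, hes, hez]
    have h4 : e * (Y ^ i * s) * e = (-1) ^ i * (z i * e) := by
      rw [← mul_assoc, mul_assoc _ s, hse, hY, mul_assoc, hez]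
    rw [h3, h4] at h2
    refine h2.trans (congrArg _ (Finset.sum_congr rfl fun j hj => ?_))
    rw [Finset.mem_range] at hj
    rw [← mul_assoc, ← mul_assoc, hY, mul_sub, sub_mul, sub_mul, mul_one, mul_sub]
    congr 1
    · rw [mul_assoc ((-1) ^ j) (e * X ^ j) e, hez]
      simp only [mul_assoc]
      rw [← mul_assoc e, hez]
    · rw [mul_assoc, mul_assoc, mul_assoc, ← mul_assoc (X ^ j), ← pow_add,
        show j + (i - 1 - j) = i - 1 by omega, ← mul_assoc e, hez]
  -- For odd `i` the signs in front of `z (i - 1)` add up to 1, and `(-1) ^ i` makes the two terms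
  -- `z i` add up instead of cancelling.
  have h3 : ∑ j ∈ Finset.range i, (-1 : R) ^ j = 1 := by
    clear h1
    obtain ⟨k, rfl⟩ := hi
    rw [Finset.sum_range_succ]
    have : ∑ j ∈ Finset.range (2 * k), (-1 : R) ^ j = 0 := by
      induction k with
      | zero => simp
      | succ k ih =>
        rw [show 2 * (k + 1) = 2 * k + 1 + 1 by ring, Finset.sum_range_succ, Finset.sum_range_succ,
          ih, pow_succ]
        simp
    rw [this]; simp
  have h4 : ∑ j ∈ Finset.Icc 1 i, (-1 : R) ^ j * (z (i - j) * z (j - 1)) * e =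
      -∑ j ∈ Finset.range i, (-1) ^ j * (z j * z (i - 1 - j) * e) := by
    rw [← Finset.sum_neg_distrib]
    refine Finset.sum_nbij' (fun j => j - 1) (fun j => j + 1) ?_ ?_ ?_ ?_ ?_
    · intro j hj; simp only [Finset.mem_Icc, Finset.mem_range] at hj ⊢; omega
    · intro j hj; simp only [Finset.mem_Icc, Finset.mem_range] at hj ⊢; omega
    · intro j hj; simp only [Finset.mem_Icc] at hj; omega
    · intro j _; simp
    · intro j hj
      simp only [Finset.mem_Icc] at hj
      obtain ⟨j, rfl⟩ : ∃ k, j = k + 1 := ⟨j - 1, by omega⟩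
      rw [(hz _ _).eq, pow_succ, show i - 1 - (j + 1 - 1) = i - (j + 1) by omega]
      simp [mul_assoc]
  rw [hi.neg_one_pow] at h1
  rw [add_mul, Finset.sum_mul, h4]
  simp only [mul_sub, Finset.sum_sub_distrib] at h1
  rw [← Finset.sum_mul, h3] at h1
  have h5 : -2 * z i * e = -(z i * e) - z i * e := by
    rw [neg_mul, neg_mul, two_mul, add_mul]; abel
  rw [h5]
  nth_rewrite 2 [h1]
  simp only [one_mul, neg_mul]
  abel

theorem z_odd (m : ℕ) {i : ℕ} (hi : Odd i) : -2 * z m N i =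
    z m N (i - 1) + ∑ j ∈ Finset.Icc 1 i, (-1) ^ j * (z m N (i - j) * z m N (j - 1)) := by
  have hup := pen_ne_ult m
  have hu := ult_eq m
  apply inc_mul_c_injective
  have := odd_relation (z := fun i => inc (le_add_two m) N (z m N i)) (c_mul_t_self hup)
    (t_mul_c_self hup) (t_mul_x hu) (c_mul_x_add_x hu) (x_commute_x (N := N) _ _)
    (fun i j => (z_commute m i (z m N j)).map (inc (le_add_two m) N)) (c_mul_x_pow_mul_c m) hi
  simp only [map_mul, map_add, map_sum, map_pow, map_neg, map_one, map_ofNat]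
  exact this

end BrauerAlgebra

/-! ### Construction of π_m. -/

namespace AffineBrauerAlgebra

open BrauerDiagram BrauerAlgebra

variable {n : ℕ} {N : ℂ}

/-! ### The homomorphisms to the Brauer algebras -/

/-- The inclusion of `B(n, N)` in `B(m + n, N)` on the last strands. -/
noncomputable def shift (m n : ℕ) (N : ℂ) : BrauerAlgebra n N →ₐ[ℂ] BrauerAlgebra (m + n) N :=
  emb (Fin.natAddEmb m) N

/-- The values of the homomorphisms on generators. -/
noncomputable def genMap (m n : ℕ) (N : ℂ) : AffineBrauerGen n N → BrauerAlgebra (m + n) N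
  | .b f => shift m n N f
  | .y k => x N (Fin.natAdd m k)
  | .w i => inc (Nat.le_add_right m n) N (z m N (i + 1))

/-- The homomorphism from the free algebra. -/
noncomputable def freeMap (m n : ℕ) (N : ℂ) :
    FreeAlgebra ℂ (AffineBrauerGen n N) →ₐ[ℂ] BrauerAlgebra (m + n) N :=
  FreeAlgebra.lift ℂ (genMap m n N)

theorem freeMap_B (m : ℕ) (f : BrauerAlgebra n N) :
    freeMap m n N (AffineBrauerGen.B f) = shift m n N f := FreeAlgebra.lift_ι_apply _ _

theorem freeMap_Y (m : ℕ) (k : Fin n) :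
    freeMap m n N (AffineBrauerGen.Y N k) = x N (Fin.natAdd m k) := FreeAlgebra.lift_ι_apply _ _

theorem freeMap_W (m i : ℕ) :
    freeMap m n N (AffineBrauerGen.W n N i) = inc (Nat.le_add_right m n) N (z m N i) := by
  cases i with
  | zero => rw [AffineBrauerGen.W, AlgHom.commutes, z_zero, AlgHom.commutes]
  | succ i => exact FreeAlgebra.lift_ι_apply _ _

theorem shift_s (m k : ℕ) (hk : k + 1 < n) : shift m n N (s N k hk) =
    t N (Fin.natAdd m ⟨k, Nat.lt_of_succ_lt hk⟩) (Fin.natAdd m ⟨k + 1, hk⟩) := emb_t _ _ _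

theorem shift_sbar (m k : ℕ) (hk : k + 1 < n) : shift m n N (sbar N k hk) =
    c N (Fin.natAdd m ⟨k, Nat.lt_of_succ_lt hk⟩) (Fin.natAdd m ⟨k + 1, hk⟩) := emb_c _ (by simp)

theorem inc_commute_shift (m : ℕ) (g : BrauerAlgebra m N) (f : BrauerAlgebra n N) :
    Commute (inc (Nat.le_add_right m n) N g) (shift m n N f) :=
  emb_commute_emb _ _ (fun i j h => by
    have := congrArg Fin.val h
    simp at this
    omega) g f

/-- If `l` comes after both strands, they are among the earlier strands over which the sum in x is
symmetric. If `l` comes before, x involves neither of them. -/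
theorem t_commute_x_natAdd (m k : ℕ) (hk : k + 1 < n) (l : Fin n) (h : (l : ℕ) ≠ k)
    (h' : (l : ℕ) ≠ k + 1) :
    Commute (t N (Fin.natAdd m ⟨k, Nat.lt_of_succ_lt hk⟩) (Fin.natAdd m ⟨k + 1, hk⟩))
      (x N (Fin.natAdd m l)) ∧
    Commute (c N (Fin.natAdd m ⟨k, Nat.lt_of_succ_lt hk⟩) (Fin.natAdd m ⟨k + 1, hk⟩))
      (x N (Fin.natAdd m l)) := by
  rcases lt_or_ge k l with hl | hl
  · have h1 : Fin.natAdd m ⟨k, Nat.lt_of_succ_lt hk⟩ < Fin.natAdd m l := by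
      simp [Fin.lt_def]; omega
    have h2 : Fin.natAdd m ⟨k + 1, hk⟩ < Fin.natAdd m l := by
      simp [Fin.lt_def]; omega
    exact ⟨t_commute_x_of_lt h1 h2, c_commute_x_of_lt (by simp [Fin.ext_iff]) h1 h2⟩
  · have hne : ∀ i ≤ Fin.natAdd m l, Fin.natAdd m ⟨k, Nat.lt_of_succ_lt hk⟩ ≠ i ∧
        Fin.natAdd m ⟨k + 1, hk⟩ ≠ i := by
      intro i hi
      simp only [Fin.le_def, Fin.val_natAdd] at hi
      simp only [ne_eq, Fin.ext_iff, Fin.val_natAdd]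
      omega
    have hkk : Fin.natAdd m ⟨k, Nat.lt_of_succ_lt hk⟩ ≠ Fin.natAdd m ⟨k + 1, hk⟩ := by
      simp [Fin.ext_iff]
    refine ⟨commute_x (fun i hi => ?_) (fun i hi => ?_),
      commute_x (fun i hi => ?_) (fun i hi => ?_)⟩
    · exact t_commute_t (hne _ le_rfl).1 (hne _ hi.le).1 (hne _ le_rfl).2 (hne _ hi.le).2
    · exact t_commute_c (hne _ le_rfl).1 (hne _ hi.le).1 (hne _ le_rfl).2 (hne _ hi.le).2 hi.ne'
    · exact (t_commute_c (hne _ le_rfl).1.symm (hne _ le_rfl).2.symm (hne _ hi.le).1.symm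
        (hne _ hi.le).2.symm hkk).symm
    · exact c_commute_c (hne _ le_rfl).1 (hne _ hi.le).1 (hne _ le_rfl).2 (hne _ hi.le).2 hkk hi.ne'

/-- The equation defining z lives in B(m+2, N) and is carried over by the inclusion into B(m+n, N),
which preserves the Jucys–Murphy elements. -/
theorem c_mul_x_pow_mul_c_natAdd (m i : ℕ) (hn : 0 + 1 < n) :
    c N (Fin.natAdd m ⟨0, Nat.lt_of_succ_lt hn⟩) (Fin.natAdd m ⟨0 + 1, hn⟩) *
      x N (Fin.natAdd m ⟨0, Nat.lt_of_succ_lt hn⟩) ^ i *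
      c N (Fin.natAdd m ⟨0, Nat.lt_of_succ_lt hn⟩) (Fin.natAdd m ⟨0 + 1, hn⟩) =
    inc (Nat.le_add_right m n) N (z m N i) *
      c N (Fin.natAdd m ⟨0, Nat.lt_of_succ_lt hn⟩) (Fin.natAdd m ⟨0 + 1, hn⟩) := by
  have hle : m + 2 ≤ m + n := by omega
  have h := congrArg (inc hle N) (c_mul_x_pow_mul_c (N := N) m i)
  simp only [map_mul, map_pow, inc_x, inc_c _ (pen_ne_ult m), inc_inc] at h
  exact h

theorem freeMap_rel (m : ℕ) ⦃a a' : FreeAlgebra ℂ (AffineBrauerGen n N)⦄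
    (h : AffineBrauerRel n N a a') : freeMap m n N a = freeMap m n N a' := by
  cases h with
  | b_algebraMap a => rw [freeMap_B, AlgHom.commutes, AlgHom.commutes]
  | b_add f g => simp only [freeMap_B, map_add]
  | b_mul f g => simp only [freeMap_B, map_mul]
  | y_comm k l => simp only [map_mul, freeMap_Y]; exact x_commute_x _ _
  | w_b i f => simp only [map_mul, freeMap_W, freeMap_B]; exact inc_commute_shift _ _ _
  | w_y i k =>
    simp only [map_mul, freeMap_W, freeMap_Y]
    exact (commute_inc_x _ (by simp) _).symm
  | w_w i j =>
    simp only [map_mul, freeMap_W]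
    exact (z_commute m i _).map (inc _ N)
  | s_y k hk l h h' =>
    simp only [map_mul, freeMap_B, freeMap_Y, shift_s]
    exact (t_commute_x_natAdd m k hk l h h').1
  | sbar_y k hk l h h' =>
    simp only [map_mul, freeMap_B, freeMap_Y, shift_sbar]
    exact (t_commute_x_natAdd m k hk l h h').2
  | s_y_left k hk =>
    simp only [map_mul, map_sub, map_one, freeMap_B, freeMap_Y, shift_s, shift_sbar]
    exact t_mul_x rfl
  | s_y_right k hk =>
    simp only [map_mul, map_sub, map_one, freeMap_B, freeMap_Y, shift_s, shift_sbar]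
    exact t_mul_x' rfl
  | sbar_y_left k hk =>
    simp only [map_mul, map_add, map_zero, freeMap_B, freeMap_Y, shift_sbar]
    exact c_mul_x_add_x rfl
  | sbar_y_right k hk =>
    simp only [map_mul, map_add, map_zero, freeMap_B, freeMap_Y, shift_sbar]
    exact x_add_x_mul_c rfl
  | sbar_y_sbar i hi hn =>
    simp only [map_mul, map_pow, freeMap_B, freeMap_Y, freeMap_W, shift_sbar]
    exact c_mul_x_pow_mul_c_natAdd m i hn
  | w_odd i hi =>
    have h := congrArg (inc (Nat.le_add_right m n) N) (z_odd (N := N) m hi)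
    simp only [map_mul, map_add, map_sum, map_pow, map_neg, map_one, map_ofNat] at h
    simp only [map_mul, map_add, map_sum, map_pow, map_neg, map_one, map_ofNat, freeMap_W]
    exact h

/-- The homomorphism `π_m`. -/
noncomputable def toBrauer (m n : ℕ) (N : ℂ) :
    AffineBrauerAlgebra n N →ₐ[ℂ] BrauerAlgebra (m + n) N :=
  RingQuot.liftAlgHom ℂ ⟨freeMap m n N, freeMap_rel m⟩

theorem toBrauer_ofBrauer (m : ℕ) (f : BrauerAlgebra n N) :
    toBrauer m n N (ofBrauer f) = shift m n N f :=
  (RingQuot.liftAlgHom_mkAlgHom_apply _ _ _ _).trans (freeMap_B m f)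

theorem toBrauer_y (m : ℕ) (k : Fin n) :
    toBrauer m n N (y N k) = x N (Fin.natAdd m k) :=
  (RingQuot.liftAlgHom_mkAlgHom_apply _ _ _ _).trans (freeMap_Y m k)

theorem toBrauer_w (m i : ℕ) :
    toBrauer m n N (w n N i) = inc (Nat.le_add_right m n) N (z m N i) :=
  (RingQuot.liftAlgHom_mkAlgHom_apply _ _ _ _).trans (freeMap_W m i)

end AffineBrauerAlgebra

/-- The affine Brauer algebra, with its ring structure sealed. -/
def Aff (n : ℕ) (N : ℂ) : Type := AffineBrauerAlgebra n N

/-! ### The degree filtration of A(n, N) and the sliding of y along edges. -/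

namespace Aff

open BrauerDiagram BrauerAlgebra

variable {n : ℕ} {N : ℂ}

noncomputable instance : Ring (Aff n N) := inferInstanceAs (Ring (AffineBrauerAlgebra n N))

noncomputable instance : Algebra ℂ (Aff n N) :=
  inferInstanceAs (Algebra ℂ (AffineBrauerAlgebra n N))

/-! ### Relations in the affine Brauer algebra -/

/-- The quotient map from the free algebra. -/
noncomputable def mk : FreeAlgebra ℂ (AffineBrauerGen n N) →ₐ[ℂ] Aff n N :=
  RingQuot.mkAlgHom ℂ (AffineBrauerRel n N)

theorem mk_surjective : Function.Surjective (mk (n := n) (N := N)) :=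
  RingQuot.mkAlgHom_surjective ℂ (AffineBrauerRel n N)

theorem rel {a a' : FreeAlgebra ℂ (AffineBrauerGen n N)} (h : AffineBrauerRel n N a a') :
    mk a = mk a' :=
  RingQuot.mkAlgHom_rel ℂ h

/-- The generators `y_k`. -/
noncomputable def y (N : ℂ) (k : Fin n) : Aff n N := mk (AffineBrauerGen.Y N k)

/-- The elements `w_0 = N` and `w_1, w_2, …`. -/
noncomputable def w (n : ℕ) (N : ℂ) (i : ℕ) : Aff n N := mk (AffineBrauerGen.W n N i)

/-- The homomorphism `B(n, N) → A(n, N)`. -/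
noncomputable def ofB : BrauerAlgebra n N →ₐ[ℂ] Aff n N where
  toFun f := mk (AffineBrauerGen.B f)
  map_one' := by
    have := rel (AffineBrauerRel.b_algebraMap (n := n) (N := N) 1)
    simpa using this
  map_mul' f g := by
    have := rel (AffineBrauerRel.b_mul f g)
    rwa [map_mul] at this
  map_zero' := by
    have := rel (AffineBrauerRel.b_algebraMap (n := n) (N := N) 0)
    simpa using this
  map_add' f g := by
    have := rel (AffineBrauerRel.b_add f g)
    rwa [map_add] at this
  commutes' a := by
    have := rel (AffineBrauerRel.b_algebraMap (n := n) (N := N) a)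
    rwa [AlgHom.commutes] at this

theorem y_comm (k l : Fin n) : y N k * y N l = y N l * y N k := by
  have := rel (AffineBrauerRel.y_comm (N := N) k l)
  rwa [map_mul, map_mul] at this

theorem w_ofB (i : ℕ) (f : BrauerAlgebra n N) : w n N i * ofB f = ofB f * w n N i := by
  have := rel (AffineBrauerRel.w_b i f)
  rwa [map_mul, map_mul] at this

theorem w_y (i : ℕ) (k : Fin n) : w n N i * y N k = y N k * w n N i := by
  have := rel (AffineBrauerRel.w_y (N := N) i k)
  rwa [map_mul, map_mul] at this

theorem w_w (i j : ℕ) : w n N i * w n N j = w n N j * w n N i := by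
  have := rel (AffineBrauerRel.w_w (n := n) (N := N) i j)
  rwa [map_mul, map_mul] at this

theorem w_zero : w n N 0 = algebraMap ℂ _ N := AlgHom.commutes _ _

section

variable {k k' : Fin n} (h : (k' : ℕ) = k + 1)

include h

theorem t_y_of_ne {l : Fin n} (hl : l ≠ k) (hl' : l ≠ k') :
    ofB (t N k k') * y N l = y N l * ofB (t N k k') := by
  obtain ⟨k, hk⟩ := k
  obtain ⟨k', hk'⟩ := k'
  simp only at h
  subst h
  have := rel (AffineBrauerRel.s_y (N := N) k hk' l (fun h => hl (Fin.ext h))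
    fun h => hl' (Fin.ext h))
  rwa [map_mul, map_mul] at this

theorem c_y_of_ne {l : Fin n} (hl : l ≠ k) (hl' : l ≠ k') :
    ofB (c N k k') * y N l = y N l * ofB (c N k k') := by
  obtain ⟨k, hk⟩ := k
  obtain ⟨k', hk'⟩ := k'
  simp only at h
  subst h
  have := rel (AffineBrauerRel.sbar_y (N := N) k hk' l (fun h => hl (Fin.ext h))
    fun h => hl' (Fin.ext h))
  rwa [map_mul, map_mul] at this

theorem t_y_left : ofB (t N k k') * y N k = y N k' * ofB (t N k k') + (ofB (c N k k') - 1) := by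
  obtain ⟨k, hk⟩ := k
  obtain ⟨k', hk'⟩ := k'
  simp only at h
  subst h
  have := rel (AffineBrauerRel.s_y_left (N := N) k hk')
  rw [map_sub, map_mul, map_mul, map_sub, map_one] at this
  exact sub_eq_iff_eq_add'.1 this

theorem t_y_right : ofB (t N k k') * y N k' = y N k * ofB (t N k k') + (1 - ofB (c N k k')) := by
  obtain ⟨k, hk⟩ := k
  obtain ⟨k', hk'⟩ := k'
  simp only at h
  subst h
  have := rel (AffineBrauerRel.s_y_right (N := N) k hk')
  rw [map_sub, map_mul, map_mul, map_sub, map_one] at this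
  exact sub_eq_iff_eq_add'.1 this

theorem c_y_add_y : ofB (c N k k') * (y N k + y N k') = 0 := by
  obtain ⟨k, hk⟩ := k
  obtain ⟨k', hk'⟩ := k'
  simp only at h
  subst h
  have := rel (AffineBrauerRel.sbar_y_left (N := N) k hk')
  rwa [map_mul, map_zero, map_add] at this

theorem y_add_y_c : (y N k + y N k') * ofB (c N k k') = 0 := by
  obtain ⟨k, hk⟩ := k
  obtain ⟨k', hk'⟩ := k'
  simp only at h
  subst h
  have := rel (AffineBrauerRel.sbar_y_right (N := N) k hk')
  rwa [map_mul, map_zero, map_add] at this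

theorem c_y_pow_c_zero (hk : (k : ℕ) = 0) (i : ℕ) :
    ofB (c N k k') * y N k ^ i * ofB (c N k k') = w n N i * ofB (c N k k') := by
  have hkk : k ≠ k' := ne_of_succ h
  rcases Nat.eq_zero_or_pos i with rfl | hi
  · rw [pow_zero, mul_one, ← map_mul, c_mul_c_self hkk, map_smul, w_zero, Algebra.smul_def]
  obtain ⟨k, hk1⟩ := k
  obtain ⟨k', hk'⟩ := k'
  simp only at h hk
  subst hk
  subst h
  have := rel (AffineBrauerRel.sbar_y_sbar (N := N) i hi hk')
  rwa [map_mul, map_mul, map_mul, map_pow] at this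

end

theorem w_odd {i : ℕ} (hi : Odd i) : -2 * w n N i =
    w n N (i - 1) + ∑ j ∈ Finset.Icc 1 i, (-1) ^ j * (w n N (i - j) * w n N (j - 1)) := by
  have := rel (AffineBrauerRel.w_odd (n := n) (N := N) i hi)
  simp only [map_mul, map_add, map_sum, map_pow, map_neg, map_one, map_ofNat] at this
  exact this

/-! ### The filtration by degree -/

/-- The products of generators, with their degree. -/
inductive Word (n : ℕ) (N : ℂ) : ℕ → Aff n N → Prop
  | one : Word n N 0 1
  | b {d : ℕ} {a : Aff n N} (f : BrauerAlgebra n N) (h : Word n N d a) :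
      Word n N d (ofB f * a)
  | y {d : ℕ} {a : Aff n N} (k : Fin n) (h : Word n N d a) :
      Word n N (d + 1) (y N k * a)
  | w {d : ℕ} {a : Aff n N} (i : ℕ) (h : Word n N d a) :
      Word n N (d + i) (w n N i * a)

theorem Word.mul {d e : ℕ} {a a' : Aff n N} (h : Word n N d a)
    (h' : Word n N e a') : Word n N (d + e) (a * a') := by
  induction h with
  | one => rwa [zero_add, one_mul]
  | b f _ ih => rw [mul_assoc]; exact ih.b f
  | y k _ ih => rw [mul_assoc, add_right_comm]; exact ih.y k
  | w i _ ih => rw [mul_assoc, add_right_comm]; exact ih.w i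

/-- The span of the products of degree less than `d`. -/
noncomputable def F (n : ℕ) (N : ℂ) (d : ℕ) : Submodule ℂ (Aff n N) :=
  Submodule.span ℂ {a | ∃ e < d, Word n N e a}

theorem F_zero : F n N 0 = ⊥ := by simp [F]

theorem F_mono {d e : ℕ} (h : d ≤ e) : F n N d ≤ F n N e :=
  Submodule.span_mono fun _ ⟨e', he', ha⟩ => ⟨e', he'.trans_le h, ha⟩

theorem Word.mem {d e : ℕ} {a : Aff n N} (h : Word n N d a) (hd : d < e) :
    a ∈ F n N e := Submodule.subset_span ⟨d, hd, h⟩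

/-- `F n N d` means degree strictly less than `d`, so degrees at most `d - 1` and `e - 1` add to at
most `d + e - 2`; hence the `f + 1`. -/
theorem F_mul {d e f : ℕ} {a a' : Aff n N} (ha : a ∈ F n N d) (ha' : a' ∈ F n N e)
    (hf : d + e ≤ f + 1) : a * a' ∈ F n N f := by
  have h := Submodule.mul_mem_mul ha ha'
  rw [F, F, Submodule.span_mul_span] at h
  refine Submodule.span_mono ?_ h
  rintro _ ⟨a, ⟨d', hd', ha⟩, a', ⟨e', he', ha'⟩, rfl⟩
  exact ⟨d' + e', by omega, ha.mul ha'⟩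

theorem ofB_mem (f : BrauerAlgebra n N) : ofB f ∈ F n N 1 := by
  have := (Word.b f Word.one).mem (Nat.lt_succ_self 0)
  rwa [mul_one] at this

theorem one_mem_F : (1 : Aff n N) ∈ F n N 1 := Word.one.mem (Nat.lt_succ_self 0)

theorem y_mem (k : Fin n) : y N k ∈ F n N 2 := by
  have := (Word.y (N := N) k Word.one).mem (Nat.lt_succ_self _)
  rwa [mul_one] at this

theorem w_mem (i : ℕ) : w n N i ∈ F n N (i + 1) := by
  have := (Word.w (n := n) (N := N) i Word.one).mem (Nat.lt_succ_self _)
  rwa [mul_one, zero_add] at this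

theorem exists_mem_F (a : Aff n N) : ∃ d, a ∈ F n N d := by
  obtain ⟨a, rfl⟩ := mk_surjective a
  induction a using FreeAlgebra.induction with
  | grade0 r =>
    refine ⟨1, ?_⟩
    rw [AlgHom.commutes, Algebra.algebraMap_eq_smul_one]
    exact Submodule.smul_mem _ _ one_mem_F
  | grade1 g =>
    cases g with
    | b f => exact ⟨1, ofB_mem f⟩
    | y k => exact ⟨2, y_mem k⟩
    | w i => exact ⟨i + 2, w_mem (i + 1)⟩
  | mul a a' ha ha' =>
    obtain ⟨d, hd⟩ := ha
    obtain ⟨e, he⟩ := ha'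
    rw [map_mul]
    exact ⟨d + e, F_mul hd he (by omega)⟩
  | add a a' ha ha' =>
    obtain ⟨d, hd⟩ := ha
    obtain ⟨e, he⟩ := ha'
    rw [map_add]
    exact ⟨d + e, Submodule.add_mem _ (F_mono (by omega) hd) (F_mono (by omega) he)⟩

/-- Every term on the right of the quadratic relation has degree `i - 1`. Thus the generators of odd
index are superfluous modulo lower degrees. -/
theorem w_odd_mem {i : ℕ} (hi : Odd i) : w n N i ∈ F n N i := by
  have hi0 : 0 < i := hi.pos
  have h : -2 * w n N i ∈ F n N i := by
    rw [w_odd hi]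
    refine Submodule.add_mem _ (F_mono (by omega) (w_mem (i - 1))) (Submodule.sum_mem _ ?_)
    intro j hj
    rw [Finset.mem_Icc] at hj
    have h1 : w n N (i - j) * w n N (j - 1) ∈ F n N i := F_mul (w_mem _) (w_mem _) (by omega)
    rcases neg_one_pow_eq_or (Aff n N) j with h2 | h2 <;> rw [h2]
    · rwa [one_mul]
    · rw [neg_one_mul]; exact Submodule.neg_mem _ h1
  have h2 : w n N i = (-(1 / 2) : ℂ) • (-2 * w n N i) := by
    have : (-2 : Aff n N) * w n N i = (-2 : ℂ) • w n N i := by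
      rw [Algebra.smul_def, map_neg, map_ofNat]
    rw [this, smul_smul]
    norm_num
  rw [h2]
  exact Submodule.smul_mem _ _ h

/-! ### Moving the `y_k` along the edges -/

/-- The action of `y` at a vertex: on the left at the top, with a sign on the right at the bottom. -/
noncomputable def slide (v : Fin n ⊕ Fin n) (a : Aff n N) :
    Aff n N :=
  Sum.elim (fun k => y N k * a) (fun k => -(a * y N k)) v

@[simp] theorem slide_inl (k : Fin n) (a : Aff n N) :
    slide (Sum.inl k) a = y N k * a := rfl

@[simp] theorem slide_inr (k : Fin n) (a : Aff n N) :
    slide (Sum.inr k) a = -(a * y N k) := rfl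

theorem t_y_sub_mem {k k' : Fin n} (h : (k' : ℕ) = k + 1) (i : Fin n) :
    ofB (t N k k') * y N i - y N (Equiv.swap k k' i) * ofB (t N k k') ∈ F n N 1 := by
  by_cases h1 : i = k
  · subst h1
    rw [Equiv.swap_apply_left, t_y_left h, add_sub_cancel_left]
    exact Submodule.sub_mem _ (ofB_mem _) one_mem_F
  by_cases h2 : i = k'
  · subst h2
    rw [Equiv.swap_apply_right, t_y_right h, add_sub_cancel_left]
    exact Submodule.sub_mem _ one_mem_F (ofB_mem _)
  · rw [Equiv.swap_apply_of_ne_of_ne h1 h2, t_y_of_ne h h1 h2, sub_self]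
    exact Submodule.zero_mem _

theorem slide_t_mul {k k' : Fin n} (h : (k' : ℕ) = k + 1) (v : Fin n ⊕ Fin n)
    (f : BrauerAlgebra n N) :
    ofB (t N k k') * slide v (ofB f) - slide (topPerm (Equiv.swap k k') v) (ofB (t N k k' * f)) ∈
      F n N 1 := by
  rcases v with i | i
  · rw [topPerm_inl, slide_inl, slide_inl, map_mul, ← mul_assoc, ← mul_assoc, ← sub_mul]
    exact F_mul (t_y_sub_mem h i) (ofB_mem f) (by omega)
  · rw [topPerm_inr, slide_inr, slide_inr, map_mul, mul_neg, mul_assoc, sub_self]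
    exact Submodule.zero_mem _

theorem slide_c_mul {k k' : Fin n} (h : (k' : ℕ) = k + 1) {v : Fin n ⊕ Fin n}
    (hv : v ≠ Sum.inl k) (hv' : v ≠ Sum.inl k') (a : Aff n N) :
    slide v (ofB (c N k k') * a) = ofB (c N k k') * slide v a := by
  rcases v with i | i
  · rw [slide_inl, slide_inl, ← mul_assoc, ← c_y_of_ne h (by simpa using hv) (by simpa using hv'),
      mul_assoc]
  · rw [slide_inr, slide_inr, mul_assoc, mul_neg]

/-- A y at one end of an edge equals, modulo degree 0, a y at the other end: with the opposite sign
for a horizontal edge, with the same sign otherwise. The sign built into `slide` makes this one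
statement, proved along the generation of `γ`. -/
theorem slide_add_slide_mem (γ : BrauerDiagram n) (v : Fin n ⊕ Fin n) :
    slide v (ofB (b γ : BrauerAlgebra n N)) + slide (γ.pair v) (ofB (b γ)) ∈ F n N 1 := by
  induction generated γ generalizing v with
  | one =>
    have h1 : ofB (b (one n) : BrauerAlgebra n N) = 1 := by rw [← one_def, map_one]
    rw [h1]
    rcases v with i | i <;> simp [one]
  | transp k hk γ _ ih =>
    have hb := t_mul_b (N := N) ⟨k, Nat.lt_of_succ_lt hk⟩ ⟨k + 1, hk⟩ γ
    rw [← hb]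
    obtain ⟨u, rfl⟩ :=
      (topPerm (Equiv.swap (⟨k, Nat.lt_of_succ_lt hk⟩ : Fin n) ⟨k + 1, hk⟩)).surjective v
    rw [conj_pair, Equiv.symm_apply_apply]
    have h1 := slide_t_mul (N := N) (k := ⟨k, Nat.lt_of_succ_lt hk⟩) (k' := ⟨k + 1, hk⟩) rfl u (b γ)
    have h2 := slide_t_mul (N := N) (k := ⟨k, Nat.lt_of_succ_lt hk⟩) (k' := ⟨k + 1, hk⟩) rfl
      (γ.pair u) (b γ)
    have h3 := F_mul (f := 1)
      (ofB_mem (t N (⟨k, Nat.lt_of_succ_lt hk⟩ : Fin n) ⟨k + 1, hk⟩)) (ih u) (by omega)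
    rw [mul_add] at h3
    have := Submodule.sub_mem _ h3 (Submodule.add_mem _ h1 h2)
    convert this using 1
    abel
  | cupcap k hk γ _ hl ih =>
    have hne : (⟨k, Nat.lt_of_succ_lt hk⟩ : Fin n) ≠ ⟨k + 1, hk⟩ := by simp
    have hb := c_mul_b_of_ne (N := N) hne hl
    rw [← hb, map_mul]
    have hs : (((⟨k + 1, hk⟩ : Fin n)) : ℕ) = (⟨k, Nat.lt_of_succ_lt hk⟩ : Fin n) + 1 := rfl
    set k0 : Fin n := ⟨k, Nat.lt_of_succ_lt hk⟩
    set k1 : Fin n := ⟨k + 1, hk⟩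
    have hpp := γ.pair_pair
    have hpn := γ.pair_ne
    have hin := inl_ne_inl hne
    -- The new edge on top: here the relation `(y_k + y_{k+1}) s̄_k = 0` applies exactly.
    have hcap : slide (Sum.inl k0) (ofB (c N k0 k1) * ofB (b γ)) +
        slide (Sum.inl k1) (ofB (c N k0 k1) * ofB (b γ)) = 0 := by
      rw [slide_inl, slide_inl, ← add_mul, ← mul_assoc, y_add_y_c hs, zero_mul]
    -- The edge that replaces the two former edges at `k0` and `k1`: y is slid along each of them
    -- inside `γ`, and between them `s̄_k (y_k + y_{k+1}) = 0` is used.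
    have key : slide (γ.pair (Sum.inl k0)) (ofB (c N k0 k1) * ofB (b γ)) +
        slide (γ.pair (Sum.inl k1)) (ofB (c N k0 k1) * ofB (b γ)) ∈ F n N 1 := by
      rw [slide_c_mul hs (hpn _) hl, slide_c_mul hs _ (hpn _), ← mul_add]
      · have h1 := F_mul (f := 1) (ofB_mem (c N k0 k1)) (Submodule.add_mem _ (ih (Sum.inl k0))
          (ih (Sum.inl k1))) (by omega)
        have h2 : ofB (c N k0 k1) * (slide (Sum.inl k0) (ofB (b γ)) +
            slide (Sum.inl k1) (ofB (b γ))) = 0 := by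
          rw [slide_inl, slide_inl, ← add_mul, ← mul_assoc, c_y_add_y hs, zero_mul]
        have h3 : ofB (c N k0 k1) * (slide (γ.pair (Sum.inl k0)) (ofB (b γ)) +
            slide (γ.pair (Sum.inl k1)) (ofB (b γ))) = ofB (c N k0 k1) *
            (slide (Sum.inl k0) (ofB (b γ)) + slide (γ.pair (Sum.inl k0)) (ofB (b γ)) +
            (slide (Sum.inl k1) (ofB (b γ)) + slide (γ.pair (Sum.inl k1)) (ofB (b γ)))) -
            ofB (c N k0 k1) * (slide (Sum.inl k0) (ofB (b γ)) +
            slide (Sum.inl k1) (ofB (b γ))) := by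
          rw [← mul_sub]; congr 1; abel
        rw [h3, h2, sub_zero]
        exact h1
      · intro h1; apply hl; rw [← h1, hpp]
    rw [join_pair]
    split_ifs with h1 h2 h3 h4
    · rw [h1, hcap]; exact Submodule.zero_mem _
    · rw [h2, add_comm, hcap]; exact Submodule.zero_mem _
    · rw [h3]; exact key
    · rw [h4, add_comm]; exact key
    · rw [slide_c_mul hs h1 h2, slide_c_mul hs, ← mul_add]
      · exact F_mul (ofB_mem _) (ih v) (by omega)
      · intro h5; apply h3; rw [← h5, hpp]
      · intro h5; apply h4; rw [← h5, hpp]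

end Aff

/-! ### Regular monomials span each degree modulo lower degrees. -/

namespace Aff

open BrauerDiagram BrauerAlgebra

variable {n : ℕ} {N : ℂ}

/-! ### Regular monomials -/

instance : LeftCommutative (fun (k : Fin n) (a : Aff n N) => y N k * a) :=
  ⟨fun k l a => by rw [← mul_assoc, y_comm, mul_assoc]⟩

instance : LeftCommutative (fun (i : ℕ) (a : Aff n N) => w n N i * a) :=
  ⟨fun i j a => by rw [← mul_assoc, w_w, mul_assoc]⟩

/-- A monomial in the `y_k`. -/
noncomputable def ypow (N : ℂ) (a : Multiset (Fin n)) : Aff n N :=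
  a.foldr (fun k u => y N k * u) 1

/-- A monomial in the `w_i`. -/
noncomputable def wpow (n : ℕ) (N : ℂ) (h : Multiset ℕ) : Aff n N :=
  h.foldr (fun i u => w n N i * u) 1

@[simp] theorem ypow_zero : ypow N (0 : Multiset (Fin n)) = 1 := rfl

@[simp] theorem ypow_cons (k : Fin n) (a : Multiset (Fin n)) :
    ypow N (k ::ₘ a) = y N k * ypow N a := Multiset.foldr_cons _ _ _ _

@[simp] theorem wpow_zero : wpow n N 0 = 1 := rfl

@[simp] theorem wpow_cons (i : ℕ) (h : Multiset ℕ) :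
    wpow n N (i ::ₘ h) = w n N i * wpow n N h := Multiset.foldr_cons _ _ _ _

theorem y_commute_ypow (k : Fin n) (a : Multiset (Fin n)) : Commute (y N k) (ypow N a) := by
  induction a using Multiset.induction with
  | empty => exact Commute.one_right _
  | cons l a ih => rw [ypow_cons]; exact (show Commute _ _ from y_comm k l).mul_right ih

theorem w_commute_ypow (i : ℕ) (a : Multiset (Fin n)) : Commute (w n N i) (ypow N a) := by
  induction a using Multiset.induction with
  | empty => exact Commute.one_right _
  | cons l a ih => rw [ypow_cons]; exact (show Commute _ _ from w_y i l).mul_right ih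

theorem y_commute_wpow (k : Fin n) (h : Multiset ℕ) : Commute (y N k) (wpow n N h) := by
  induction h using Multiset.induction with
  | empty => exact Commute.one_right _
  | cons i h ih => rw [wpow_cons]; exact (show Commute _ _ from (w_y i k).symm).mul_right ih

theorem ofB_commute_wpow (f : BrauerAlgebra n N) (h : Multiset ℕ) :
    Commute (ofB f) (wpow n N h) := by
  induction h using Multiset.induction with
  | empty => exact Commute.one_right _
  | cons i h ih => rw [wpow_cons]; exact (show Commute _ _ from (w_ofB i f).symm).mul_right ih

theorem ypow_commute_wpow (a : Multiset (Fin n)) (h : Multiset ℕ) :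
    Commute (ypow N a) (wpow n N h) := by
  induction a using Multiset.induction with
  | empty => exact Commute.one_left _
  | cons k a ih => rw [ypow_cons]; exact (y_commute_wpow k h).mul_left ih

theorem ypow_mem (a : Multiset (Fin n)) : ypow N a ∈ F n N (a.card + 1) := by
  induction a using Multiset.induction with
  | empty => exact one_mem_F
  | cons k a ih =>
    rw [ypow_cons, Multiset.card_cons]
    exact F_mul (y_mem k) ih (by omega)

theorem wpow_mem (h : Multiset ℕ) : wpow n N h ∈ F n N (h.sum + 1) := by
  induction h using Multiset.induction with
  | empty => exact one_mem_F
  | cons i h ih =>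
    rw [wpow_cons, Multiset.sum_cons]
    exact F_mul (w_mem i) ih (by omega)

/-- The monomial `y^a w^h b(γ) y^c`. -/
noncomputable def mono (N : ℂ) (a : Multiset (Fin n)) (h : Multiset ℕ) (γ : BrauerDiagram n)
    (c : Multiset (Fin n)) : Aff n N :=
  ypow N a * wpow n N h * ofB (b γ) * ypow N c

/-- The order of the vertices: first the top, then the bottom. -/
def rank (v : Fin n ⊕ Fin n) : ℕ := Sum.elim (fun i : Fin n => (i : ℕ)) (fun i : Fin n => n + (i : ℕ)) v

theorem rank_injective : Function.Injective (rank (n := n)) := by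
  rintro (i | i) (j | j) h <;> simp only [rank, Sum.elim_inl, Sum.elim_inr] at h
  · rw [Fin.ext h]
  · omega
  · omega
  · rw [Fin.ext (Nat.add_left_cancel h)]

/-- The first end of an edge. -/
def Primary (γ : BrauerDiagram n) (v : Fin n ⊕ Fin n) : Prop := rank v < rank (γ.pair v)

theorem primary_pair {γ : BrauerDiagram n} {v : Fin n ⊕ Fin n} (h : ¬ Primary γ v) :
    Primary γ (γ.pair v) := by
  rw [Primary, γ.pair_pair]
  exact lt_of_le_of_ne (not_lt.1 h) fun h' => γ.pair_ne v (rank_injective h')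

/-- The exponents of a regular monomial. -/
structure Regular (a : Multiset (Fin n)) (h : Multiset ℕ) (γ : BrauerDiagram n)
    (c : Multiset (Fin n)) : Prop where
  left : ∀ k ∈ a, Primary γ (Sum.inl k)
  right : ∀ k ∈ c, Primary γ (Sum.inr k)
  even : ∀ i ∈ h, Even i ∧ 0 < i

/-- The span of the regular monomials of degree `d`. -/
noncomputable def R (n : ℕ) (N : ℂ) (d : ℕ) : Submodule ℂ (Aff n N) :=
  Submodule.span ℂ {u | ∃ a h γ c, Regular a h γ c ∧ a.card + h.sum + c.card = d ∧
    u = mono N a h γ c}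

/-- The span of the regular monomials of degree `d` modulo lower degrees. -/
noncomputable def K (n : ℕ) (N : ℂ) (d : ℕ) : Submodule ℂ (Aff n N) := R n N d ⊔ F n N d

theorem mono_mid_mem {a : Multiset (Fin n)} {h : Multiset ℕ} {c : Multiset (Fin n)} {d : ℕ}
    (hd : a.card + h.sum + c.card = d) {u : Aff n N} (hu : u ∈ F n N 1) :
    ypow N a * wpow n N h * u * ypow N c ∈ F n N (d + 1) := by
  have h1 : ypow N a * wpow n N h ∈ F n N (a.card + h.sum + 1) :=
    F_mul (ypow_mem a) (wpow_mem h) (by omega)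
  have h2 : ypow N a * wpow n N h * u ∈ F n N (a.card + h.sum + 1) := F_mul h1 hu (by omega)
  exact F_mul h2 (ypow_mem c) (by omega)

theorem mono_mem_F (a : Multiset (Fin n)) (h : Multiset ℕ) (γ : BrauerDiagram n)
    (c : Multiset (Fin n)) : mono N a h γ c ∈ F n N (a.card + h.sum + c.card + 1) :=
  mono_mid_mem rfl (ofB_mem (b γ))

theorem F_le_K (d : ℕ) : F n N d ≤ K n N d := le_sup_right

theorem R_le_F (d : ℕ) : R n N d ≤ F n N (d + 1) := by
  rw [R, Submodule.span_le]
  rintro _ ⟨a, h, γ, c, -, rfl, rfl⟩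
  exact mono_mem_F a h γ c

theorem K_le_F (d : ℕ) : K n N d ≤ F n N (d + 1) := sup_le (R_le_F d) (F_mono (Nat.le_succ d))

theorem mono_mem_K {a : Multiset (Fin n)} {h : Multiset ℕ} {γ : BrauerDiagram n}
    {c : Multiset (Fin n)} (hr : Regular a h γ c) {d : ℕ} (hd : a.card + h.sum + c.card = d) :
    mono N a h γ c ∈ K n N d :=
  le_sup_left (a := R n N d) (Submodule.subset_span ⟨a, h, γ, c, hr, hd, rfl⟩)

/-- The spaces `K n N d` are shown to be stable, with the right shift of degree, under left
multiplication by every generator; this reduces each case to regular monomials. -/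
theorem K_map {d d' : ℕ} (φ : Aff n N →ₗ[ℂ] Aff n N)
    (h1 : ∀ a h γ c, Regular a h γ c → a.card + h.sum + c.card = d → φ (mono N a h γ c) ∈ K n N d')
    (h2 : ∀ u ∈ F n N d, φ u ∈ F n N d') {u : Aff n N} (hu : u ∈ K n N d) : φ u ∈ K n N d' := by
  have : K n N d ≤ (K n N d').comap φ := by
    refine sup_le ?_ fun u hu => F_le_K d' (h2 u hu)
    rw [R, Submodule.span_le]
    rintro _ ⟨a, h, γ, c, hr, hd, rfl⟩
    exact h1 a h γ c hr hd
  exact this hu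

theorem mem_K_of_sub {d : ℕ} {u v : Aff n N} (h : u - v ∈ F n N d) (hv : v ∈ K n N d) :
    u ∈ K n N d := by
  rw [← sub_add_cancel u v]
  exact Submodule.add_mem _ (F_le_K d h) hv

theorem y_mul_mono (k : Fin n) (a : Multiset (Fin n)) (h : Multiset ℕ) (γ : BrauerDiagram n)
    (c : Multiset (Fin n)) :
    y N k * mono N a h γ c = ypow N a * wpow n N h * (y N k * ofB (b γ)) * ypow N c := by
  rw [mono, ← mul_assoc, ← mul_assoc, ← mul_assoc, ← mul_assoc, (y_commute_ypow k a).eq,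
    mul_assoc (ypow N a), (y_commute_wpow k h).eq, ← mul_assoc]

theorem mono_mul_y (k : Fin n) (a : Multiset (Fin n)) (h : Multiset ℕ) (γ : BrauerDiagram n)
    (c : Multiset (Fin n)) :
    mono N a h γ c * y N k = ypow N a * wpow n N h * (ofB (b γ) * y N k) * ypow N c := by
  simp only [mono, mul_assoc, (y_commute_ypow k c).eq]

theorem y_mul_mono_eq (k : Fin n) (a : Multiset (Fin n)) (h : Multiset ℕ) (γ : BrauerDiagram n)
    (c : Multiset (Fin n)) : y N k * mono N a h γ c = mono N (k ::ₘ a) h γ c := by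
  simp only [mono, ypow_cons, mul_assoc]

theorem mono_mul_y_eq (k : Fin n) (a : Multiset (Fin n)) (h : Multiset ℕ) (γ : BrauerDiagram n)
    (c : Multiset (Fin n)) : mono N a h γ c * y N k = mono N a h γ (k ::ₘ c) := by
  simp only [mono, ypow_cons, mul_assoc, (y_commute_ypow k c).eq]

/-- If the vertex of `k` is not the first end of its edge, the new y is slid to the first end, at
the cost of a sign and of terms of lower degree. -/
theorem y_mul_mem_K (k : Fin n) {d : ℕ} {u : Aff n N} (hu : u ∈ K n N d) :
    y N k * u ∈ K n N (d + 1) := by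
  refine K_map (LinearMap.mulLeft ℂ (y N k)) (fun a h γ c hr hd => ?_)
    (fun u hu => F_mul (y_mem k) hu (by omega)) hu
  rw [LinearMap.mulLeft_apply]
  by_cases hk : Primary γ (Sum.inl k)
  · rw [y_mul_mono_eq]
    exact mono_mem_K ⟨by simpa using ⟨hk, hr.left⟩, hr.right, hr.even⟩ (by
      rw [Multiset.card_cons]; omega)
  · have hp := primary_pair hk
    have hs := slide_add_slide_mem (N := N) γ (Sum.inl k)
    rcases hj : γ.pair (Sum.inl k) with j | j
    · rw [hj] at hp hs
      have h1 := mono_mid_mem (a := a) (h := h) (c := c) hd hs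
      have h2 : mono N (j ::ₘ a) h γ c ∈ K n N (d + 1) :=
        mono_mem_K ⟨by simpa using ⟨hp, hr.left⟩, hr.right, hr.even⟩ (by
          rw [Multiset.card_cons]; omega)
      refine mem_K_of_sub (v := -mono N (j ::ₘ a) h γ c) ?_ (Submodule.neg_mem _ h2)
      rw [← y_mul_mono_eq, y_mul_mono, y_mul_mono]
      rw [slide_inl, slide_inl, mul_add, add_mul] at h1
      rwa [sub_neg_eq_add]
    -- A top vertex whose partner is at the bottom is always the first end, since the top comes
    -- first in `rank`.
    · exfalso
      apply hk
      rw [Primary, hj]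
      simp only [rank, Sum.elim_inl, Sum.elim_inr]
      omega

theorem mul_y_mem_K (k : Fin n) {d : ℕ} {u : Aff n N} (hu : u ∈ K n N d) :
    u * y N k ∈ K n N (d + 1) := by
  refine K_map (LinearMap.mulRight ℂ (y N k)) (fun a h γ c hr hd => ?_)
    (fun u hu => F_mul hu (y_mem k) (by omega)) hu
  rw [LinearMap.mulRight_apply]
  by_cases hk : Primary γ (Sum.inr k)
  · rw [mono_mul_y_eq]
    exact mono_mem_K ⟨hr.left, by simpa using ⟨hk, hr.right⟩, hr.even⟩ (by
      rw [Multiset.card_cons]; omega)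
  · have hp := primary_pair hk
    have hs := slide_add_slide_mem (N := N) γ (Sum.inr k)
    rcases hj : γ.pair (Sum.inr k) with j | j
    · rw [hj] at hp hs
      have h1 := mono_mid_mem (a := a) (h := h) (c := c) hd hs
      have h2 : mono N (j ::ₘ a) h γ c ∈ K n N (d + 1) :=
        mono_mem_K ⟨by simpa using ⟨hp, hr.left⟩, hr.right, hr.even⟩ (by
          rw [Multiset.card_cons]; omega)
      refine mem_K_of_sub (v := mono N (j ::ₘ a) h γ c) ?_ h2
      rw [← y_mul_mono_eq, y_mul_mono, mono_mul_y]
      rw [slide_inr, slide_inl, mul_add, add_mul, mul_neg, neg_mul] at h1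
      rw [← Submodule.neg_mem_iff]
      convert h1 using 1
      abel
    · rw [hj] at hp hs
      have h1 := mono_mid_mem (a := a) (h := h) (c := c) hd hs
      have h2 : mono N a h γ (j ::ₘ c) ∈ K n N (d + 1) :=
        mono_mem_K ⟨hr.left, by simpa using ⟨hp, hr.right⟩, hr.even⟩ (by
          rw [Multiset.card_cons]; omega)
      refine mem_K_of_sub (v := -mono N a h γ (j ::ₘ c)) ?_ (Submodule.neg_mem _ h2)
      rw [← mono_mul_y_eq, mono_mul_y, mono_mul_y]
      rw [slide_inr, slide_inr, mul_add, add_mul, mul_neg, neg_mul, mul_neg, neg_mul] at h1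
      rw [← Submodule.neg_mem_iff]
      convert h1 using 1
      abel

theorem w_mul_mem_K (i : ℕ) {d : ℕ} {u : Aff n N} (hu : u ∈ K n N d) :
    w n N i * u ∈ K n N (i + d) := by
  rcases Nat.even_or_odd i with hi | hi
  · rcases Nat.eq_zero_or_pos i with rfl | hi0
    · rw [w_zero, ← Algebra.smul_def, zero_add]
      exact Submodule.smul_mem _ _ hu
    · refine K_map (LinearMap.mulLeft ℂ (w n N i)) (fun a h γ c hr hd => ?_)
        (fun u hu => F_mul (w_mem i) hu (by omega)) hu
      have : w n N i * mono N a h γ c = mono N a (i ::ₘ h) γ c := by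
        simp only [mono, wpow_cons]
        rw [← mul_assoc, ← mul_assoc, ← mul_assoc, (w_commute_ypow i a).eq, mul_assoc (ypow N a)]
      rw [LinearMap.mulLeft_apply, this]
      exact mono_mem_K ⟨hr.left, hr.right, by simpa using ⟨⟨hi, hi0⟩, hr.even⟩⟩ (by
        rw [Multiset.sum_cons]; omega)
  · exact F_le_K _ (F_mul (w_odd_mem hi) (K_le_F d hu) (by omega))

theorem ypow_mul_mem_K (a : Multiset (Fin n)) {d : ℕ} {u : Aff n N} (hu : u ∈ K n N d) :
    ypow N a * u ∈ K n N (a.card + d) := by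
  induction a using Multiset.induction with
  | empty => simpa using hu
  | cons k a ih =>
    rw [ypow_cons, mul_assoc, Multiset.card_cons, add_right_comm]
    exact y_mul_mem_K k ih

theorem mul_ypow_mem_K (a : Multiset (Fin n)) {d : ℕ} {u : Aff n N} (hu : u ∈ K n N d) :
    u * ypow N a ∈ K n N (d + a.card) := by
  induction a using Multiset.induction with
  | empty => simpa using hu
  | cons k a ih =>
    rw [ypow_cons, (y_commute_ypow k a).eq, ← mul_assoc, Multiset.card_cons, ← add_assoc]
    exact mul_y_mem_K k ih

theorem wpow_mul_mem_K (h : Multiset ℕ) {d : ℕ} {u : Aff n N} (hu : u ∈ K n N d) :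
    wpow n N h * u ∈ K n N (h.sum + d) := by
  induction h using Multiset.induction with
  | empty => simpa using hu
  | cons i h ih =>
    rw [wpow_cons, mul_assoc, Multiset.sum_cons, add_assoc]
    exact w_mul_mem_K i ih

theorem ofB_b_mem_K (γ : BrauerDiagram n) : ofB (b γ : BrauerAlgebra n N) ∈ K n N 0 := by
  have : ofB (b γ : BrauerAlgebra n N) = mono N 0 0 γ 0 := by simp [mono]
  rw [this]
  exact mono_mem_K ⟨by simp, by simp, by simp⟩ (by simp)

theorem ypow_replicate (k : Fin n) (r : ℕ) : ypow N (Multiset.replicate r k) = y N k ^ r := by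
  induction r with
  | zero => rw [Multiset.replicate_zero, ypow_zero, pow_zero]
  | succ r ih => rw [Multiset.replicate_succ, ypow_cons, ih, pow_succ']

theorem pow_mem {u : Aff n N} (hu : u ∈ F n N 2) (r : ℕ) : u ^ r ∈ F n N (r + 1) := by
  induction r with
  | zero => rw [pow_zero]; exact one_mem_F
  | succ r ih => rw [pow_succ]; exact F_mul ih hu (by omega)

/-! ### Multiplication by the generators of the Brauer algebra -/

section Neighbours

variable {k k' : Fin n} (hk : (k' : ℕ) = k + 1)

include hk

theorem t_mul_ypow_sub_mem (a : Multiset (Fin n)) :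
    ofB (t N k k') * ypow N a - ypow N (a.map (Equiv.swap k k')) * ofB (t N k k') ∈
      F n N a.card := by
  induction a using Multiset.induction with
  | empty => simp
  | cons i a ih =>
    have h1 := F_mul (t_y_sub_mem (N := N) hk i) (ypow_mem (N := N) a)
      (show 1 + (a.card + 1) ≤ (a.card + 1) + 1 by omega)
    have h2 := F_mul (y_mem (N := N) (Equiv.swap k k' i)) ih
      (show 2 + a.card ≤ (a.card + 1) + 1 by omega)
    rw [Multiset.map_cons, ypow_cons, ypow_cons, Multiset.card_cons]
    convert Submodule.add_mem _ h1 h2 using 1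
    noncomm_ring

/-- Moving s_k past y^a permutes the exponents modulo lower degrees. The outcome need not be
regular, and the stability under multiplication by y and w restores this. -/
theorem t_mul_mem_K {d : ℕ} {u : Aff n N} (hu : u ∈ K n N d) : ofB (t N k k') * u ∈ K n N d := by
  refine K_map (LinearMap.mulLeft ℂ (ofB (t N k k'))) (fun a h γ c hr hd => ?_)
    (fun u hu => F_mul (ofB_mem _) hu (by omega)) hu
  rw [LinearMap.mulLeft_apply]
  refine mem_K_of_sub (v := ypow N (a.map (Equiv.swap k k')) *
    (wpow n N h * ofB (t N k k' * b γ)) * ypow N c) ?_ ?_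
  · have h1 : (ofB (t N k k') * ypow N a - ypow N (a.map (Equiv.swap k k')) * ofB (t N k k')) *
        wpow n N h ∈ F n N (a.card + h.sum) :=
      F_mul (t_mul_ypow_sub_mem hk a) (wpow_mem h) (by omega)
    have h2 := F_mul (f := d) (F_mul (f := a.card + h.sum) h1 (ofB_mem (b γ)) (by omega))
      (ypow_mem c) (by omega)
    convert h2 using 1
    rw [mono, map_mul, ← mul_assoc (wpow n N h), ← (ofB_commute_wpow (t N k k') h).eq]
    noncomm_ring
  · rw [t_mul_b]
    have h1 := mul_ypow_mem_K c (ypow_mul_mem_K (a.map (Equiv.swap k k'))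
      (wpow_mul_mem_K h (ofB_b_mem_K (N := N) (conj (topPerm (Equiv.swap k k')) γ))))
    rw [Multiset.card_map] at h1
    convert h1 using 2
    omega

theorem c_mul_pow (r : ℕ) : ofB (c N k k') * y N k ^ r * y N k' =
    -(ofB (c N k k') * y N k ^ (r + 1)) := by
  have h1 : ofB (c N k k') * y N k' = -(ofB (c N k k') * y N k) := by
    have := c_y_add_y (N := N) hk
    rw [mul_add] at this
    exact eq_neg_of_add_eq_zero_right this
  have h2 : y N k ^ r * y N k' = y N k' * y N k ^ r :=
    ((show Commute (y N k) (y N k') from y_comm k k').pow_left r).eq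
  rw [mul_assoc, h2, ← mul_assoc, h1, neg_mul, mul_assoc, pow_succ']

end Neighbours

theorem y_pow_mul_sub_mem_left (γ : BrauerDiagram n) {k j : Fin n}
    (h : γ.pair (Sum.inl k) = Sum.inl j) (r : ℕ) :
    y N k ^ r * ofB (b γ) - (-y N j) ^ r * ofB (b γ) ∈ F n N r := by
  have hs := slide_add_slide_mem (N := N) γ (Sum.inl k)
  rw [h, slide_inl, slide_inl] at hs
  induction r with
  | zero => simp
  | succ r ih =>
    have h1 := F_mul (f := r + 1) (y_mem k) ih (by omega)
    have h2 := F_mul (f := r + 1) (pow_mem (Submodule.neg_mem _ (y_mem (N := N) j)) r) hs (by omega)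
    have hc : y N k * (-y N j) ^ r = (-y N j) ^ r * y N k :=
      (((show Commute (y N k) (y N j) from y_comm k j).neg_right).pow_right r).eq
    convert Submodule.add_mem _ h1 h2 using 1
    rw [mul_sub, ← mul_assoc, ← mul_assoc, hc, mul_add, pow_succ', pow_succ]
    noncomm_ring

theorem y_pow_mul_sub_mem_right (γ : BrauerDiagram n) {k j : Fin n}
    (h : γ.pair (Sum.inl k) = Sum.inr j) (r : ℕ) :
    y N k ^ r * ofB (b γ) - ofB (b γ) * y N j ^ r ∈ F n N r := by
  have hs := slide_add_slide_mem (N := N) γ (Sum.inl k)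
  rw [h, slide_inl, slide_inr] at hs
  induction r with
  | zero => simp
  | succ r ih =>
    have h1 := F_mul (f := r + 1) (y_mem k) ih (by omega)
    have h2 := F_mul (f := r + 1) hs (pow_mem (y_mem (N := N) j) r) (by omega)
    convert Submodule.add_mem _ h1 h2 using 1
    rw [pow_succ', pow_succ']
    noncomm_ring

/-- The defining relation concerns the first two strands only. The step to the next pair conjugates
by s_j s_k, which carries s̄_j to s̄_k exactly and y_j to y_k modulo lower degrees. -/
theorem c_y_pow_c_sub_mem {k k' : Fin n} (hk : (k' : ℕ) = k + 1) (r : ℕ) :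
    ofB (c N k k') * y N k ^ r * ofB (c N k k') - w n N r * ofB (c N k k') ∈ F n N r := by
  obtain ⟨m, hm⟩ : ∃ m, (k : ℕ) = m := ⟨_, rfl⟩
  induction m generalizing k k' with
  | zero => rw [c_y_pow_c_zero hk hm, sub_self]; exact Submodule.zero_mem _
  | succ m ih =>
    obtain ⟨j, hj⟩ : ∃ j : Fin n, (j : ℕ) = m := ⟨⟨m, by omega⟩, rfl⟩
    have hjk : (k : ℕ) = j + 1 := by omega
    have h1 : j ≠ k := ne_of_succ hjk
    have h2 : k ≠ k' := ne_of_succ hk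
    have h3 : j ≠ k' := by rintro rfl; omega
    have e1 : t N k k' * c N j k = c N j k' * t N k k' := by
      rw [t_mul_c _ _ h1, Equiv.swap_apply_of_ne_of_ne h1 h3, Equiv.swap_apply_left]
    have e2 : t N j k * c N j k' = c N k k' * t N j k := by
      rw [t_mul_c _ _ h3, Equiv.swap_apply_left, Equiv.swap_apply_of_ne_of_ne h3.symm h2.symm]
    have e3 : t N j k * c N k k' = c N j k' * t N j k := by
      rw [t_mul_c _ _ h2, Equiv.swap_apply_right, Equiv.swap_apply_of_ne_of_ne h3.symm h2.symm]
    have e4 : t N k k' * c N j k' = c N j k * t N k k' := by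
      rw [t_mul_c _ _ h3, Equiv.swap_apply_of_ne_of_ne h1 h3, Equiv.swap_apply_right]
    set s1 := ofB (t N j k) with hs1
    set s2 := ofB (t N k k') with hs2
    set e := ofB (c N k k') with he
    set e0 := ofB (c N j k) with he0
    have s11 : s1 * s1 = 1 := by rw [hs1, ← map_mul, t_mul_t_self, map_one]
    have s22 : s2 * s2 = 1 := by rw [hs2, ← map_mul, t_mul_t_self, map_one]
    have hg : s1 * s2 * e0 = e * (s1 * s2) := by
      simp only [hs1, hs2, he, he0, ← map_mul]
      rw [mul_assoc, e1, ← mul_assoc, e2, mul_assoc]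
    have hg' : s2 * s1 * e = e0 * (s2 * s1) := by
      simp only [hs1, hs2, he, he0, ← map_mul]
      rw [mul_assoc, e3, ← mul_assoc, e4, mul_assoc]
    have gg' : s1 * s2 * (s2 * s1) = 1 := by
      rw [mul_assoc, ← mul_assoc s2, s22, one_mul, s11]
    have hD0 : s1 * y N k ^ r - y N j ^ r * s1 ∈ F n N r := by
      have := t_mul_ypow_sub_mem (N := N) hjk (Multiset.replicate r k)
      rwa [Multiset.map_replicate, Equiv.swap_apply_right, ypow_replicate, ypow_replicate,
        Multiset.card_replicate] at this
    have hg1 : s1 * s2 ∈ F n N 1 := F_mul (ofB_mem _) (ofB_mem _) (by omega)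
    have hg2 : s2 * s1 ∈ F n N 1 := F_mul (ofB_mem _) (ofB_mem _) (by omega)
    -- Only passing `s1` costs terms of lower degree; `s2` commutes with `y N j`.
    have hD : s2 * s1 * y N k ^ r * (s1 * s2) - y N j ^ r ∈ F n N r := by
      have h4 := F_mul (f := r) (F_mul (f := r) (ofB_mem (t N k k')) hD0 (by omega)) hg1 (by omega)
      have hc : s2 * y N j ^ r = y N j ^ r * s2 :=
        ((show Commute s2 (y N j) from t_y_of_ne hk h1 h3).pow_right r).eq
      convert h4 using 1
      rw [mul_sub, sub_mul, ← hs2, mul_assoc s2 s1]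
      congr 1
      rw [mul_assoc s2, mul_assoc _ s1, ← mul_assoc s1 s1, s11, one_mul, ← mul_assoc, hc,
        mul_assoc, s22, mul_one]
    have h4 := F_mul (f := r) (F_mul (f := r) (F_mul (f := r) (ofB_mem (c N j k)) hD (by omega))
      (ofB_mem (c N j k)) (by omega)) (F_mul (f := 1) hg2 one_mem_F (by omega)) (by omega)
    have h5 := F_mul (f := r) hg1 h4 (by omega)
    have h6 := F_mul (f := r) (F_mul (f := r) hg1 (ih hjk hj) (by omega)) hg2 (by omega)
    convert Submodule.add_mem _ h5 h6 using 1
    rw [← he0, mul_one]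
    have h7 : e * (s1 * s2) * (s2 * s1) = e := by rw [mul_assoc, gg', mul_one]
    have ha : e * y N k ^ r * e =
        s1 * s2 * (e0 * (s2 * s1 * y N k ^ r * (s1 * s2)) * e0 * (s2 * s1)) := by
      have : s1 * s2 * (e0 * (s2 * s1 * y N k ^ r * (s1 * s2)) * e0 * (s2 * s1)) =
          (s1 * s2 * e0) * (s2 * s1) * y N k ^ r * ((s1 * s2) * e0 * (s2 * s1)) := by
        noncomm_ring
      rw [this, hg, h7]
    have hb : w n N r * e = s1 * s2 * (w n N r * e0) * (s2 * s1) := by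
      have hw : s1 * s2 * w n N r = w n N r * (s1 * s2) := by
        rw [hs1, hs2, ← map_mul, w_ofB]
      rw [← mul_assoc (s1 * s2), hw, mul_assoc (w n N r), hg, mul_assoc (w n N r), h7]
    rw [ha, hb]
    noncomm_ring

/-- A diagram with top edge `{k, k'}` is thus s̄ times another diagram without a loop. This avoids
writing `b γ` as `N⁻¹` times s̄ `b γ`, which fails for `N = 0`. -/
theorem exists_join_eq {γ : BrauerDiagram n} {k k' : Fin n} (hkk : k ≠ k')
    (h : γ.pair (Sum.inl k) = Sum.inl k') :
    ∃ γ' : BrauerDiagram n, γ'.pair (Sum.inl k) ≠ Sum.inl k' ∧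
      join _ _ (inl_ne_inl hkk) γ' = γ := by
  -- Without a bottom edge, the bottom vertices would be matched with all the top vertices,
  -- including `k`.
  obtain ⟨j, j', hj⟩ : ∃ j j', γ.pair (Sum.inr j) = Sum.inr j' := by
    by_contra! hno
    have hex : ∀ j, ∃ i, γ.pair (Sum.inr j) = Sum.inl i := by
      intro j
      rcases hi : γ.pair (Sum.inr j) with i | i
      · exact ⟨i, rfl⟩
      · exact absurd hi (hno j i)
    choose f hf using hex
    have hinj : Function.Injective f := by
      intro i j hij
      have : γ.pair (Sum.inr i) = γ.pair (Sum.inr j) := by rw [hf, hf, hij]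
      simpa using γ.pair_injective this
    obtain ⟨j, hj⟩ := Finite.injective_iff_surjective.1 hinj k
    have h1 := hf j
    rw [hj, pair_eq_iff, h] at h1
    simp at h1
  have hne : (Sum.inl k : Fin n ⊕ Fin n) ≠ Sum.inr j := by simp
  have h1 := γ.pair_pair
  have h2 := inl_ne_inl hkk
  refine ⟨join _ _ hne γ, ?_, ?_⟩
  · simp [join_pair]
  · ext1; funext v
    simp only [join_pair]
    grind

theorem c_mul_mem_K_zero (k k' : Fin n) (hkk : k ≠ k') (γ : BrauerDiagram n) :
    ofB (c N k k') * ofB (b γ) ∈ K n N 0 := by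
  rw [← map_mul, c_mul_b hkk, map_smul]
  exact Submodule.smul_mem _ _ (ofB_b_mem_K _)

/-- The edge of `γ` at `k` decides. If it leads to `k'`, then `γ` absorbs another s̄ and `w_r`
appears. If it leads to another top vertex, the power of y is slid there and commutes with s̄. If it
leads to the bottom, the power is slid to the right end. -/
theorem c_mul_y_pow_mem_K {k k' : Fin n} (hk : (k' : ℕ) = k + 1) (r : ℕ) (γ : BrauerDiagram n) :
    ofB (c N k k') * y N k ^ r * ofB (b γ) ∈ K n N r := by
  have hkk : k ≠ k' := ne_of_succ hk
  rcases hj : γ.pair (Sum.inl k) with j | j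
  · by_cases hj' : j = k'
    · subst hj'
      obtain ⟨γ', h1, h2⟩ := exists_join_eq hkk hj
      have h3 := c_mul_b_of_ne (N := N) hkk h1
      rw [h2] at h3
      have h0 := w_mul_mem_K r (ofB_b_mem_K (N := N) γ)
      rw [add_zero] at h0
      refine mem_K_of_sub (v := w n N r * ofB (b γ)) ?_ h0
      have h4 := F_mul (f := r) (c_y_pow_c_sub_mem (N := N) hk r) (ofB_mem (b γ')) (by omega)
      have h5 : (ofB (c N k j) * y N k ^ r * ofB (c N k j) - w n N r * ofB (c N k j)) *
          ofB (b γ') = ofB (c N k j) * y N k ^ r * ofB (c N k j * b γ') -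
          w n N r * ofB (c N k j * b γ') := by
        rw [sub_mul, map_mul, mul_assoc, mul_assoc (w n N r)]
      rw [h5, h3] at h4
      exact h4
    · have hjk : j ≠ k := by rintro rfl; exact γ.pair_ne _ hj
      have h1 := F_mul (f := r) (ofB_mem (c N k k')) (y_pow_mul_sub_mem_left (N := N) γ hj r)
        (by omega)
      rw [mul_sub, ← mul_assoc] at h1
      refine mem_K_of_sub h1 ?_
      have hc : ofB (c N k k') * (-y N j) ^ r = (-y N j) ^ r * ofB (c N k k') :=
        (((show Commute (ofB (c N k k')) (y N j) from c_y_of_ne hk hjk hj').neg_right).pow_right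
          r).eq
      rw [← mul_assoc, hc, mul_assoc, neg_pow, ← ypow_replicate, mul_assoc]
      have h2 := ypow_mul_mem_K (Multiset.replicate r j) (c_mul_mem_K_zero (N := N) k k' hkk γ)
      rw [Multiset.card_replicate, add_zero] at h2
      rcases neg_one_pow_eq_or (Aff n N) r with h3 | h3 <;> rw [h3]
      · rwa [one_mul]
      · rw [neg_one_mul]; exact Submodule.neg_mem _ h2
  · have h1 := F_mul (f := r) (ofB_mem (c N k k')) (y_pow_mul_sub_mem_right (N := N) γ hj r)
      (by omega)
    rw [mul_sub, ← mul_assoc] at h1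
    refine mem_K_of_sub h1 ?_
    have h2 := mul_ypow_mem_K (Multiset.replicate r j) (c_mul_mem_K_zero (N := N) k k' hkk γ)
    rwa [ypow_replicate, Multiset.card_replicate, mul_assoc, zero_add] at h2

/-- Next to s̄, every y_{k+1} is minus a y_k, so these factors are collected in the power `r`, and
the other y's commute out to the left. -/
theorem c_mul_y_pow_ypow_mem_K {k k' : Fin n} (hk : (k' : ℕ) = k + 1) (r : ℕ)
    (a : Multiset (Fin n)) (γ : BrauerDiagram n) :
    ofB (c N k k') * y N k ^ r * ypow N a * ofB (b γ) ∈ K n N (r + a.card) := by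
  induction a using Multiset.induction generalizing r with
  | empty => simpa using c_mul_y_pow_mem_K hk r γ
  | cons i a ih =>
    rw [ypow_cons, Multiset.card_cons, ← mul_assoc]
    by_cases h1 : i = k
    · rw [h1, mul_assoc _ _ (y N k), ← pow_succ, add_comm a.card, ← add_assoc]
      exact ih (r + 1)
    by_cases h2 : i = k'
    · rw [h2, c_mul_pow hk, neg_mul, neg_mul, add_comm a.card, ← add_assoc]
      exact Submodule.neg_mem _ (ih (r + 1))
    · have hc : ofB (c N k k') * y N k ^ r * y N i = y N i * (ofB (c N k k') * y N k ^ r) :=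
        ((show Commute (ofB (c N k k')) (y N i) from c_y_of_ne hk h1 h2).mul_left
          ((show Commute (y N k) (y N i) from y_comm k i).pow_left r)).eq
      rw [hc, mul_assoc, mul_assoc, ← mul_assoc (ofB (c N k k') * y N k ^ r), ← add_assoc]
      exact y_mul_mem_K i (ih r)

theorem c_mul_mem_K {k k' : Fin n} (hk : (k' : ℕ) = k + 1) {d : ℕ} {u : Aff n N}
    (hu : u ∈ K n N d) : ofB (c N k k') * u ∈ K n N d := by
  refine K_map (LinearMap.mulLeft ℂ (ofB (c N k k'))) (fun a h γ c' hr hd => ?_)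
    (fun u hu => F_mul (ofB_mem _) hu (by omega)) hu
  rw [LinearMap.mulLeft_apply]
  have h1 := mul_ypow_mem_K c' (wpow_mul_mem_K h (c_mul_y_pow_ypow_mem_K (N := N) hk 0 a γ))
  have h2 : ofB (c N k k') * mono N a h γ c' =
      wpow n N h * (ofB (c N k k') * y N k ^ 0 * ypow N a * ofB (b γ)) * ypow N c' := by
    rw [pow_zero, mul_one, mono, (ypow_commute_wpow a h).eq, ← mul_assoc, ← mul_assoc,
      ← mul_assoc, (ofB_commute_wpow _ h).eq]
    simp only [mul_assoc]
  rw [h2]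
  convert h1 using 2
  omega

theorem ofB_mul_mem_K (f : BrauerAlgebra n N) {d : ℕ} {u : Aff n N} (hu : u ∈ K n N d) :
    ofB f * u ∈ K n N d := by
  induction f using span_induction with
  | hadd f g hf hg => rw [map_add, add_mul]; exact Submodule.add_mem _ hf hg
  | hsmul a f hf => rw [map_smul, smul_mul_assoc]; exact Submodule.smul_mem _ _ hf
  | hb γ =>
    refine b_induction (P := fun f => ofB f * u ∈ K n N d) ?_ (fun k hk γ ih => ?_)
      (fun k hk γ ih => ?_) γ
    · rwa [map_one, one_mul]
    · rw [map_mul, mul_assoc]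
      exact t_mul_mem_K rfl ih
    · rw [map_mul, mul_assoc]
      exact c_mul_mem_K rfl ih

theorem Word.mem_K {d : ℕ} {u : Aff n N} (h : Word n N d u) : u ∈ K n N d := by
  induction h with
  | one =>
    have := ofB_b_mem_K (N := N) (BrauerDiagram.one n)
    rwa [← one_def, map_one] at this
  | b f _ ih => exact ofB_mul_mem_K f ih
  | y k _ ih => exact y_mul_mem_K k ih
  | w i _ ih => rw [add_comm]; exact w_mul_mem_K i ih

theorem F_succ_le_K (d : ℕ) : F n N (d + 1) ≤ K n N d := by
  rw [F, Submodule.span_le]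
  rintro u ⟨e, he, hu⟩
  rcases Nat.lt_succ_iff_lt_or_eq.1 he with h | rfl
  · exact F_le_K d (hu.mem h)
  · exact hu.mem_K

end Aff

/-! ### The degree filtration of the Brauer algebra. -/

namespace BrauerDiagram

variable {n : ℕ}

/-! ### The degree of a diagram -/

/-- The number of strands in `S` which are not vertical edges. -/
def cnt (S : Finset (Fin n)) (γ : BrauerDiagram n) : ℕ :=
  (S.filter fun l => γ.pair (Sum.inl l) ≠ Sum.inr l).card

theorem comp_pair_vertical {γ γ' : BrauerDiagram n} {l : Fin n}
    (h : γ.pair (Sum.inl l) = Sum.inr l) (h' : γ'.pair (Sum.inl l) = Sum.inr l) :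
    (comp γ γ').pair (Sum.inl l) = Sum.inr l := by
  refine comp_pair_eq γ γ' (by simp) ?_
  have h1 : glued γ γ' (upper (Sum.inl l)) (upper (Sum.inr l)) := by
    rw [← h]; exact Relation.EqvGen.rel _ _ (GlueEdge.up _)
  have h2 : glued γ γ' (lower (Sum.inl l)) (lower (Sum.inr l)) := by
    rw [← h']; exact Relation.EqvGen.rel _ _ (GlueEdge.low _)
  exact (glued γ γ').trans' h1 h2

/-- A strand vertical in both factors is vertical in the composition. -/
theorem cnt_comp_le (S : Finset (Fin n)) (γ γ' : BrauerDiagram n) :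
    cnt S (comp γ γ') ≤ cnt S γ + cnt S γ' := by
  refine le_trans (Finset.card_le_card ?_) (Finset.card_union_le _ _)
  intro l hl
  simp only [Finset.mem_filter, Finset.mem_union] at hl ⊢
  by_contra! h
  exact hl.2 (comp_pair_vertical (h.1 hl.1) (h.2 hl.1))

theorem cnt_mono {S S' : Finset (Fin n)} (h : S ⊆ S') (γ : BrauerDiagram n) :
    cnt S γ ≤ cnt S' γ := Finset.card_le_card (Finset.filter_subset_filter _ h)

theorem cnt_flip (S : Finset (Fin n)) (γ : BrauerDiagram n) : cnt S (flip γ) = cnt S γ := by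
  unfold cnt
  congr 1
  ext l
  have : (flip γ).pair (Sum.inl l) = Sum.inr l ↔ γ.pair (Sum.inl l) = Sum.inr l := by
    rw [flip_pair, Sum.swap_inl, pair_eq_iff γ (a := Sum.inl l)]
    rcases γ.pair (Sum.inr l) with i | i <;> simp [eq_comm]
  simp only [Finset.mem_filter, ne_eq, this]

theorem cnt_one (S : Finset (Fin n)) : cnt S (one n) = 0 := by
  simp [cnt, one]

theorem pair_transp_of_ne {k l i : Fin n} (hk : i ≠ k) (hl : i ≠ l) :
    (transp k l).pair (Sum.inl i) = Sum.inr i := by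
  simp [transp, Equiv.swap_apply_of_ne_of_ne hk hl]

theorem pair_cupcap_of_ne {k l i : Fin n} (hk : i ≠ k) (hl : i ≠ l) :
    (cupcap k l).pair (Sum.inl i) = Sum.inr i := by
  simp [cupcap, Equiv.swap_apply_of_ne_of_ne hk hl]

theorem cnt_le_of_ne {S : Finset (Fin n)} {γ : BrauerDiagram n} {k l : Fin n}
    (h : ∀ i, i ≠ k → i ≠ l → γ.pair (Sum.inl i) = Sum.inr i) : cnt S γ ≤ ({k, l} ∩ S).card := by
  refine Finset.card_le_card fun i hi => ?_
  simp only [Finset.mem_filter, Finset.mem_inter, Finset.mem_insert, Finset.mem_singleton] at hi ⊢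
  refine ⟨?_, hi.1⟩
  by_contra! h'
  exact hi.2 (h i h'.1 h'.2)

theorem card_pair_inter_le_one {S : Finset (Fin n)} {k l : Fin n} (hk : k ∉ S) :
    ({k, l} ∩ S).card ≤ 1 := by
  rw [Finset.insert_inter_of_notMem hk]
  exact (Finset.card_le_card Finset.inter_subset_left).trans (Finset.card_singleton l).le

theorem card_pair_inter_eq_zero {S : Finset (Fin n)} {k l : Fin n} (hk : k ∉ S) (hl : l ∉ S) :
    ({k, l} ∩ S).card = 0 := by
  rw [Finset.insert_inter_of_notMem hk, Finset.singleton_inter_of_notMem hl, Finset.card_empty]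

end BrauerDiagram

namespace BrauerAlgebra

open BrauerDiagram

variable {n : ℕ} {N : ℂ}

/-- The elements supported on a set of diagrams. -/
noncomputable def bspan (N : ℂ) (A : Set (BrauerDiagram n)) : Submodule ℂ (BrauerAlgebra n N) :=
  Submodule.span ℂ (b '' A)

theorem b_mem_bspan {A : Set (BrauerDiagram n)} {γ : BrauerDiagram n} (h : γ ∈ A) :
    b γ ∈ bspan N A := Submodule.subset_span ⟨γ, h, rfl⟩

theorem bspan_mono {A A' : Set (BrauerDiagram n)} (h : A ⊆ A') : bspan N A ≤ bspan N A' :=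
  Submodule.span_mono (Set.image_mono h)

theorem map_mem_of_mem_bspan {V : Type*} [AddCommGroup V] [Module ℂ V]
    {A : Set (BrauerDiagram n)} {W : Submodule ℂ V} (φ : BrauerAlgebra n N →ₗ[ℂ] V)
    (h : ∀ γ ∈ A, φ (b γ) ∈ W) {f : BrauerAlgebra n N} (hf : f ∈ bspan N A) : φ f ∈ W := by
  have : bspan N A ≤ W.comap φ := by
    rw [bspan, Submodule.span_le]
    rintro _ ⟨γ, hγ, rfl⟩
    exact h γ hγ
  exact this hf

theorem mem_bspan_iff {A : Set (BrauerDiagram n)} {f : BrauerAlgebra n N} :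
    f ∈ bspan N A ↔ ∀ γ, coeff γ f ≠ 0 → γ ∈ A := by
  classical
  constructor
  · intro hf γ hγ
    by_contra hA
    refine hγ ?_
    have : coeff γ f ∈ (⊥ : Submodule ℂ ℂ) := by
      refine map_mem_of_mem_bspan (coeff γ) (fun γ' h' => ?_) hf
      rw [coeff_b, if_neg (by rintro rfl; exact hA h')]
      exact Submodule.zero_mem _
    exact this
  · intro h
    have h1 : f = Finsupp.sum (show BrauerDiagram n →₀ ℂ from f)
        fun γ a => Finsupp.single γ a := (Finsupp.sum_single _).symm
    rw [h1]
    refine Submodule.sum_mem _ fun γ hγ => ?_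
    have h2 : (Finsupp.single γ ((show BrauerDiagram n →₀ ℂ from f) γ) : BrauerDiagram n →₀ ℂ) =
        (coeff γ f) • (b γ : BrauerAlgebra n N) := by
      change _ = (coeff γ f) • (Finsupp.single γ (1 : ℂ))
      rw [Finsupp.smul_single, smul_eq_mul, mul_one]; rfl
    exact (congrArg (fun u : BrauerAlgebra n N => u ∈ bspan N A) h2).mpr
      (Submodule.smul_mem _ _ (b_mem_bspan (h γ (Finsupp.mem_support_iff.1 hγ))))

theorem coeff_eq_zero {A : Set (BrauerDiagram n)} {f : BrauerAlgebra n N} (hf : f ∈ bspan N A)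
    {γ : BrauerDiagram n} (h : γ ∉ A) : coeff γ f = 0 := by
  by_contra h'
  exact h (mem_bspan_iff.1 hf γ h')

/-- The elements of degree less than `d`, where the degree counts the strands in `S`. -/
noncomputable def Deg (N : ℂ) (S : Finset (Fin n)) (d : ℕ) : Submodule ℂ (BrauerAlgebra n N) :=
  bspan N {γ | cnt S γ < d}

theorem b_mem_Deg {S : Finset (Fin n)} {d : ℕ} {γ : BrauerDiagram n} (h : cnt S γ < d) :
    b γ ∈ Deg N S d := b_mem_bspan h

theorem Deg_mono {S S' : Finset (Fin n)} {d d' : ℕ} (hS : S' ⊆ S) (h : d ≤ d') :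
    Deg N S d ≤ Deg N S' d' :=
  bspan_mono fun γ hγ => lt_of_le_of_lt (cnt_mono hS γ) (lt_of_lt_of_le hγ h)

theorem coeff_eq_zero_of_Deg {S : Finset (Fin n)} {d : ℕ} {f : BrauerAlgebra n N}
    (hf : f ∈ Deg N S d) {γ : BrauerDiagram n} (h : d ≤ cnt S γ) : coeff γ f = 0 :=
  coeff_eq_zero hf (by simpa using h)

theorem Deg_mul {S : Finset (Fin n)} {d e k : ℕ} {f g : BrauerAlgebra n N} (hf : f ∈ Deg N S d)
    (hg : g ∈ Deg N S e) (h : d + e ≤ k + 1) : f * g ∈ Deg N S k := by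
  refine map_mem_of_mem_bspan (LinearMap.mulRight ℂ g) (fun γ hγ => ?_) hf
  refine map_mem_of_mem_bspan (LinearMap.mulLeft ℂ (b γ)) (fun γ' hγ' => ?_) hg
  rw [LinearMap.mulLeft_apply, b_mul_b]
  refine Submodule.smul_mem _ _ (b_mem_Deg ?_)
  have := cnt_comp_le S γ γ'
  simp only [Set.mem_ofPred_eq] at hγ hγ'
  omega

theorem one_mem_Deg (S : Finset (Fin n)) : (1 : BrauerAlgebra n N) ∈ Deg N S 1 :=
  b_mem_Deg (by rw [cnt_one]; omega)

theorem algebraMap_mem_Deg (S : Finset (Fin n)) (a : ℂ) :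
    algebraMap ℂ (BrauerAlgebra n N) a ∈ Deg N S 1 := by
  rw [Algebra.algebraMap_eq_smul_one]
  exact Submodule.smul_mem _ _ (one_mem_Deg S)

theorem pow_mem_Deg {S : Finset (Fin n)} {f : BrauerAlgebra n N} (hf : f ∈ Deg N S 2) (r : ℕ) :
    f ^ r ∈ Deg N S (r + 1) := by
  induction r with
  | zero => rw [pow_zero]; exact one_mem_Deg S
  | succ r ih => rw [pow_succ]; exact Deg_mul ih hf (by omega)

theorem t_mem_Deg {S : Finset (Fin n)} {k l : Fin n} {d : ℕ} (h : ({k, l} ∩ S).card < d) :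
    t N k l ∈ Deg N S d :=
  b_mem_Deg (lt_of_le_of_lt (cnt_le_of_ne fun _ h1 h2 => pair_transp_of_ne h1 h2) h)

theorem c_mem_Deg {S : Finset (Fin n)} {k l : Fin n} {d : ℕ} (h : ({k, l} ∩ S).card < d) :
    c N k l ∈ Deg N S d :=
  b_mem_Deg (lt_of_le_of_lt (cnt_le_of_ne fun _ h1 h2 => pair_cupcap_of_ne h1 h2) h)

theorem d_mem_Deg {S : Finset (Fin n)} {k l : Fin n} {e : ℕ} (h : ({k, l} ∩ S).card < e) :
    d N k l ∈ Deg N S e := Submodule.sub_mem _ (t_mem_Deg h) (c_mem_Deg h)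

theorem sum_d_mem_Deg {S : Finset (Fin n)} {k : Fin n} (h : k ∉ S) (T : Finset (Fin n)) :
    ∑ l ∈ T, d N k l ∈ Deg N S 2 :=
  Submodule.sum_mem _ fun _ _ => d_mem_Deg (Nat.lt_succ_of_le (card_pair_inter_le_one h))

theorem x_mem_Deg {S : Finset (Fin n)} {k : Fin n} (h : k ∉ S) : x N k ∈ Deg N S 2 := by
  rw [x_eq]
  exact Submodule.add_mem _ (Deg_mono subset_rfl one_le_two (algebraMap_mem_Deg S _))
    (sum_d_mem_Deg h _)

theorem flipL_mem_Deg {S : Finset (Fin n)} {d : ℕ} {f : BrauerAlgebra n N} (hf : f ∈ Deg N S d) :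
    flipL f ∈ Deg N S d := by
  refine map_mem_of_mem_bspan flipL (fun γ hγ => ?_) hf
  rw [flipL_b]
  exact b_mem_Deg (by rw [cnt_flip]; exact hγ)

/-! ### The degree of the elements `z i` -/

section Z

variable (m : ℕ)

/-- The first `m` of `m + 2` strands. -/
def inner : Finset (Fin (m + 2)) := Finset.univ.map (Fin.castLEEmb (le_add_two m))

theorem pen_notMem : pen m ∉ inner m := by
  simp [inner, castLE_ne_pen]

theorem ult_notMem : ult m ∉ inner m := by
  simp [inner, castLE_ne_ult]

theorem cnt_addCap (S : Finset (Fin m)) (γ : BrauerDiagram m) :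
    cnt (S.map (Fin.castLEEmb (le_add_two m))) (addCap m γ) = cnt S γ := by
  rw [cnt, cnt, Finset.filter_map, Finset.card_map]
  congr 1
  ext l
  have h := addCap_pair_map m γ (Sum.inl l)
  have h' : (addCap m γ).pair (Sum.inl (Fin.castLE (le_add_two m) l)) =
      Sum.inr (Fin.castLE (le_add_two m) l) ↔ γ.pair (Sum.inl l) = Sum.inr l := by
    rw [Sum.map_inl] at h
    rw [h]
    rcases γ.pair (Sum.inl l) with i | i <;> simp
  rw [Finset.mem_filter, Finset.mem_filter, Function.comp_apply]
  exact and_congr_right fun _ => not_congr h'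

/-- Adding the horizontal edges on two new strands does not change which strands of `S` are
vertical, so degrees of z can be computed after multiplication by s̄. -/
theorem mem_Deg_of_inc_mul_c {g : BrauerAlgebra m N} {S : Finset (Fin m)} {d : ℕ}
    (h : inc (le_add_two m) N g * c N (pen m) (ult m) ∈
      Deg N (S.map (Fin.castLEEmb (le_add_two m))) d) : g ∈ Deg N S d := by
  rw [Deg, mem_bspan_iff] at h ⊢
  intro γ hγ
  rw [inc_mul_c] at h
  have := h (addCap m γ) (by rwa [coeff_lift_b (addCap_injective m)])
  rwa [Set.mem_ofPred_eq, cnt_addCap] at this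

theorem c_mem_Deg_inner : c N (pen m) (ult m) ∈ Deg N (inner m) 1 :=
  c_mem_Deg (by rw [card_pair_inter_eq_zero (pen_notMem m) (ult_notMem m)]; omega)

theorem z_mem_Deg (i : ℕ) : z m N i ∈ Deg N Finset.univ (i + 1) := by
  apply mem_Deg_of_inc_mul_c
  rw [← c_mul_x_pow_mul_c]
  exact Deg_mul (Deg_mul (k := i + 1) (c_mem_Deg_inner m)
    (pow_mem_Deg (x_mem_Deg (pen_notMem m)) i) (by omega)) (c_mem_Deg_inner m) (by omega)

end Z

end BrauerAlgebra

/-! ### The leading part of z and its coefficients at permutations. -/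

namespace BrauerAlgebra

open BrauerDiagram

variable {m : ℕ} {N : ℂ}

/-! ### The top degree part of `z i` -/

/-- The sum of the `d N l l'` over all the strands `l' ≠ l`. -/
noncomputable def star (N : ℂ) (l : Fin m) : BrauerAlgebra m N :=
  ∑ l' ∈ Finset.univ.erase l, d N l l'

theorem inc_d {p q : ℕ} (h : p ≤ q) {k l : Fin p} (hkl : k ≠ l) :
    inc h N (d N k l) = d N (Fin.castLE h k) (Fin.castLE h l) := by
  rw [d, map_sub, inc_t, inc_c h hkl, d]

theorem d_comm {n : ℕ} (k l : Fin n) : d N k l = d N l k := by rw [d, d, t_comm, c_comm]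

theorem inc_star {p q : ℕ} (h : p ≤ q) (l : Fin p) : inc h N (star N l) =
    ∑ l' ∈ Finset.univ.erase l, d N (Fin.castLE h l) (Fin.castLE h l') := by
  rw [star, map_sum]
  exact Finset.sum_congr rfl fun l' hl' => inc_d h (Finset.ne_of_mem_erase hl').symm

theorem Deg_insert {n : ℕ} {S S' : Finset (Fin n)} {l : Fin n} (h : S' ⊆ insert l S) {k : ℕ} :
    Deg N S k ≤ Deg N S' (k + 1) := by
  refine bspan_mono fun γ hγ => ?_
  have h1 : cnt S' γ ≤ cnt S γ + 1 := by
    refine le_trans (Finset.card_le_card ?_) (Finset.card_insert_le l _)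
    intro i hi
    simp only [Finset.mem_filter, Finset.mem_insert] at hi ⊢
    rcases Finset.mem_insert.1 (h hi.1) with h2 | h2
    · exact Or.inl h2
    · exact Or.inr ⟨h2, hi.2⟩
  simp only [Set.mem_ofPred_eq] at hγ ⊢
  omega

section Strand

variable (l : Fin m)

/-- The first `m` of `m + 2` strands, except for one. -/
def others : Finset (Fin (m + 2)) :=
  (Finset.univ.erase l).map (Fin.castLEEmb (le_add_two m))

theorem others_subset : others l ⊆ inner m := Finset.map_subset_map.2 (Finset.erase_subset _ _)

theorem pen_notMem_others : pen m ∉ others l := fun h => pen_notMem m (others_subset l h)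

theorem castLE_notMem_others : Fin.castLE (le_add_two m) l ∉ others l := by
  simp [others]

theorem inner_subset_insert : inner m ⊆ insert (Fin.castLE (le_add_two m) l) (others l) := by
  intro i hi
  simp only [inner, Finset.mem_map, Finset.mem_univ, true_and] at hi
  obtain ⟨j, rfl⟩ := hi
  by_cases h : j = l
  · simp [h]
  · refine Finset.mem_insert_of_mem (Finset.mem_map_of_mem _ ?_)
    simpa using h

theorem Iio_pen : Finset.Iio (pen m) = inner m := by
  ext i
  simp only [Finset.mem_Iio, inner, Finset.mem_map, Finset.mem_univ, true_and]
  constructor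
  · intro h
    exact ⟨⟨i, Fin.lt_def.1 h⟩, rfl⟩
  · rintro ⟨j, rfl⟩
    exact Fin.lt_def.2 j.2

theorem exists_x_pen_eq : ∃ r ∈ Deg N (others l) 1, x N (pen m) =
    ∑ l' ∈ Finset.univ.erase l, d N (pen m) (Fin.castLE (le_add_two m) l') + r := by
  refine ⟨algebraMap ℂ _ ((N - 1) / 2) + d N (pen m) (Fin.castLE (le_add_two m) l),
    Submodule.add_mem _ (algebraMap_mem_Deg _ _) (d_mem_Deg ?_), ?_⟩
  · rw [card_pair_inter_eq_zero (pen_notMem_others l) (castLE_notMem_others l)]; omega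
  · rw [x_eq, Iio_pen, inner, Finset.sum_map,
      ← Finset.add_sum_erase Finset.univ _ (Finset.mem_univ l)]
    simp only [Fin.castLEEmb_apply]
    abel

theorem inc_star_mem_Deg : inc (le_add_two m) N (star N l) ∈ Deg N (others l) 2 := by
  rw [inc_star]
  exact Submodule.sum_mem _ fun _ _ =>
    d_mem_Deg (Nat.lt_succ_of_le (card_pair_inter_le_one (castLE_notMem_others l)))

/-- The transposition carries `d N (pen m) l'` to `d N l l'`, so x becomes `star N l`. The constant
and the summand at `l` are left out, since they have degree 0 when the strand `l` is not counted. -/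
theorem t_mul_x_pow_sub_mem (j : ℕ) :
    t N (pen m) (Fin.castLE (le_add_two m) l) * x N (pen m) ^ j -
      inc (le_add_two m) N (star N l) ^ j * t N (pen m) (Fin.castLE (le_add_two m) l) ∈
        Deg N (others l) j := by
  obtain ⟨r, hr, hx⟩ := exists_x_pen_eq (N := N) l
  have hne := (castLE_ne_pen m l).symm
  have ht : t N (pen m) (Fin.castLE (le_add_two m) l) ∈ Deg N (others l) 1 :=
    t_mem_Deg (by
      rw [card_pair_inter_eq_zero (pen_notMem_others l) (castLE_notMem_others l)]; omega)
  have h1 : t N (pen m) (Fin.castLE (le_add_two m) l) *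
      ∑ l' ∈ Finset.univ.erase l, d N (pen m) (Fin.castLE (le_add_two m) l') =
      inc (le_add_two m) N (star N l) * t N (pen m) (Fin.castLE (le_add_two m) l) := by
    rw [inc_star, Finset.mul_sum, Finset.sum_mul]
    refine Finset.sum_congr rfl fun l' hl' => ?_
    rw [t_mul_d _ _ (castLE_ne_pen m l').symm, Equiv.swap_apply_left,
      Equiv.swap_apply_of_ne_of_ne (castLE_ne_pen m l')]
    simpa using Finset.ne_of_mem_erase hl'
  induction j with
  | zero => simp
  | succ j ih =>
    have h2 := Deg_mul (k := j + 1) (Deg_mul (k := 1) ht hr (by omega))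
      (pow_mem_Deg (x_mem_Deg (N := N) (pen_notMem_others l)) j) (by omega)
    have h3 := Deg_mul (k := j + 1) (inc_star_mem_Deg (N := N) l) ih (by omega)
    convert Submodule.add_mem _ h2 h3 using 1
    rw [pow_succ', pow_succ', ← mul_assoc]
    nth_rewrite 1 [hx]
    rw [mul_add, h1]
    noncomm_ring

/-- As for the transposition, but the horizontal edges exchange `pen m` and `l` with a sign, by
`c_mul_d_add_d`. -/
theorem c_mul_x_pow_sub_mem (j : ℕ) :
    c N (pen m) (Fin.castLE (le_add_two m) l) * x N (pen m) ^ j -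
      (-1) ^ j * (c N (pen m) (Fin.castLE (le_add_two m) l) *
        inc (le_add_two m) N (star N l) ^ j) ∈ Deg N (others l) j := by
  obtain ⟨r, hr, hx⟩ := exists_x_pen_eq (N := N) l
  have hne := (castLE_ne_pen m l).symm
  have hc : c N (pen m) (Fin.castLE (le_add_two m) l) ∈ Deg N (others l) 1 :=
    c_mem_Deg (by
      rw [card_pair_inter_eq_zero (pen_notMem_others l) (castLE_notMem_others l)]; omega)
  have h1 : c N (pen m) (Fin.castLE (le_add_two m) l) *
      ∑ l' ∈ Finset.univ.erase l, d N (pen m) (Fin.castLE (le_add_two m) l') =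
      -(c N (pen m) (Fin.castLE (le_add_two m) l) * inc (le_add_two m) N (star N l)) := by
    rw [inc_star, Finset.mul_sum, Finset.mul_sum, eq_neg_iff_add_eq_zero, ← Finset.sum_add_distrib]
    refine Finset.sum_eq_zero fun l' hl' => ?_
    have hll : Fin.castLE (le_add_two m) l ≠ Fin.castLE (le_add_two m) l' := by
      simpa using (Finset.ne_of_mem_erase hl').symm
    have := c_mul_d_add_d (N := N) hne (castLE_ne_pen m l').symm hll
    rwa [d_comm _ (pen m), d_comm _ (Fin.castLE (le_add_two m) l), mul_add] at this
  have hcomm : Commute (x N (pen m)) (inc (le_add_two m) N (star N l)) :=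
    commute_inc_x _ (Nat.le_refl m) _
  induction j with
  | zero => simp
  | succ j ih =>
    have h2 := Deg_mul (k := j + 1) (Deg_mul (k := 1) hc hr (by omega))
      (pow_mem_Deg (x_mem_Deg (N := N) (pen_notMem_others l)) j) (by omega)
    have h3 := Deg_mul (k := j + 1) ih (inc_star_mem_Deg (N := N) l) (by omega)
    convert Submodule.sub_mem _ h2 h3 using 1
    rw [pow_succ' (x N _), ← mul_assoc]
    nth_rewrite 1 [hx]
    rw [mul_add, h1, add_mul, neg_mul, mul_assoc _ (inc _ _ _), ← (hcomm.pow_left j).eq,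
      pow_succ (inc _ _ _), pow_succ' (-1 : BrauerAlgebra (m + 2) N)]
    noncomm_ring

end Strand

/-- The transposition and the horizontal pair contribute `star N l ^ j` with the coefficients 1 and
`-(-1) ^ j`. They add up to 2 for odd `j`. -/
theorem c_mul_d_mul_x_pow_mul_c_sub_mem (l : Fin m) {j : ℕ} (hj : Odd j) :
    c N (pen m) (ult m) * (d N (pen m) (Fin.castLE (le_add_two m) l) * x N (pen m) ^ j) *
      c N (pen m) (ult m) -
        inc (le_add_two m) N (2 * star N l ^ j) * c N (pen m) (ult m) ∈ Deg N (inner m) (j + 1) := by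
  have hcX : Commute (c N (pen m) (ult m)) (inc (le_add_two m) N (star N l ^ j)) :=
    commute_inc_c (le_add_two m) (pen_ne_ult m) (Nat.le_refl m) (Nat.le_succ m) _
  have he : c N (pen m) (ult m) ∈ Deg N (others l) 1 :=
    Deg_mono (others_subset l) le_rfl (c_mem_Deg_inner m)
  have h1 := Deg_mul (k := j) (Deg_mul (k := j) he
    (Submodule.sub_mem _ (t_mul_x_pow_sub_mem (N := N) l j) (c_mul_x_pow_sub_mem (N := N) l j))
    (by omega)) he (by omega)
  -- The error was estimated without counting the strand `l`; counting it raises the degree by at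
  -- most one.
  refine Deg_insert (inner_subset_insert l) ?_
  convert h1 using 1
  have h2 := c_mul_t_mul_c (N := N) (pen_ne_ult m) (castLE_ne_pen m l).symm (castLE_ne_ult m l).symm
  have h3 := c_mul_c_mul_c' (N := N) (pen_ne_ult m) (castLE_ne_pen m l).symm
    (castLE_ne_ult m l).symm
  rw [hj.neg_one_pow, ← map_pow, map_mul, map_ofNat, d]
  set e := c N (pen m) (ult m)
  set X := inc (le_add_two m) N (star N l ^ j)
  set T := t N (pen m) (Fin.castLE (le_add_two m) l)
  set C := c N (pen m) (Fin.castLE (le_add_two m) l)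
  have h4 : e * (X * T) * e = X * e := by
    rw [← mul_assoc, hcX.eq, mul_assoc X, mul_assoc X, h2]
  have h5 : e * (C * X) * e = X * e := by
    rw [← mul_assoc, mul_assoc _ X, ← hcX.eq, ← mul_assoc, h3, hcX.eq]
  have h6 : 2 * X * e = e * (X * T) * e + e * (C * X) * e := by
    rw [h4, h5, mul_assoc, two_mul]
  rw [h6]
  noncomm_ring

theorem z_sub_mem {j : ℕ} (hj : Odd j) :
    z m N (j + 1) - ∑ l, 2 * star N l ^ j ∈ Deg N Finset.univ (j + 1) := by
  apply mem_Deg_of_inc_mul_c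
  rw [map_sub, sub_mul, ← c_mul_x_pow_mul_c, pow_succ']
  nth_rewrite 1 [x_eq]
  have h1 : ∀ l : Fin m, _ := fun l => c_mul_d_mul_x_pow_mul_c_sub_mem (N := N) l hj
  have h2 : c N (pen m) (ult m) * (algebraMap ℂ _ ((N - 1) / 2) * x N (pen m) ^ j) *
      c N (pen m) (ult m) ∈ Deg N (inner m) (j + 1) :=
    Deg_mul (Deg_mul (k := j + 1) (c_mem_Deg_inner m)
      (Deg_mul (k := j + 1) (algebraMap_mem_Deg _ _) (pow_mem_Deg (x_mem_Deg (pen_notMem m)) j)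
        (by omega))
      (by omega)) (c_mem_Deg_inner m) (by omega)
  have h3 := Submodule.add_mem _ h2 (Submodule.sum_mem _ fun l (_ : l ∈ Finset.univ) => h1 l)
  change _ ∈ Deg N (inner m) (j + 1)
  convert h3 using 1
  rw [Iio_pen, inner, Finset.sum_map, Finset.sum_sub_distrib, map_sum, add_mul, mul_add, add_mul,
    Finset.sum_mul, Finset.sum_mul, Finset.mul_sum, Finset.sum_mul]
  simp only [Fin.castLEEmb_apply]
  abel

/-! ### Coefficients at permutations -/

theorem conj_topPerm_ofPerm (σ τ : Equiv.Perm (Fin m)) :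
    conj (topPerm σ) (ofPerm τ) = ofPerm (σ * τ) := by
  rw [← ofPerm_mul, (ofPerm_comp σ (ofPerm τ)).2]

theorem t_mul_eq_lift (k l : Fin m) (f : BrauerAlgebra m N) :
    t N k l * f = lift (fun γ => b (conj (topPerm (Equiv.swap k l)) γ)) f := by
  induction f using span_induction with
  | hadd f g hf hg => rw [map_add, mul_add, hf, hg]
  | hsmul a f hf => rw [map_smul, mul_smul_comm, hf]
  | hb γ => rw [lift_b, t_mul_b]

theorem conj_swap_conj_swap (k l : Fin m) (γ : BrauerDiagram m) :
    conj (topPerm (Equiv.swap k l)) (conj (topPerm (Equiv.swap k l)) γ) = γ := by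
  ext1; funext v
  rcases v with i | i
  · simp only [conj_pair, topPerm_symm_inl, Equiv.symm_swap, Equiv.swap_apply_self]
    rcases γ.pair (Sum.inl i) with j | j <;> simp
  · simp only [conj_pair, topPerm_symm_inr]
    rcases γ.pair (Sum.inr i) with j | j <;> simp

theorem coeff_t_mul (k l : Fin m) (γ : BrauerDiagram m) (f : BrauerAlgebra m N) :
    coeff (conj (topPerm (Equiv.swap k l)) γ) (t N k l * f) = coeff γ f := by
  rw [t_mul_eq_lift]
  exact coeff_lift_b (Function.LeftInverse.injective (conj_swap_conj_swap k l)) γ f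

theorem coeff_ofPerm_t_mul (k l : Fin m) (σ : Equiv.Perm (Fin m)) (f : BrauerAlgebra m N) :
    coeff (ofPerm σ) (t N k l * f) = coeff (ofPerm (Equiv.swap k l * σ)) f := by
  rw [← coeff_t_mul k l (ofPerm (Equiv.swap k l * σ)), conj_topPerm_ofPerm, Equiv.swap_mul_self_mul]

theorem coeff_ofPerm_c_mul {k l : Fin m} (h : k ≠ l) (σ : Equiv.Perm (Fin m))
    (f : BrauerAlgebra m N) : coeff (ofPerm σ) (c N k l * f) = 0 := by
  classical
  induction f using span_induction with
  | hadd f g hf hg => rw [mul_add, map_add, hf, hg, add_zero]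
  | hsmul a f hf => rw [mul_smul_comm, map_smul, hf, smul_zero]
  | hb γ =>
    have hne : join _ _ (inl_ne_inl h) γ ≠ ofPerm σ := by
      intro h'
      have := congrArg (fun δ : BrauerDiagram m => δ.pair (Sum.inl k)) h'
      simp [join_pair] at this
    rw [c_mul_b h, map_smul, coeff_b, if_neg hne, smul_zero]

/-- Products with horizontal edges on the left have a top edge and are never permutations, so only
the transpositions with `l` matter. -/
theorem coeff_ofPerm_star_mul (l : Fin m) (σ : Equiv.Perm (Fin m)) (f : BrauerAlgebra m N) :
    coeff (ofPerm σ) (star N l * f) =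
      ∑ l' ∈ Finset.univ.erase l, coeff (ofPerm (Equiv.swap l l' * σ)) f := by
  rw [star, Finset.sum_mul, map_sum]
  refine Finset.sum_congr rfl fun l' hl' => ?_
  rw [d, sub_mul, map_sub, coeff_ofPerm_t_mul, coeff_ofPerm_c_mul (Finset.ne_of_mem_erase hl').symm,
    sub_zero]

theorem cnt_ofPerm (σ : Equiv.Perm (Fin m)) : cnt Finset.univ (ofPerm σ) = σ.support.card := by
  rw [cnt, ← Equiv.Perm.support_inv]
  congr 1
  ext i
  rw [Finset.mem_filter, Equiv.Perm.mem_support, ofPerm_pair_inl]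
  simp [← Equiv.Perm.inv_def]

end BrauerAlgebra

/-- The product of the transpositions of a point with the points of a list is a cycle. -/
theorem List.prod_map_swap {α : Type*} [DecidableEq α] {l : α} {L : List α} (h : (l :: L).Nodup) :
    (L.map (Equiv.swap l)).prod = (l :: L.reverse).formPerm := by
  induction L with
  | nil => simp
  | cons a L ih =>
    have h1 : (l :: L).Nodup := by
      rw [List.nodup_cons, List.nodup_cons] at h
      rw [List.nodup_cons]
      exact ⟨fun h' => h.1 (List.mem_cons_of_mem a h'), h.2.2⟩
    have h2 : (a :: l :: L.reverse).Nodup := by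
      simp only [List.nodup_cons, List.mem_cons, not_or, List.mem_reverse, List.nodup_reverse] at h ⊢
      exact ⟨⟨fun h' => h.1.1 h'.symm, h.2.1⟩, h.1.2, h.2.2⟩
    rw [List.map_cons, List.prod_cons, ih h1, List.reverse_cons, Equiv.swap_comm,
      ← List.formPerm_cons_cons, ← List.formPerm_rotate_one _ h2]
    rfl

theorem List.prod_map_swap_apply_ne {α : Type*} [DecidableEq α] {l x : α} {L : List α}
    (h : (L.map (Equiv.swap l)).prod x ≠ x) : x ∈ l :: L := by
  induction L generalizing x with
  | nil => simp at h
  | cons a L ih =>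
    by_contra hx
    simp only [List.mem_cons, not_or] at hx ih
    rw [List.map_cons, List.prod_cons, Equiv.Perm.mul_apply] at h
    have : (L.map (Equiv.swap l)).prod x = x := by
      by_contra h'
      rcases ih h' with h' | h'
      · exact hx.1 h'
      · exact hx.2.2 h'
    rw [this, Equiv.swap_apply_of_ne_of_ne hx.1 hx.2.1] at h
    exact h rfl

theorem List.support_prod_map_swap_subset {α : Type*} [DecidableEq α] [Fintype α] (l : α)
    (L : List α) : (L.map (Equiv.swap l)).prod.support ⊆ (l :: L).toFinset := by
  intro x hx
  rw [Equiv.Perm.mem_support] at hx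
  rw [List.mem_toFinset]
  exact List.prod_map_swap_apply_ne hx

theorem List.support_prod_map_swap {α : Type*} [DecidableEq α] [Fintype α] {l : α} {L : List α}
    (h : (l :: L).Nodup) (hL : L ≠ []) :
    (L.map (Equiv.swap l)).prod.support = (l :: L).toFinset := by
  rw [List.prod_map_swap h, List.support_formPerm_of_nodup]
  · ext; simp
  · simpa using h
  · intro x hx; simp at hx; exact hL hx.2

theorem List.cycleType_prod_map_swap {α : Type*} [DecidableEq α] [Fintype α] {l : α} {L : List α}
    (h : (l :: L).Nodup) (hL : L ≠ []) :
    (L.map (Equiv.swap l)).prod.cycleType = {L.length + 1} := by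
  have h1 : (L.map (Equiv.swap l)).prod.IsCycle := by
    rw [List.prod_map_swap h]
    apply List.isCycle_formPerm
    · simpa using h
    · have := List.length_pos_of_ne_nil hL
      simp; omega
  rw [h1.cycleType, List.support_prod_map_swap h hL, List.toFinset_card_of_nodup h,
    List.length_cons]

/-! ### Products of z's detect their indices as cycle types. -/

namespace BrauerAlgebra

open BrauerDiagram

variable {m : ℕ} {N : ℂ}

open scoped ComplexOrder

theorem card_support_erase_le (l l' : Fin m) (σ : Equiv.Perm (Fin m)) :
    (σ.support.erase l).card ≤ ((Equiv.swap l l' * σ).support.erase l).card + 1 := by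
  refine (Finset.card_le_card ?_).trans (Finset.card_insert_le l' _)
  intro i hi
  simp only [Finset.mem_erase, Equiv.Perm.mem_support, Finset.mem_insert] at hi ⊢
  by_cases h : i = l'
  · exact Or.inl h
  · refine Or.inr ⟨hi.1, fun h' => hi.2 ?_⟩
    rwa [Equiv.Perm.mul_apply, Equiv.swap_apply_eq_iff, Equiv.swap_apply_of_ne_of_ne hi.1 h] at h'

/-- A transposition with `l` removes at most one point other than `l` from the support. After `j` of
them the support still has at least `e` points, where nonnegativity of the coefficients of `f` is
known. -/
theorem coeff_star_pow_nonneg {f : BrauerAlgebra m N} {e : ℕ}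
    (hf : ∀ σ : Equiv.Perm (Fin m), e ≤ σ.support.card → 0 ≤ coeff (ofPerm σ) f) (l : Fin m) (j : ℕ)
    (σ : Equiv.Perm (Fin m)) (hσ : e + j ≤ (σ.support.erase l).card) :
    0 ≤ coeff (ofPerm σ) (star N l ^ j * f) := by
  induction j generalizing σ with
  | zero =>
    rw [pow_zero, one_mul]
    exact hf σ (hσ.trans (Finset.card_le_card (Finset.erase_subset _ _)))
  | succ j ih =>
    rw [pow_succ', mul_assoc, coeff_ofPerm_star_mul]
    refine Finset.sum_nonneg fun l' _ => ih _ ?_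
    have := card_support_erase_le l l' σ
    omega

theorem exists_of_coeff_star_pow {f : BrauerAlgebra m N} (l : Fin m) (j : ℕ)
    (σ : Equiv.Perm (Fin m)) (h : coeff (ofPerm σ) (star N l ^ j * f) ≠ 0) :
    ∃ (L : List (Fin m)) (τ : Equiv.Perm (Fin m)), L.length = j ∧ coeff (ofPerm τ) f ≠ 0 ∧
      σ = (L.map (Equiv.swap l)).prod * τ := by
  induction j generalizing σ with
  | zero => exact ⟨[], σ, rfl, by simpa using h, by simp⟩
  | succ j ih =>
    rw [pow_succ', mul_assoc, coeff_ofPerm_star_mul] at h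
    obtain ⟨l', -, h'⟩ := Finset.exists_ne_zero_of_sum_ne_zero h
    obtain ⟨L, τ, h1, h2, h3⟩ := ih _ h'
    refine ⟨l' :: L, τ, by rw [List.length_cons, h1], h2, ?_⟩
    rw [List.map_cons, List.prod_cons, mul_assoc, ← h3, Equiv.swap_mul_self_mul]

/-- The permutation σ is a product of `j` transpositions with `l` and a τ moving at most `e` points.
Those transpositions move at most `j + 1` points. The size of the support of σ leaves no room for
coincidences, so a genuine (j+1)-cycle and τ are disjoint. -/
theorem cycleType_of_coeff_star_pow {f : BrauerAlgebra m N} {e : ℕ}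
    (hf : f ∈ Deg N Finset.univ (e + 1)) (l : Fin m) {j : ℕ} (hj : 0 < j)
    (σ : Equiv.Perm (Fin m)) (hσ : e + j + 1 ≤ σ.support.card)
    (h : coeff (ofPerm σ) (star N l ^ j * f) ≠ 0) : ∃ τ : Equiv.Perm (Fin m),
      coeff (ofPerm τ) f ≠ 0 ∧ e ≤ τ.support.card ∧ σ.cycleType = (j + 1) ::ₘ τ.cycleType := by
  obtain ⟨L, τ, h1, h2, h3⟩ := exists_of_coeff_star_pow l j σ h
  have hτ : τ.support.card ≤ e := by
    by_contra h'
    exact h2 (coeff_eq_zero_of_Deg hf (by rw [cnt_ofPerm]; omega))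
  have hsub : σ.support ⊆ (l :: L).toFinset ∪ τ.support := by
    rw [h3]
    exact (Equiv.Perm.support_mul_le _ _).trans
      (Finset.union_subset_union_left (List.support_prod_map_swap_subset l L))
  have hc1 := Finset.card_le_card hsub
  have hc2 := Finset.card_union_le (l :: L).toFinset τ.support
  have hc3 := List.toFinset_card_le (l :: L)
  rw [List.length_cons, h1] at hc3
  have hnd : (l :: L).Nodup := by
    rw [← Multiset.coe_nodup, ← Multiset.toFinset_card_eq_card_iff_nodup]
    change (l :: L).toFinset.card = (l :: L).length
    rw [List.length_cons, h1]; omega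
  have hdis : Disjoint (l :: L).toFinset τ.support := by
    rw [← Finset.card_union_eq_card_add_card]; omega
  have hL : L ≠ [] := by rintro rfl; simp at h1; omega
  refine ⟨τ, h2, by omega, ?_⟩
  rw [h3, Equiv.Perm.Disjoint.cycleType_mul, List.cycleType_prod_map_swap hnd hL, h1]
  · rfl
  · rw [Equiv.Perm.disjoint_iff_disjoint_support, List.support_prod_map_swap hnd hL]
    exact hdis

/-- The coefficient at the enlarged permutation is a sum of nonnegative terms at each stage, so it
is at least the single term that removes the first point of the list. -/
theorem le_coeff_star_pow {f : BrauerAlgebra m N} {e : ℕ}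
    (hf : ∀ σ : Equiv.Perm (Fin m), e ≤ σ.support.card → 0 ≤ coeff (ofPerm σ) f) {l : Fin m}
    {L : List (Fin m)} (hL : (l :: L).Nodup) {τ : Equiv.Perm (Fin m)} (hτ : e ≤ τ.support.card)
    (hd : Disjoint (l :: L).toFinset τ.support) :
    coeff (ofPerm τ) f ≤
      coeff (ofPerm ((L.map (Equiv.swap l)).prod * τ)) (star N l ^ L.length * f) := by
  induction L with
  | nil => simp
  | cons a L ih =>
    have h1 : (l :: L).Nodup := by
      rw [List.nodup_cons, List.nodup_cons] at hL
      rw [List.nodup_cons]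
      exact ⟨fun h' => hL.1 (List.mem_cons_of_mem a h'), hL.2.2⟩
    have hal : a ≠ l := by
      rintro rfl
      simp at hL
    refine (ih h1 (hd.mono_left ?_)).trans ?_
    · intro i hi
      simp only [List.toFinset_cons, Finset.mem_insert] at hi ⊢
      tauto
    · rw [List.length_cons, pow_succ', mul_assoc, coeff_ofPerm_star_mul]
      have hdd : Equiv.Perm.Disjoint ((a :: L).map (Equiv.swap l)).prod τ := by
        rw [Equiv.Perm.disjoint_iff_disjoint_support,
          List.support_prod_map_swap hL (by simp)]
        exact hd
      have hs : e + (L.length + 1) ≤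
          ((((a :: L).map (Equiv.swap l)).prod * τ).support.erase l).card := by
        rw [Finset.card_erase_of_mem, hdd.card_support_mul,
          List.support_prod_map_swap hL (by simp), List.toFinset_card_of_nodup hL]
        · simp only [List.length_cons]; omega
        · rw [hdd.support_mul, List.support_prod_map_swap hL (by simp)]
          simp
      have hn : ∀ l' ∈ Finset.univ.erase l, 0 ≤ coeff (ofPerm (Equiv.swap l l' *
          (((a :: L).map (Equiv.swap l)).prod * τ))) (star N l ^ L.length * f) := by
        intro l' _
        refine coeff_star_pow_nonneg hf l _ _ ?_
        have := card_support_erase_le l l' (((a :: L).map (Equiv.swap l)).prod * τ)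
        omega
      have := Finset.single_le_sum hn (Finset.mem_erase.2 ⟨hal, Finset.mem_univ a⟩)
      rwa [List.map_cons, List.prod_cons, mul_assoc, Equiv.swap_mul_self_mul] at this

/-! ### Products of the elements `z i` -/

instance : LeftCommutative (fun (i : ℕ) (a : BrauerAlgebra m N) => z m N i * a) :=
  ⟨fun i j a => by rw [← mul_assoc, (z_commute m i _).eq, mul_assoc]⟩

/-- A monomial in the `z i`. -/
noncomputable def zprod (m : ℕ) (N : ℂ) (h : Multiset ℕ) : BrauerAlgebra m N :=
  h.foldr (fun i u => z m N i * u) 1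

@[simp] theorem zprod_zero : zprod m N 0 = 1 := rfl

@[simp] theorem zprod_cons (i : ℕ) (h : Multiset ℕ) :
    zprod m N (i ::ₘ h) = z m N i * zprod m N h := Multiset.foldr_cons _ _ _ _

theorem zprod_mem_Deg (h : Multiset ℕ) : zprod m N h ∈ Deg N Finset.univ (h.sum + 1) := by
  induction h using Multiset.induction with
  | empty => exact one_mem_Deg _
  | cons i h ih =>
    rw [zprod_cons, Multiset.sum_cons]
    exact Deg_mul (z_mem_Deg m i) ih (by omega)

theorem coeff_z_mul {f : BrauerAlgebra m N} {e j : ℕ} (hf : f ∈ Deg N Finset.univ (e + 1))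
    (hj : Odd j) {σ : Equiv.Perm (Fin m)} (hσ : e + j + 1 ≤ σ.support.card) :
    coeff (ofPerm σ) (z m N (j + 1) * f) =
      ∑ l, 2 * coeff (ofPerm σ) (star N l ^ j * f) := by
  have h1 := Deg_mul (k := e + j + 1) (z_sub_mem (N := N) hj) hf (by omega)
  have h2 := coeff_eq_zero_of_Deg h1 (γ := ofPerm σ) (by rwa [cnt_ofPerm])
  rw [sub_mul, map_sub, sub_eq_zero] at h2
  rw [h2, Finset.sum_mul, map_sum]
  refine Finset.sum_congr rfl fun l _ => ?_
  rw [mul_assoc, two_mul, map_add, two_mul]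

theorem star_pow_nonneg_aux {f : BrauerAlgebra m N} {e j : ℕ}
    (hn : ∀ σ : Equiv.Perm (Fin m), e ≤ σ.support.card → 0 ≤ coeff (ofPerm σ) f)
    {σ : Equiv.Perm (Fin m)} (hσ : e + j + 1 ≤ σ.support.card) (l : Fin m) :
    0 ≤ 2 * coeff (ofPerm σ) (star N l ^ j * f) := by
  refine mul_nonneg zero_le_two (coeff_star_pow_nonneg hn l j σ ?_)
  have := Finset.pred_card_le_card_erase (s := σ.support) (a := l)
  omega

theorem exists_odd_of_even {i : ℕ} (hi : Even i ∧ 0 < i) : ∃ j, Odd j ∧ i = j + 1 := by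
  obtain ⟨⟨k, rfl⟩, hk⟩ := hi
  exact ⟨k + k - 1, ⟨k - 1, by omega⟩, by omega⟩

theorem coeff_zprod_nonneg {h : Multiset ℕ} (hh : ∀ i ∈ h, Even i ∧ 0 < i)
    (σ : Equiv.Perm (Fin m)) (hσ : h.sum ≤ σ.support.card) :
    0 ≤ coeff (ofPerm σ) (zprod m N h) := by
  classical
  induction h using Multiset.induction generalizing σ with
  | empty =>
    rw [zprod_zero, one_def, coeff_b]
    split_ifs
    · exact zero_le_one
    · exact le_rfl
  | cons i h ih =>
    obtain ⟨j, hj, rfl⟩ := exists_odd_of_even (hh i (Multiset.mem_cons_self i h))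
    rw [Multiset.sum_cons] at hσ
    have hσ' : h.sum + j + 1 ≤ σ.support.card := by omega
    rw [zprod_cons, coeff_z_mul (zprod_mem_Deg h) hj hσ']
    exact Finset.sum_nonneg fun l _ => star_pow_nonneg_aux
      (ih fun i hi => hh i (Multiset.mem_cons_of_mem hi)) hσ' l

theorem cycleType_of_coeff_zprod {h : Multiset ℕ} (hh : ∀ i ∈ h, Even i ∧ 0 < i)
    (σ : Equiv.Perm (Fin m)) (hσ : h.sum ≤ σ.support.card)
    (hne : coeff (ofPerm σ) (zprod m N h) ≠ 0) : σ.cycleType = h := by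
  classical
  induction h using Multiset.induction generalizing σ with
  | empty =>
    rw [zprod_zero, one_def, coeff_b] at hne
    have h1 : BrauerDiagram.one m = ofPerm σ := by
      by_contra h'
      rw [if_neg h'] at hne
      exact hne rfl
    have : σ = 1 := by
      ext1 i
      have h2 := congrArg (fun δ : BrauerDiagram m => δ.pair (Sum.inr i)) h1
      simp [BrauerDiagram.one] at h2
      exact h2.symm
    rw [this, Equiv.Perm.cycleType_one]
  | cons i h ih =>
    obtain ⟨j, hj, rfl⟩ := exists_odd_of_even (hh i (Multiset.mem_cons_self i h))
    rw [Multiset.sum_cons] at hσ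
    have hσ' : h.sum + j + 1 ≤ σ.support.card := by omega
    rw [zprod_cons, coeff_z_mul (zprod_mem_Deg h) hj hσ'] at hne
    obtain ⟨l, -, hl⟩ := Finset.exists_ne_zero_of_sum_ne_zero hne
    obtain ⟨τ, h1, h2, h3⟩ := cycleType_of_coeff_star_pow (zprod_mem_Deg h) l hj.pos σ hσ'
      (right_ne_zero_of_mul hl)
    rw [h3, ih (fun i hi => hh i (Multiset.mem_cons_of_mem hi)) τ h2 h1]

theorem exists_coeff_zprod_pos {h : Multiset ℕ} (hh : ∀ i ∈ h, Even i ∧ 0 < i)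
    (hm : h.sum ≤ m) : ∃ σ : Equiv.Perm (Fin m), σ.support.card = h.sum ∧
      0 < coeff (ofPerm σ) (zprod m N h) := by
  classical
  induction h using Multiset.induction with
  | empty =>
    refine ⟨1, by simp, ?_⟩
    have : ofPerm (1 : Equiv.Perm (Fin m)) = BrauerDiagram.one m := by
      ext1; funext v
      rcases v with i | i <;> simp [BrauerDiagram.one, ← Equiv.Perm.inv_def]
    rw [zprod_zero, one_def, coeff_b, this, if_pos rfl]
    exact zero_lt_one
  | cons i h ih =>
    have hh' : ∀ i ∈ h, Even i ∧ 0 < i := fun i hi => hh i (Multiset.mem_cons_of_mem hi)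
    obtain ⟨j, hj, rfl⟩ := exists_odd_of_even (hh i (Multiset.mem_cons_self i h))
    rw [Multiset.sum_cons] at hm
    obtain ⟨τ, h1, h2⟩ := ih hh' (by omega)
    -- The bound `h.sum ≤ m` leaves `j + 1` fixed points of τ for a new cycle.
    obtain ⟨T, hT, hT'⟩ := Finset.exists_subset_card_eq (s := (τ.support)ᶜ) (n := j + 1) (by
      rw [Finset.card_compl, Fintype.card_fin]; omega)
    obtain ⟨l, L, hL⟩ : ∃ l L, T.toList = l :: L := by
      rcases hl : T.toList with _ | ⟨l, L⟩
      · have := T.length_toList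
        rw [hl, hT'] at this
        simp at this
      · exact ⟨l, L, rfl⟩
    have hnd : (l :: L).Nodup := hL ▸ T.nodup_toList
    have hlen : L.length = j := by
      have := T.length_toList
      rw [hL, hT', List.length_cons] at this
      omega
    have hdis : Disjoint (l :: L).toFinset τ.support := by
      rw [← hL, Finset.toList_toFinset]
      exact Finset.disjoint_of_subset_left hT disjoint_compl_left
    have hne : L ≠ [] := by rintro rfl; simp at hlen; have := hj.pos; omega
    have hdd : Equiv.Perm.Disjoint (L.map (Equiv.swap l)).prod τ := by
      rw [Equiv.Perm.disjoint_iff_disjoint_support, List.support_prod_map_swap hnd hne]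
      exact hdis
    have hcard : ((L.map (Equiv.swap l)).prod * τ).support.card = h.sum + j + 1 := by
      rw [hdd.card_support_mul, List.support_prod_map_swap hnd hne,
        List.toFinset_card_of_nodup hnd, List.length_cons, h1]
      omega
    refine ⟨(L.map (Equiv.swap l)).prod * τ, by rw [hcard, Multiset.sum_cons]; omega, ?_⟩
    rw [zprod_cons, coeff_z_mul (zprod_mem_Deg h) hj hcard.ge]
    have hnn := coeff_zprod_nonneg (m := m) (N := N) hh'
    have h3 := le_coeff_star_pow hnn hnd h1.ge hdis
    rw [hlen] at h3
    refine lt_of_lt_of_le ?_ (Finset.single_le_sum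
      (fun l _ => star_pow_nonneg_aux hnn hcard.ge l) (Finset.mem_univ l))
    exact mul_pos zero_lt_two (h2.trans_le h3)

end BrauerAlgebra

/-! ### Diagrams on disjoint strands, and the type of a diagram on `m + n` strands. -/

namespace BrauerDiagram

variable {n : ℕ}

/-! ### Diagrams on complementary strands -/

section Tensor

variable {p p' q : ℕ} (f : Fin p ↪ Fin q) (f' : Fin p' ↪ Fin q) (hf : ∀ i j, f i ≠ f' j)

/-- The diagram with two parts on complementary strands. -/
noncomputable def tensor (γ : BrauerDiagram p) (γ' : BrauerDiagram p') : BrauerDiagram q :=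
  comp (embed f γ) (embed f' γ')

include hf

theorem embed_pair_left (γ' : BrauerDiagram p') (i : Fin p) :
    (embed f' γ').pair (Sum.inl (f i)) = Sum.inr (f i) := by
  refine embed_pair_off f' γ' ?_
  rintro (j | j)
  · simpa using (hf i j).symm
  · simp

theorem embed_pair_right (γ : BrauerDiagram p) (i : Fin p') :
    (embed f γ).pair (Sum.inr (f' i)) = Sum.inl (f' i) := by
  refine embed_pair_off f γ ?_
  rintro (j | j)
  · simp
  · simpa using hf j i

/-- On the strands of `f` the second factor is vertical and only prolongs the edges of the first. -/
theorem tensor_pair_left (γ : BrauerDiagram p) (γ' : BrauerDiagram p') (u : Fin p ⊕ Fin p) :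
    (tensor f f' γ γ').pair (Sum.map f f u) = Sum.map f f (γ.pair u) := by
  set G := glued (embed f γ) (embed f' γ')
  have h1 : ∀ u : Fin p ⊕ Fin p, G (upper (Sum.map f f u)) (outer (Sum.map f f u)) := by
    rintro (i | i)
    · exact G.refl' _
    · have := Relation.EqvGen.rel _ _
        (GlueEdge.low (γ := embed f γ) (γ' := embed f' γ') (Sum.inl (f i)))
      rw [embed_pair_left f f' hf] at this
      exact this
  have h2 : G (upper (Sum.map f f u)) (upper (Sum.map f f (γ.pair u))) := by
    have := Relation.EqvGen.rel _ _
      (GlueEdge.up (γ := embed f γ) (γ' := embed f' γ') (Sum.map f f u))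
    rwa [embed_pair_map] at this
  exact comp_pair_eq _ _ (fun h => γ.pair_ne u (map_map_injective f h))
    (G.trans' (G.symm' (h1 u)) (G.trans' h2 (h1 _)))

theorem tensor_pair_right (γ : BrauerDiagram p) (γ' : BrauerDiagram p') (u : Fin p' ⊕ Fin p') :
    (tensor f f' γ γ').pair (Sum.map f' f' u) = Sum.map f' f' (γ'.pair u) := by
  set G := glued (embed f γ) (embed f' γ')
  have h1 : ∀ u : Fin p' ⊕ Fin p', G (lower (Sum.map f' f' u)) (outer (Sum.map f' f' u)) := by
    rintro (i | i)
    · have := Relation.EqvGen.rel _ _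
        (GlueEdge.up (γ := embed f γ) (γ' := embed f' γ') (Sum.inr (f' i)))
      rw [embed_pair_right f f' hf] at this
      exact this
    · exact G.refl' _
  have h2 : G (lower (Sum.map f' f' u)) (lower (Sum.map f' f' (γ'.pair u))) := by
    have := Relation.EqvGen.rel _ _
      (GlueEdge.low (γ := embed f γ) (γ' := embed f' γ') (Sum.map f' f' u))
    rwa [embed_pair_map] at this
  exact comp_pair_eq _ _ (fun h => γ'.pair_ne u (map_map_injective f' h))
    (G.trans' (G.symm' (h1 u)) (G.trans' h2 (h1 _)))

theorem loops_embed_embed (γ : BrauerDiagram p) (γ' : BrauerDiagram p') :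
    loops (embed f γ) (embed f' γ') = 0 := by
  have : IsEmpty (Loop (embed f γ) (embed f' γ')) := by
    refine ⟨fun ⟨c, hc⟩ => ?_⟩
    induction c using Quotient.ind with
    | _ v =>
      rcases v with i | i | i
      · exact hc (Sum.inl i) rfl
      · by_cases hi : ∃ j, f j = i
        · obtain ⟨j, rfl⟩ := hi
          have := Relation.EqvGen.rel _ _
            (GlueEdge.low (γ := embed f γ) (γ' := embed f' γ') (Sum.inl (f j)))
          rw [embed_pair_left f f' hf] at this
          exact hc (Sum.inr (f j)) (Quotient.sound ((glued _ _).symm' this))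
        · have h1 : (embed f γ).pair (Sum.inl i) = Sum.inr i := by
            refine embed_pair_off f γ ?_
            rintro (j | j)
            · intro h
              exact hi ⟨j, by simpa using h⟩
            · simp
          have := Relation.EqvGen.rel _ _
            (GlueEdge.up (γ := embed f γ) (γ' := embed f' γ') (Sum.inl i))
          rw [h1] at this
          exact hc (Sum.inl i) (Quotient.sound this)
      · exact hc (Sum.inr i) rfl
  exact Nat.card_of_isEmpty

theorem tensor_injective (γ' : BrauerDiagram p') :
    Function.Injective fun γ => tensor f f' γ γ' := by
  intro γ₁ γ₂ h
  ext1; funext u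
  apply map_map_injective f
  rw [← tensor_pair_left f f' hf γ₁ γ', ← tensor_pair_left f f' hf γ₂ γ']
  exact congrArg (fun δ : BrauerDiagram q => δ.pair (Sum.map f f u)) h

theorem cnt_tensor (γ : BrauerDiagram p) (γ' : BrauerDiagram p') :
    cnt (Finset.univ.map f) (tensor f f' γ γ') = cnt Finset.univ γ := by
  rw [cnt, cnt, Finset.filter_map, Finset.card_map]
  congr 1
  ext i
  rw [Finset.mem_filter, Finset.mem_filter, Function.comp_apply]
  refine and_congr_right fun _ => not_congr ?_
  have := tensor_pair_left f f' hf γ γ' (Sum.inl i)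
  rw [Sum.map_inl] at this
  rw [this]
  rcases γ.pair (Sum.inl i) with j | j <;> simp

end Tensor

/-! ### Paths through the strands in `S` -/

/-- The strand of a vertex. -/
def idx (v : Fin n ⊕ Fin n) : Fin n := Sum.elim id id v

@[simp] theorem idx_inl (i : Fin n) : idx (Sum.inl i) = i := rfl

@[simp] theorem idx_inr (i : Fin n) : idx (Sum.inr i : Fin n ⊕ Fin n) = i := rfl

@[simp] theorem idx_swap (v : Fin n ⊕ Fin n) : idx v.swap = idx v := by
  rcases v with i | i <;> rfl

/-- The path from `a` along the edges of `δ`, where the two ends of every strand in `S` are joined,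
ends in `w` and passes through `j` strands in `S`. -/
inductive Path (S : Finset (Fin n)) (δ : BrauerDiagram n) :
    Fin n ⊕ Fin n → ℕ → Fin n ⊕ Fin n → Prop
  | final {a : Fin n ⊕ Fin n} (h : idx (δ.pair a) ∉ S) : Path S δ a 0 (δ.pair a)
  | step {a w : Fin n ⊕ Fin n} {j : ℕ} (h : idx (δ.pair a) ∈ S)
      (hp : Path S δ (δ.pair a).swap j w) : Path S δ a (j + 1) w

variable {S : Finset (Fin n)} {δ δ' : BrauerDiagram n}

theorem Path.unique {a w w' : Fin n ⊕ Fin n} {j j' : ℕ} (h : Path S δ a j w)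
    (h' : Path S δ a j' w') : j = j' ∧ w = w' := by
  induction h generalizing j' with
  | final h =>
    cases h' with
    | final _ => exact ⟨rfl, rfl⟩
    | step h' _ => exact absurd h' h
  | step h _ ih =>
    cases h' with
    | final h' => exact absurd h h'
    | step _ hp => exact ⟨congrArg (· + 1) (ih hp).1, (ih hp).2⟩

theorem Path.flip {a w : Fin n ⊕ Fin n} {j : ℕ} (h : Path S δ a j w) :
    Path S (flip δ) a.swap j w.swap := by
  induction h with
  | @final a h =>
    have h1 : (BrauerDiagram.flip δ).pair a.swap = (δ.pair a).swap := by
      rw [flip_pair, Sum.swap_swap]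
    rw [← h1]
    exact Path.final (by rwa [h1, idx_swap])
  | @step a w j h _ ih =>
    have h1 : (BrauerDiagram.flip δ).pair a.swap = (δ.pair a).swap := by
      rw [flip_pair, Sum.swap_swap]
    exact Path.step (by rwa [h1, idx_swap]) (by rwa [h1])

/-- The diagram `δ` arises from `δ'` by leading the edge at the top of the strand `k` through the
strand `l`. -/
structure Hook (k l : Fin n) (δ' δ : BrauerDiagram n) (q : Fin n ⊕ Fin n) : Prop where
  idx_eq : idx q = l
  vertical : δ'.pair (Sum.inl l) = Sum.inr l
  first : δ.pair (Sum.inl k) = q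
  second : δ.pair q.swap = δ'.pair (Sum.inl k)
  other : ∀ v, idx v ≠ l → v ≠ Sum.inl k → v ≠ δ'.pair (Sum.inl k) → δ.pair v = δ'.pair v

section Hook

variable {k l : Fin n} {q : Fin n ⊕ Fin n}

theorem idx_pair_ne (h : δ'.pair (Sum.inl l) = Sum.inr l) {a : Fin n ⊕ Fin n} (ha : idx a ≠ l) :
    idx (δ'.pair a) ≠ l := by
  intro h'
  apply ha
  rcases hv : δ'.pair a with i | i
  · rw [hv, idx_inl] at h'
    rw [h', pair_eq_iff, h] at hv
    rw [hv, idx_inr]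
  · rw [hv, idx_inr] at h'
    rw [h', ← h, δ'.pair_injective.eq_iff] at hv
    rw [hv, idx_inl]

theorem Hook.pair_eq (H : Hook k l δ' δ q) {a : Fin n ⊕ Fin n} (ha : idx a ≠ l)
    (hak : a ≠ Sum.inl k) (hw : δ'.pair a ≠ Sum.inl k) : δ.pair a = δ'.pair a :=
  H.other a ha hak fun h => hw (by rw [h, δ'.pair_pair])

variable (hk : k ∉ S) (hl : l ∈ S)

include hk

theorem ne_of_idx_mem {v : Fin n ⊕ Fin n} (h : idx v ∈ S) : v ≠ Sum.inl k := by
  rintro rfl; exact hk h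

/-- Since `k ∉ S`, a path meets the top of `k` only at its ends. If neither end is there, the path
avoids the changed edge; otherwise it gains the strand `l`, at its start (`Hook.path_start`) or at
its end (`Hook.path_end`). -/
theorem Hook.path (H : Hook k l δ' δ q) {a w : Fin n ⊕ Fin n} {j : ℕ}
    (h : Path S δ' a j w) (ha : idx a ≠ l) (hak : a ≠ Sum.inl k) (hw : w ≠ Sum.inl k) :
    Path S δ a j w := by
  induction h with
  | @final a h =>
    have h1 := H.pair_eq ha hak hw
    rw [← h1]
    exact Path.final (by rwa [h1])
  | @step a w j h _ ih =>
    have h1 := H.pair_eq ha hak (ne_of_idx_mem hk h)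
    refine Path.step (by rwa [h1]) ?_
    rw [h1]
    exact ih (by rw [idx_swap]; exact idx_pair_ne H.vertical ha)
      (ne_of_idx_mem hk (by rwa [idx_swap])) hw

include hl

theorem Hook.path_start (H : Hook k l δ' δ q) {w : Fin n ⊕ Fin n} {j : ℕ}
    (h : Path S δ' (Sum.inl k) j w) (hw : w ≠ Sum.inl k) : Path S δ (Sum.inl k) (j + 1) w := by
  have hkl : k ≠ l := by rintro rfl; exact hk hl
  refine Path.step (by rwa [H.first, H.idx_eq]) ?_
  rw [H.first]
  cases h with
  | final h => rw [← H.second]; exact Path.final (by rwa [H.second])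
  | step h hp =>
    refine Path.step (by rwa [H.second]) ?_
    rw [H.second]
    exact H.path hk hp (by rw [idx_swap]; exact idx_pair_ne H.vertical hkl)
      (ne_of_idx_mem hk (by rwa [idx_swap])) hw

theorem Hook.path_end (H : Hook k l δ' δ q) {a w : Fin n ⊕ Fin n} {j : ℕ}
    (h : Path S δ' a j w) (ha : idx a ≠ l) (hak : a ≠ Sum.inl k) (hw : w = Sum.inl k) :
    Path S δ a (j + 1) w := by
  induction h with
  | @final a h =>
    have h1 : δ.pair a = q.swap := by
      rw [pair_eq_iff, H.second, ← pair_eq_iff, hw]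
    have h2 : δ.pair q = Sum.inl k := by rw [pair_eq_iff, H.first]
    refine Path.step (by rwa [h1, idx_swap, H.idx_eq]) ?_
    rw [h1, Sum.swap_swap, hw, ← h2]
    exact Path.final (by rwa [h2])
  | @step a w j h _ ih =>
    have h1 := H.pair_eq ha hak (ne_of_idx_mem hk h)
    refine Path.step (by rwa [h1]) ?_
    rw [h1]
    exact ih (by rw [idx_swap]; exact idx_pair_ne H.vertical ha)
      (ne_of_idx_mem hk (by rwa [idx_swap])) hw

end Hook

theorem hook_transp {k l : Fin n} (hkl : k ≠ l) {δ : BrauerDiagram n}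
    (h : δ.pair (Sum.inl l) = Sum.inr l) :
    Hook k l δ (conj (topPerm (Equiv.swap k l)) δ) (Sum.inr l) := by
  have h0 : δ.pair (Sum.inr l) = Sum.inl l := by rw [pair_eq_iff, h]
  refine ⟨rfl, h, ?_, ?_, ?_⟩
  · simp [h]
  · have h1 := δ.pair_ne (Sum.inl k)
    rcases hu : δ.pair (Sum.inl k) with i | i
    · have h2 : i ≠ k := by rintro rfl; exact h1 hu
      have h3 : i ≠ l := by
        rintro rfl
        rw [pair_eq_iff, h] at hu
        simp at hu
      simp [hu, Equiv.swap_apply_of_ne_of_ne h2 h3]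
    · simp [hu]
  · intro v hv hvk hvu
    have h2 : δ.pair v ≠ Sum.inl k := fun h => hvu (by rw [← h, δ.pair_pair])
    have h3 := idx_pair_ne h hv
    have h4 : (topPerm (Equiv.swap k l)).symm v = v := by
      rcases v with i | i
      · have hik : i ≠ k := by rintro rfl; exact hvk rfl
        rw [topPerm_symm_inl, Equiv.symm_swap, Equiv.swap_apply_of_ne_of_ne hik hv]
      · rfl
    rw [conj_pair, h4]
    rcases hw : δ.pair v with i | i
    · have hik : i ≠ k := by rintro rfl; exact h2 hw
      rw [hw] at h3
      rw [topPerm_inl, Equiv.swap_apply_of_ne_of_ne hik h3]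
    · rfl

theorem hook_cupcap {k l : Fin n} (hkl : k ≠ l) {δ : BrauerDiagram n}
    (h : δ.pair (Sum.inl l) = Sum.inr l) :
    Hook k l δ (join _ _ (inl_ne_inl hkl) δ) (Sum.inl l) := by
  have h0 : δ.pair (Sum.inr l) = Sum.inl l := by rw [pair_eq_iff, h]
  refine ⟨rfl, h, ?_, ?_, ?_⟩
  · simp [join_pair]
  · have h1 : Sum.inr l ≠ δ.pair (Sum.inl k) := by
      intro h'
      rw [eq_comm, pair_eq_iff, h0] at h'
      exact hkl (Sum.inl_injective h')
    simp [join_pair, h, h1]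
  · intro v hv hvk hvu
    have h1 : v ≠ Sum.inl l := by rintro rfl; exact hv rfl
    have h2 : v ≠ Sum.inr l := by rintro rfl; exact hv rfl
    rw [join_pair, h, if_neg hvk, if_neg h1, if_neg hvu, if_neg h2]

/-! ### The type of a diagram -/

section HasType

variable {m : ℕ}

/-- The vertices of the last strands. -/
def last (m : ℕ) (v : Fin n ⊕ Fin n) : Fin (m + n) ⊕ Fin (m + n) :=
  Sum.map (Fin.natAdd m) (Fin.natAdd m) v

/-- The first `m` of `m + n` strands. -/
def firsts (m n : ℕ) : Finset (Fin (m + n)) :=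
  Finset.univ.map (Fin.castLEEmb (Nat.le_add_right m n))

theorem natAdd_notMem_firsts (k : Fin n) : Fin.natAdd m k ∉ firsts m n := by
  simp only [firsts, Finset.mem_map, Finset.mem_univ, true_and, not_exists]
  intro i h
  have := congrArg Fin.val h
  simp at this
  omega

theorem lt_of_mem_firsts {i : Fin (m + n)} (h : i ∈ firsts m n) : (i : ℕ) < m := by
  simp only [firsts, Finset.mem_map, Finset.mem_univ, true_and] at h
  obtain ⟨j, rfl⟩ := h
  exact j.2

theorem card_firsts : (firsts m n).card = m := by simp [firsts]

theorem last_injective : Function.Injective (last (n := n) m) :=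
  map_map_injective (Fin.natAddEmb m)

theorem idx_last_notMem (v : Fin n ⊕ Fin n) : idx (last m v) ∉ firsts m n := by
  rcases v with i | i <;> exact natAdd_notMem_firsts i

/-- The paths of `δ` between the last strands join the same vertices as the edges of `γ`, and `e`
counts the other strands on them. -/
def HasType (δ : BrauerDiagram (m + n)) (γ : BrauerDiagram n) (e : Fin n ⊕ Fin n → ℕ) : Prop :=
  ∀ v, Path (firsts m n) δ (last m v) (e v) (last m (γ.pair v))

theorem HasType.unique {δ : BrauerDiagram (m + n)} {γ γ' : BrauerDiagram n}
    {e e' : Fin n ⊕ Fin n → ℕ} (h : HasType δ γ e) (h' : HasType δ γ' e') : γ = γ' ∧ e = e' := by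
  refine ⟨?_, ?_⟩
  · ext1; funext v
    exact last_injective ((h v).unique (h' v)).2
  · funext v
    exact ((h v).unique (h' v)).1

theorem HasType.flip {δ : BrauerDiagram (m + n)} {γ : BrauerDiagram n} {e : Fin n ⊕ Fin n → ℕ}
    (h : HasType δ γ e) : HasType (flip δ) (flip γ) (e ∘ Sum.swap) := by
  intro v
  have hs : ∀ v : Fin n ⊕ Fin n, (last m v).swap = last m v.swap := by
    rintro (i | i) <;> rfl
  have := (h v.swap).flip
  rwa [hs, hs, Sum.swap_swap] at this

/-- The contribution of a vertex to the numbers of strands. -/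
def bump (γ : BrauerDiagram n) (u v : Fin n ⊕ Fin n) : ℕ :=
  (if v = u then 1 else 0) + if γ.pair v = u then 1 else 0

theorem Hook.hasType {δ δ' : BrauerDiagram (m + n)} {γ : BrauerDiagram n}
    {e : Fin n ⊕ Fin n → ℕ} {k : Fin n} {l : Fin (m + n)} {q : Fin (m + n) ⊕ Fin (m + n)}
    (H : Hook (Fin.natAdd m k) l δ' δ q) (hl : l ∈ firsts m n) (h : HasType δ' γ e) :
    HasType δ γ (e + bump γ (Sum.inl k)) := by
  intro v
  have hk := natAdd_notMem_firsts (m := m) k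
  have hv : idx (last m v) ≠ l := fun h' => idx_last_notMem v (h'.symm ▸ hl)
  have hiff : ∀ v, last m v = Sum.inl (Fin.natAdd m k) ↔ v = Sum.inl k :=
    fun v => last_injective.eq_iff (b := Sum.inl k)
  rw [Pi.add_apply, bump]
  by_cases h1 : v = Sum.inl k
  · subst h1
    have h2 : γ.pair (Sum.inl k) ≠ Sum.inl k := γ.pair_ne _
    rw [if_pos rfl, if_neg h2]
    exact H.path_start hk hl (h (Sum.inl k)) fun h' => h2 ((hiff _).1 h')
  · by_cases h2 : γ.pair v = Sum.inl k
    · rw [if_neg h1, if_pos h2, zero_add]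
      exact H.path_end hk hl (h v) hv (fun h' => h1 ((hiff _).1 h')) ((hiff _).2 h2)
    · rw [if_neg h1, if_neg h2]
      exact H.path hk (h v) hv (fun h' => h1 ((hiff _).1 h')) fun h' => h2 ((hiff _).1 h')

end HasType

end BrauerDiagram

/-! ### The degree under multiplication by a transposition. -/

namespace BrauerDiagram

variable {n : ℕ} {S : Finset (Fin n)}

theorem cnt_comp_le_of {α γ : BrauerDiagram n}
    (h : ∀ i ∈ S, α.pair (Sum.inl i) ≠ Sum.inr i → γ.pair (Sum.inl i) ≠ Sum.inr i) :
    cnt S (comp α γ) ≤ cnt S γ := by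
  refine Finset.card_le_card fun i hi => ?_
  rw [Finset.mem_filter] at hi ⊢
  refine ⟨hi.1, ?_⟩
  by_contra h'
  exact hi.2 (comp_pair_vertical (by_contra fun h'' => h i hi.1 h'' h') h')

theorem pair_conj_swap_top {k l : Fin n} (γ : BrauerDiagram n) (h : γ.pair (Sum.inl l) = Sum.inr l) :
    (conj (topPerm (Equiv.swap k l)) γ).pair (Sum.inl k) = Sum.inr l := by
  simp [h]

theorem cnt_hook {k l : Fin n} (hk : k ∉ S) (hl : l ∈ S) {γ : BrauerDiagram n}
    (h : γ.pair (Sum.inl l) = Sum.inr l) :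
    cnt S (conj (topPerm (Equiv.swap k l)) γ) = cnt S γ + 1 := by
  have hkl : k ≠ l := by rintro rfl; exact hk hl
  have hu := γ.pair_ne (Sum.inl k)
  rw [cnt, cnt, ← Finset.card_insert_of_notMem (a := l)]
  · congr 1
    ext i
    simp only [Finset.mem_filter, Finset.mem_insert]
    by_cases hi : i = l
    · subst hi
      simp only [hl, true_and, true_or, iff_true, conj_pair, topPerm_symm_inl, Equiv.symm_swap,
        Equiv.swap_apply_right]
      intro h'
      rcases hv : γ.pair (Sum.inl k) with j | j
      · rw [hv] at h'; simp at h'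
      · rw [hv, topPerm_inr] at h'
        rw [h', ← h] at hv
        exact hkl (Sum.inl_injective (γ.pair_injective hv))
    · by_cases hik : i = k
      · subst hik; simp [hk, hi]
      · simp only [hi, false_or, and_congr_right_iff, conj_pair, topPerm_symm_inl,
          Equiv.symm_swap, Equiv.swap_apply_of_ne_of_ne hik hi]
        intro _
        rcases γ.pair (Sum.inl i) with j | j <;> simp
  · simp [h]

/-- If `k` is joined with the bottom of `l`, exchanging the tops of `k` and `l'` cannot make `l'` or
any other strand in `S` vertical. This excludes the wrong summands in `coeff_x_mul`. -/
theorem cnt_le_cnt_swap {k l l' : Fin n} (hk : k ∉ S) (hl' : l' ≠ l) {δ : BrauerDiagram n}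
    (h : δ.pair (Sum.inl k) = Sum.inr l) :
    cnt S δ ≤ cnt S (conj (topPerm (Equiv.swap k l')) δ) := by
  refine Finset.card_le_card fun i hi => ?_
  rw [Finset.mem_filter] at hi ⊢
  have hik : i ≠ k := by rintro rfl; exact hk hi.1
  refine ⟨hi.1, ?_⟩
  by_cases h1 : i = l'
  · subst h1
    simp only [conj_pair, topPerm_symm_inl, Equiv.symm_swap, Equiv.swap_apply_right, h,
      topPerm_inr, ne_eq, Sum.inr.injEq]
    exact hl'.symm
  · have h2 := hi.2
    simp only [conj_pair, topPerm_symm_inl, Equiv.symm_swap, Equiv.swap_apply_of_ne_of_ne hik h1]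
    rcases hv : δ.pair (Sum.inl i) with j | j
    · simp
    · rw [hv] at h2; exact h2

end BrauerDiagram

/-! ### Multiplication by Jucys–Murphy elements: leading coefficients and types. -/

namespace BrauerAlgebra

open BrauerDiagram

section Coefficients

variable {n : ℕ} {N : ℂ} {S : Finset (Fin n)}

theorem coeff_c_mul_eq_zero {k l : Fin n} (h : k ≠ l) {γ : BrauerDiagram n}
    (hγ : γ.pair (Sum.inl k) ≠ Sum.inl l) (f : BrauerAlgebra n N) :
    coeff γ (c N k l * f) = 0 := by
  classical
  induction f using span_induction with
  | hadd f g hf hg => rw [mul_add, map_add, hf, hg, add_zero]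
  | hsmul a f hf => rw [mul_smul_comm, map_smul, hf, smul_zero]
  | hb δ =>
    have hne : join _ _ (inl_ne_inl h) δ ≠ γ := by
      rintro rfl
      apply hγ
      simp [join_pair]
    rw [c_mul_b h, map_smul, coeff_b, if_neg hne, smul_zero]

theorem coeff_flipL (γ : BrauerDiagram n) (f : BrauerAlgebra n N) :
    coeff γ (flipL f) = coeff (flip γ) f := by
  have := coeff_lift_b (N := N) (Function.LeftInverse.injective (BrauerDiagram.flip_flip (n := n))) (flip γ) f
  rwa [BrauerDiagram.flip_flip] at this

/-- Only the summand `t N k l` of x counts. The horizontal pairs would need a top edge at `k`. The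
constant and the other transpositions would need a diagram in `f` of degree more than `cnt S γ`. -/
theorem coeff_x_mul {k l : Fin n} (hk : k ∉ S) (hl : l ∈ S) (hlk : l < k) {γ : BrauerDiagram n}
    (h : γ.pair (Sum.inl l) = Sum.inr l) {f : BrauerAlgebra n N}
    (hf : f ∈ Deg N S (cnt S γ + 1)) :
    coeff (conj (topPerm (Equiv.swap k l)) γ) (x N k * f) = coeff γ f := by
  have h1 : cnt S γ + 1 ≤ cnt S (conj (topPerm (Equiv.swap k l)) γ) := (cnt_hook hk hl h).ge
  have h2 := pair_conj_swap_top (k := k) γ h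
  have h3 : ∀ l' ∈ Finset.Iio k, coeff (conj (topPerm (Equiv.swap k l)) γ) (d N k l' * f) =
      if l' = l then coeff γ f else 0 := by
    intro l' hl'
    rw [d, sub_mul, map_sub, coeff_c_mul_eq_zero (Finset.mem_Iio.1 hl').ne' (by rw [h2]; simp),
      sub_zero]
    split_ifs with h'
    · rw [h', coeff_t_mul]
    · rw [← conj_swap_conj_swap k l' (conj (topPerm (Equiv.swap k l)) γ), coeff_t_mul]
      exact coeff_eq_zero_of_Deg hf (h1.trans (cnt_le_cnt_swap hk h' h2))
  rw [x_eq, add_mul, map_add, ← Algebra.smul_def, map_smul, coeff_eq_zero_of_Deg hf h1, smul_zero,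
    zero_add, Finset.sum_mul, map_sum, Finset.sum_congr rfl h3, Finset.sum_ite_eq',
    if_pos (Finset.mem_Iio.2 hlk)]

theorem coeff_mul_x {k l : Fin n} (hk : k ∉ S) (hl : l ∈ S) (hlk : l < k) {γ : BrauerDiagram n}
    (h : γ.pair (Sum.inl l) = Sum.inr l) {f : BrauerAlgebra n N}
    (hf : f ∈ Deg N S (cnt S γ + 1)) :
    coeff (flip (conj (topPerm (Equiv.swap k l)) (flip γ))) (f * x N k) = coeff γ f := by
  have h1 : (flip γ).pair (Sum.inl l) = Sum.inr l := by
    rw [flip_pair, Sum.swap_inl]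
    have : γ.pair (Sum.inr l) = Sum.inl l := by rw [pair_eq_iff, h]
    rw [this]; rfl
  rw [← coeff_flipL, flipL_mul, flipL_x, coeff_x_mul hk hl hlk h1, coeff_flipL, BrauerDiagram.flip_flip]
  rw [cnt_flip]
  exact flipL_mem_Deg hf

end Coefficients

variable {m n : ℕ} {N : ℂ}

/-- The span of the diagrams of degree `d` of the given type, and the diagrams of lower degree. -/
noncomputable def Typ (m : ℕ) (N : ℂ) (γ : BrauerDiagram n) (e : Fin n ⊕ Fin n → ℕ) (d : ℕ) :
    Submodule ℂ (BrauerAlgebra (m + n) N) :=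
  bspan N {δ | cnt (firsts m n) δ < d ∨ cnt (firsts m n) δ = d ∧ HasType δ γ e}

theorem Deg_le_Typ {γ : BrauerDiagram n} {e : Fin n ⊕ Fin n → ℕ} {d : ℕ} :
    Deg N (firsts m n) d ≤ Typ m N γ e d := bspan_mono fun _ h => Or.inl h

theorem Typ_le_Deg {γ : BrauerDiagram n} {e : Fin n ⊕ Fin n → ℕ} {d : ℕ} :
    Typ m N γ e d ≤ Deg N (firsts m n) (d + 1) := bspan_mono fun δ h => by
  simp only [Set.mem_ofPred_eq] at h ⊢
  omega

/-- The degree can rise only if `l` is a vertical strand of `δ` among the first `m`. In that case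
the factor leads the edge at `k` through `l`, and the path counts grow by `bump`. -/
theorem b_mul_b_mem_Typ {γ : BrauerDiagram n} {e : Fin n ⊕ Fin n → ℕ} {d : ℕ} {k : Fin n}
    {l : Fin (m + n)} {α δ : BrauerDiagram (m + n)} (hkl : Fin.natAdd m k ≠ l)
    (hα : ∀ i, i ≠ Fin.natAdd m k → i ≠ l → α.pair (Sum.inl i) = Sum.inr i)
    (hH : δ.pair (Sum.inl l) = Sum.inr l →
      ∃ q, Hook (Fin.natAdd m k) l δ (comp α δ) q)
    (hδ : cnt (firsts m n) δ < d ∨ cnt (firsts m n) δ = d ∧ HasType δ γ e) :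
    (b α * b δ : BrauerAlgebra (m + n) N) ∈ Typ m N γ (e + bump γ (Sum.inl k)) (d + 1) := by
  have hk := natAdd_notMem_firsts (m := m) k
  rw [b_mul_b]
  refine Submodule.smul_mem _ _ (b_mem_bspan ?_)
  rw [Set.mem_ofPred_eq]
  have h1 : cnt (firsts m n) (comp α δ) ≤ cnt (firsts m n) δ + 1 := by
    have h2 := cnt_comp_le (firsts m n) α δ
    have h3 := (cnt_le_of_ne (S := firsts m n) hα).trans (card_pair_inter_le_one hk)
    omega
  rcases hδ with hδ | ⟨hδ, ht⟩
  · left; omega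
  · by_cases h : l ∈ firsts m n ∧ δ.pair (Sum.inl l) = Sum.inr l
    · obtain ⟨q, H⟩ := hH h.2
      have := H.hasType h.1 ht
      by_cases h2 : cnt (firsts m n) (comp α δ) < d + 1
      · exact Or.inl h2
      · exact Or.inr ⟨by omega, this⟩
    · left
      have : cnt (firsts m n) (comp α δ) ≤ cnt (firsts m n) δ := by
        refine cnt_comp_le_of fun i hi hi' hi'' => ?_
        by_cases hil : i = l
        · subst hil; exact h ⟨hi, hi''⟩
        · exact hi' (hα i (by rintro rfl; exact hk hi) hil)
      omega

theorem x_mul_mem_Typ {γ : BrauerDiagram n} {e : Fin n ⊕ Fin n → ℕ} {d : ℕ} (k : Fin n)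
    {f : BrauerAlgebra (m + n) N} (hf : f ∈ Typ m N γ e d) :
    x N (Fin.natAdd m k) * f ∈ Typ m N γ (e + bump γ (Sum.inl k)) (d + 1) := by
  rw [x_eq, add_mul, Finset.sum_mul]
  refine Submodule.add_mem _ ?_ (Submodule.sum_mem _ fun l hl => ?_)
  · rw [← Algebra.smul_def]
    exact Submodule.smul_mem _ _ (Deg_le_Typ (Typ_le_Deg hf))
  · have hkl : Fin.natAdd m k ≠ l := (Finset.mem_Iio.1 hl).ne'
    rw [BrauerAlgebra.d, sub_mul]
    refine Submodule.sub_mem _ ?_ ?_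
    · refine map_mem_of_mem_bspan (LinearMap.mulLeft ℂ (t N (Fin.natAdd m k) l))
        (fun δ hδ => ?_) hf
      refine b_mul_b_mem_Typ hkl (fun i => pair_transp_of_ne) (fun h => ⟨Sum.inr l, ?_⟩) hδ
      rw [(transp_comp _ _ δ).2]
      exact hook_transp hkl h
    · refine map_mem_of_mem_bspan (LinearMap.mulLeft ℂ (c N (Fin.natAdd m k) l))
        (fun δ hδ => ?_) hf
      refine b_mul_b_mem_Typ hkl (fun i => pair_cupcap_of_ne) (fun h => ⟨Sum.inl l, ?_⟩) hδ
      rw [(cupcap_comp hkl δ).2]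
      exact hook_cupcap hkl h

theorem flipL_mem_Typ {γ : BrauerDiagram n} {e : Fin n ⊕ Fin n → ℕ} {d : ℕ}
    {f : BrauerAlgebra (m + n) N} (hf : f ∈ Typ m N γ e d) :
    flipL f ∈ Typ m N (flip γ) (e ∘ Sum.swap) d := by
  refine map_mem_of_mem_bspan flipL (fun δ hδ => ?_) hf
  rw [flipL_b]
  refine b_mem_bspan ?_
  rw [Set.mem_ofPred_eq, cnt_flip]
  exact hδ.imp_right fun h => ⟨h.1, h.2.flip⟩

theorem mul_x_mem_Typ {γ : BrauerDiagram n} {e : Fin n ⊕ Fin n → ℕ} {d : ℕ} (k : Fin n)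
    {f : BrauerAlgebra (m + n) N} (hf : f ∈ Typ m N γ e d) :
    f * x N (Fin.natAdd m k) ∈ Typ m N γ (e + bump γ (Sum.inr k)) (d + 1) := by
  have h1 := flipL_mem_Typ (x_mul_mem_Typ k (flipL_mem_Typ hf))
  rw [flipL_mul, flipL_flipL, flipL_x, BrauerDiagram.flip_flip] at h1
  have h2 : (e ∘ Sum.swap + bump (flip γ) (Sum.inl k)) ∘ Sum.swap = e + bump γ (Sum.inr k) := by
    funext v
    have h3 : ∀ v : Fin n ⊕ Fin n, v.swap = Sum.inl k ↔ v = Sum.inr k := by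
      rintro (i | i) <;> simp
    simp only [Function.comp_apply, Pi.add_apply, Sum.swap_swap, bump, flip_pair, h3]
  rwa [h2] at h1

end BrauerAlgebra

/-! ### Separation of the regular monomials and the intersection of the kernels. -/

namespace Aff

open BrauerDiagram BrauerAlgebra

variable {n : ℕ} {N : ℂ}

/-! ### The images of the monomials -/

/-- The homomorphism `π_m`. -/
noncomputable def proj (m n : ℕ) (N : ℂ) : Aff n N →ₐ[ℂ] BrauerAlgebra (m + n) N :=
  AffineBrauerAlgebra.toBrauer m n N

theorem proj_y (m : ℕ) (k : Fin n) : proj m n N (y N k) = x N (Fin.natAdd m k) :=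
  AffineBrauerAlgebra.toBrauer_y m k

theorem proj_w (m i : ℕ) : proj m n N (w n N i) = inc (Nat.le_add_right m n) N (z m N i) :=
  AffineBrauerAlgebra.toBrauer_w m i

theorem proj_ofB (m : ℕ) (f : BrauerAlgebra n N) :
    proj m n N (ofB f) = emb (Fin.natAddEmb m) N f :=
  AffineBrauerAlgebra.toBrauer_ofBrauer m f

theorem proj_wpow (m : ℕ) (h : Multiset ℕ) :
    proj m n N (wpow n N h) = inc (Nat.le_add_right m n) N (zprod m N h) := by
  induction h using Multiset.induction with
  | empty => rw [wpow_zero, zprod_zero, map_one, map_one]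
  | cons i h ih => rw [wpow_cons, zprod_cons, map_mul, map_mul, ih, proj_w]

theorem castLE_ne_natAdd (m : ℕ) (i : Fin m) (j : Fin n) :
    Fin.castLEEmb (Nat.le_add_right m n) i ≠ Fin.natAddEmb m j := by
  intro h
  have := congrArg Fin.val h
  simp at this
  omega

theorem inc_mul_emb_b (m : ℕ) (γ : BrauerDiagram n) (f : BrauerAlgebra m N) :
    inc (Nat.le_add_right m n) N f * emb (Fin.natAddEmb m) N (b γ) =
      lift (fun δ => b (tensor (Fin.castLEEmb (Nat.le_add_right m n)) (Fin.natAddEmb m) δ γ)) f := by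
  induction f using span_induction with
  | hadd f g hf hg => rw [map_add, map_add, add_mul, hf, hg]
  | hsmul a f hf => rw [map_smul, map_smul, smul_mul_assoc, hf]
  | hb δ =>
    rw [lift_b, inc, emb_b, emb_b, b_mul_b, loops_embed_embed _ _ (castLE_ne_natAdd m), pow_zero,
      one_smul, tensor]

theorem hasType_tensor (m : ℕ) (δ : BrauerDiagram m) (γ : BrauerDiagram n) :
    HasType (tensor (Fin.castLEEmb (Nat.le_add_right m n)) (Fin.natAddEmb m) δ γ) γ 0 := by
  intro v
  have h := tensor_pair_right _ _ (castLE_ne_natAdd m) δ γ v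
  have h' : last m (γ.pair v) = (tensor (Fin.castLEEmb (Nat.le_add_right m n))
    (Fin.natAddEmb m) δ γ).pair (last m v) := h.symm
  rw [h']
  refine Path.final ?_
  rw [← h']
  exact idx_last_notMem _

theorem inc_mul_emb_b_mem_Typ {m d : ℕ} (γ : BrauerDiagram n) {f : BrauerAlgebra m N}
    (hf : f ∈ Deg N Finset.univ (d + 1)) :
    inc (Nat.le_add_right m n) N f * emb (Fin.natAddEmb m) N (b γ) ∈ Typ m N γ 0 d := by
  rw [inc_mul_emb_b]
  refine map_mem_of_mem_bspan _ (fun δ hδ => ?_) hf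
  rw [lift_b]
  refine b_mem_bspan ?_
  rw [Set.mem_ofPred_eq] at hδ ⊢
  have := cnt_tensor _ _ (castLE_ne_natAdd m) δ γ
  rw [firsts, this]
  rcases Nat.lt_succ_iff_lt_or_eq.1 hδ with h | h
  · exact Or.inl h
  · exact Or.inr ⟨h, hasType_tensor m δ γ⟩

theorem mono_zero (h : Multiset ℕ) (γ : BrauerDiagram n) :
    mono N 0 h γ 0 = wpow n N h * ofB (b γ) := by
  rw [mono, ypow_zero, one_mul, mul_one]

theorem proj_mono_zero (m : ℕ) (h : Multiset ℕ) (γ : BrauerDiagram n) :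
    proj m n N (mono N 0 h γ 0) =
      inc (Nat.le_add_right m n) N (zprod m N h) * emb (Fin.natAddEmb m) N (b γ) := by
  rw [mono_zero, map_mul, proj_wpow, proj_ofB]

/-- The exponents of a monomial at the vertices. -/
def expo (a c : Multiset (Fin n)) : Fin n ⊕ Fin n → ℕ :=
  Sum.elim (fun k => a.count k) fun k => c.count k

/-- The exponents of a monomial at the edges. -/
def edgeExpo (γ : BrauerDiagram n) (a c : Multiset (Fin n)) (v : Fin n ⊕ Fin n) : ℕ :=
  expo a c v + expo a c (γ.pair v)

theorem edgeExpo_cons_left (γ : BrauerDiagram n) (k : Fin n) (a c : Multiset (Fin n)) :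
    edgeExpo γ (k ::ₘ a) c = edgeExpo γ a c + bump γ (Sum.inl k) := by
  have h : ∀ v, expo (k ::ₘ a) c v = expo a c v + if v = Sum.inl k then 1 else 0 := by
    rintro (i | i)
    · simp [expo, Multiset.count_cons]
    · simp [expo]
  funext v
  rw [Pi.add_apply, edgeExpo, edgeExpo, bump, h, h]
  omega

theorem edgeExpo_cons_right (γ : BrauerDiagram n) (k : Fin n) (a c : Multiset (Fin n)) :
    edgeExpo γ a (k ::ₘ c) = edgeExpo γ a c + bump γ (Sum.inr k) := by
  have h : ∀ v, expo a (k ::ₘ c) v = expo a c v + if v = Sum.inr k then 1 else 0 := by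
    rintro (i | i)
    · simp [expo]
    · simp [expo, Multiset.count_cons]
  funext v
  rw [Pi.add_apply, edgeExpo, edgeExpo, bump, h, h]
  omega

theorem edgeExpo_zero (γ : BrauerDiagram n) : edgeExpo γ 0 0 = 0 := by
  funext v
  have h : ∀ v : Fin n ⊕ Fin n, expo 0 0 v = 0 := by rintro (i | i) <;> simp [expo]
  rw [edgeExpo, h, h]; rfl

theorem proj_mono_mem_Typ (m : ℕ) (a : Multiset (Fin n)) (h : Multiset ℕ) (γ : BrauerDiagram n)
    (c : Multiset (Fin n)) : proj m n N (mono N a h γ c) ∈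
      Typ m N γ (edgeExpo γ a c) (a.card + h.sum + c.card) := by
  induction a using Multiset.induction with
  | empty =>
    induction c using Multiset.induction with
    | empty =>
      rw [proj_mono_zero, edgeExpo_zero]
      simpa using inc_mul_emb_b_mem_Typ γ (zprod_mem_Deg h)
    | cons k c ih =>
      rw [← mono_mul_y_eq, map_mul, proj_y, edgeExpo_cons_right, Multiset.card_cons, ← add_assoc]
      exact mul_x_mem_Typ k ih
  | cons k a ih =>
    rw [← y_mul_mono_eq, map_mul, proj_y, edgeExpo_cons_left, Multiset.card_cons,
      add_right_comm _ 1, add_right_comm _ 1]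
    exact x_mul_mem_Typ k ih

theorem proj_mono_mem_Deg (m : ℕ) (a : Multiset (Fin n)) (h : Multiset ℕ) (γ : BrauerDiagram n)
    (c : Multiset (Fin n)) {d : ℕ} (hd : a.card + h.sum + c.card = d) :
    proj m n N (mono N a h γ c) ∈ Deg N (firsts m n) (d + 1) :=
  hd ▸ Typ_le_Deg (proj_mono_mem_Typ m a h γ c)

/-- The spanning theorem `F_succ_le_K` reduces this to regular monomials, by induction on the
degree. -/
theorem proj_mem_Deg (m : ℕ) {d : ℕ} {u : Aff n N} (hu : u ∈ F n N d) :
    proj m n N u ∈ Deg N (firsts m n) d := by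
  induction d generalizing u with
  | zero =>
    rw [F_zero, Submodule.mem_bot] at hu
    rw [hu, map_zero]
    exact Submodule.zero_mem _
  | succ d ih =>
    have h : K n N d ≤ (Deg N (firsts m n) (d + 1)).comap (proj m n N).toLinearMap := by
      refine sup_le ?_ fun u hu => ?_
      · rw [R, Submodule.span_le]
        rintro _ ⟨a, h, γ, c, -, hd, rfl⟩
        exact proj_mono_mem_Deg m a h γ c hd
      · exact Deg_mono subset_rfl (Nat.le_succ d) (ih hu)
    exact h (F_succ_le_K d hu)

/-! ### The coefficients of the images of the monomials -/

theorem exists_vertical {m : ℕ} {δ : BrauerDiagram (m + n)} (h : cnt (firsts m n) δ < m) :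
    ∃ l ∈ firsts m n, δ.pair (Sum.inl l) = Sum.inr l := by
  by_contra! h'
  have : cnt (firsts m n) δ = m := by
    rw [cnt, Finset.filter_true_of_mem h', card_firsts]
  omega

/-- Starting from σ beside γ, every factor y leads an edge through a fresh vertical strand,
available since `m` is at least the total degree. The diagram obtained does not depend on `h`, so
the coefficient isolates the product of z's. -/
theorem exists_coeff_proj_mono (m : ℕ) (γ : BrauerDiagram n) (σ : Equiv.Perm (Fin m))
    (a c : Multiset (Fin n)) (hm : a.card + σ.support.card + c.card ≤ m) :
    ∃ δ : BrauerDiagram (m + n),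
      cnt (firsts m n) δ = a.card + σ.support.card + c.card ∧
      ∀ h : Multiset ℕ, h.sum = σ.support.card →
        coeff δ (proj m n N (mono N a h γ c)) = coeff (ofPerm σ) (zprod m N h) := by
  induction a using Multiset.induction with
  | empty =>
    induction c using Multiset.induction with
    | empty =>
      refine ⟨tensor (Fin.castLEEmb (Nat.le_add_right m n)) (Fin.natAddEmb m) (ofPerm σ) γ,
        ?_, fun h _ => ?_⟩
      · rw [firsts, cnt_tensor _ _ (castLE_ne_natAdd m), cnt_ofPerm]; simp
      · rw [proj_mono_zero, inc_mul_emb_b]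
        exact coeff_lift_b (tensor_injective _ _ (castLE_ne_natAdd m) γ) (ofPerm σ) _
    | cons k c ih =>
      rw [Multiset.card_cons] at hm ⊢
      obtain ⟨δ, h1, h2⟩ := ih (by omega)
      obtain ⟨l, hl, hv⟩ := exists_vertical (δ := δ) (by omega)
      have hk := natAdd_notMem_firsts (m := m) k
      have hlk : l < Fin.natAdd m k := by
        have := lt_of_mem_firsts hl
        rw [Fin.lt_def, Fin.val_natAdd]; omega
      refine ⟨flip (conj (topPerm (Equiv.swap (Fin.natAdd m k) l)) (flip δ)), ?_, fun h hs => ?_⟩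
      · rw [cnt_flip, cnt_hook hk hl, cnt_flip, h1, add_assoc]
        rw [flip_pair, Sum.swap_inl, ← hv, δ.pair_pair, hv]; rfl
      · rw [← mono_mul_y_eq, map_mul, proj_y, ← h2 h hs]
        exact coeff_mul_x hk hl hlk hv (proj_mono_mem_Deg m _ _ _ _ (by rw [hs, h1]))
  | cons k a ih =>
    rw [Multiset.card_cons] at hm ⊢
    obtain ⟨δ, h1, h2⟩ := ih (by omega)
    obtain ⟨l, hl, hv⟩ := exists_vertical (δ := δ) (by omega)
    have hk := natAdd_notMem_firsts (m := m) k
    have hlk : l < Fin.natAdd m k := by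
      have := lt_of_mem_firsts hl
      rw [Fin.lt_def, Fin.val_natAdd]; omega
    refine ⟨conj (topPerm (Equiv.swap (Fin.natAdd m k) l)) δ, ?_, fun h hs => ?_⟩
    · rw [cnt_hook hk hl hv, h1]; omega
    · rw [← y_mul_mono_eq, map_mul, proj_y, ← h2 h hs]
      exact coeff_x_mul hk hl hlk hv (proj_mono_mem_Deg m _ _ _ _ (by rw [hs, h1]))

/-- In a regular monomial only the first end of an edge carries an exponent, so the total on the
edge determines it. -/
theorem expo_eq_of_regular {a a' c c' : Multiset (Fin n)} {h h' : Multiset ℕ}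
    {γ : BrauerDiagram n} (hr : Regular a h γ c) (hr' : Regular a' h' γ c')
    (he : edgeExpo γ a c = edgeExpo γ a' c') : a = a' ∧ c = c' := by
  have key : ∀ {a c : Multiset (Fin n)} {h : Multiset ℕ}, Regular a h γ c →
      ∀ v, ¬ Primary γ v → expo a c v = 0 := by
    rintro a c h hr (k | k) hv
    · exact Multiset.count_eq_zero.2 fun hk => hv (hr.left k hk)
    · exact Multiset.count_eq_zero.2 fun hk => hv (hr.right k hk)
  have hexp : ∀ v, expo a c v = expo a' c' v := by
    intro v
    by_cases hv : Primary γ v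
    · have hv' : ¬ Primary γ (γ.pair v) := by
        rw [Primary, γ.pair_pair]
        exact not_lt.2 hv.le
      have := congrFun he v
      rwa [edgeExpo, edgeExpo, key hr _ hv', key hr' _ hv'] at this
    · rw [key hr v hv, key hr' v hv]
  exact ⟨Multiset.ext.2 fun k => hexp (Sum.inl k), Multiset.ext.2 fun k => hexp (Sum.inr k)⟩

open scoped ComplexOrder in
/-- The diagrams of top degree separate the regular monomials. -/
theorem exists_separating (d : ℕ) {a c : Multiset (Fin n)} {h : Multiset ℕ} {γ : BrauerDiagram n}
    (hr : Regular a h γ c) (hd : a.card + h.sum + c.card = d) :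
    ∃ δ : BrauerDiagram (d + n), cnt (firsts d n) δ = d ∧
      coeff δ (proj d n N (mono N a h γ c)) ≠ 0 ∧
      ∀ a' h' γ' c', Regular a' h' γ' c' → a'.card + h'.sum + c'.card = d →
        coeff δ (proj d n N (mono N a' h' γ' c')) ≠ 0 → a' = a ∧ h' = h ∧ γ' = γ ∧ c' = c := by
  obtain ⟨σ, hσ, hpos⟩ := exists_coeff_zprod_pos (m := d) (N := N) hr.even (by omega)
  obtain ⟨δ, h1, h2⟩ := exists_coeff_proj_mono (N := N) d γ σ a c (by omega)
  have hδ : cnt (firsts d n) δ = d := by omega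
  have hne : coeff δ (proj d n N (mono N a h γ c)) ≠ 0 := by
    rw [h2 h hσ.symm]; exact hpos.ne'
  -- As `δ` has the top degree `d`, it can occur in the image of a monomial of degree `d` only with
  -- the type of that monomial.
  have htype : ∀ {a h γ c}, a.card + h.sum + c.card = d →
      coeff δ (proj d n N (mono N a h γ c)) ≠ 0 → HasType δ γ (edgeExpo γ a c) := by
    intro a h γ c hd hne
    have := mem_bspan_iff.1 (proj_mono_mem_Typ (N := N) d a h γ c) δ hne
    rw [Set.mem_ofPred_eq, hδ, hd] at this
    exact (this.resolve_left (lt_irrefl d)).2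
  refine ⟨δ, hδ, hne, fun a' h' γ' c' hr' hd' hne' => ?_⟩
  obtain ⟨rfl, he⟩ := (htype hd' hne').unique (htype hd hne)
  obtain ⟨rfl, rfl⟩ := expo_eq_of_regular hr' hr he
  have hs : h'.sum = σ.support.card := by omega
  refine ⟨rfl, ?_, rfl, rfl⟩
  -- With γ and the exponents of y equal, `h` and `h'` have the same sum, and both must be the cycle
  -- type of σ.
  rw [h2 h' hs] at hne'
  rw [← cycleType_of_coeff_zprod hr'.even σ hs.le hne',
    cycleType_of_coeff_zprod hr.even σ hσ.ge hpos.ne']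

/-- Only π_d is applied: the part of lower degree is invisible at diagrams of degree `d`, and the
separating diagrams show that every coefficient of the regular part vanishes. -/
theorem mem_F_of_proj_eq_zero {d : ℕ} {u : Aff n N} (hu : u ∈ F n N (d + 1))
    (h0 : ∀ m, proj m n N u = 0) : u ∈ F n N d := by
  obtain ⟨r, hr, f, hf, rfl⟩ := Submodule.mem_sup.1 (F_succ_le_K d hu)
  suffices hr0 : r = 0 by rwa [hr0, zero_add]
  let I := Multiset (Fin n) × Multiset ℕ × BrauerDiagram n × Multiset (Fin n)
  let M : I → Aff n N := fun μ => mono N μ.1 μ.2.1 μ.2.2.1 μ.2.2.2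
  let T : Set I := {μ | Regular μ.1 μ.2.1 μ.2.2.1 μ.2.2.2 ∧
    μ.1.card + μ.2.1.sum + μ.2.2.2.card = d}
  have hr' : r ∈ Submodule.span ℂ (M '' T) := by
    refine Submodule.span_mono ?_ hr
    rintro _ ⟨a, h, γ, c, h1, h2, rfl⟩
    exact ⟨(a, h, γ, c), ⟨h1, h2⟩, rfl⟩
  obtain ⟨l, hl, rfl⟩ := (Finsupp.mem_span_image_iff_linearCombination ℂ).1 hr'
  rw [Finsupp.mem_supported] at hl
  suffices hl0 : l = 0 by rw [hl0, map_zero]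
  ext μ
  by_contra hμ
  obtain ⟨hμ1, hμ2⟩ := hl (Finset.mem_coe.2 (Finsupp.mem_support_iff.2 hμ))
  obtain ⟨δ, h1, h2, h3⟩ := exists_separating (N := N) d hμ1 hμ2
  have h4 := congrArg (coeff δ) (h0 d)
  rw [map_add, map_add, map_zero, coeff_eq_zero_of_Deg (proj_mem_Deg d hf) h1.ge, add_zero,
    Finsupp.linearCombination_apply, Finsupp.sum, map_sum, map_sum,
    Finset.sum_eq_single μ] at h4
  · rw [map_smul, map_smul, smul_eq_mul] at h4
    rcases mul_eq_zero.1 h4 with h5 | h5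
    · exact hμ h5
    · exact h2 h5
  · intro μ' hμ' hne
    rw [map_smul, map_smul, smul_eq_mul]
    by_contra h5
    obtain ⟨h6, h7⟩ := hl (Finset.mem_coe.2 hμ')
    obtain ⟨e1, e2, e3, e4⟩ := h3 _ _ _ _ h6 h7 (right_ne_zero_of_mul h5)
    exact hne (Prod.ext e1 (Prod.ext e2 (Prod.ext e3 e4)))
  · intro h5
    exact absurd (Finsupp.mem_support_iff.2 hμ) h5

theorem eq_zero_of_proj_eq_zero {u : Aff n N} (h0 : ∀ m, proj m n N u = 0) : u = 0 := by
  obtain ⟨d, hd⟩ := exists_mem_F u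
  induction d with
  | zero => rwa [F_zero, Submodule.mem_bot] at hd
  | succ d ih => exact ih (mem_F_of_proj_eq_zero hd h0)

end Aff

theorem theorem4p7 (n : ℕ) (hn : 0 < n) (N : ℂ) :
    ∃ z : (m : ℕ) → ℕ → BrauerAlgebra m N,
      -- `z m i`, the element `z_{m+1}^{(i)}`, is the unique solution of its defining equation
      (∀ (m i : ℕ) (c : BrauerAlgebra m N), BrauerAlgebra.IsZ m i c ↔ c = z m i) ∧
      ∃ π : (m : ℕ) → (AffineBrauerAlgebra n N →ₐ[ℂ] BrauerAlgebra (m + n) N),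
        (∀ m : ℕ,
          (∀ (k : ℕ) (hk : k + 1 < n),
            π m (AffineBrauerAlgebra.ofBrauer (BrauerAlgebra.s N k hk)) =
              BrauerAlgebra.s N (m + k) (by omega)) ∧
          (∀ (k : ℕ) (hk : k + 1 < n),
            π m (AffineBrauerAlgebra.ofBrauer (BrauerAlgebra.sbar N k hk)) =
              BrauerAlgebra.sbar N (m + k) (by omega)) ∧
          (∀ k : Fin n, π m (AffineBrauerAlgebra.y N k) = BrauerAlgebra.x N (Fin.natAdd m k)) ∧
          (∀ i : ℕ, 1 ≤ i → π m (AffineBrauerAlgebra.w n N i) = BrauerAlgebra.incl m n N (z m i))) ∧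
        ⨅ m : ℕ, RingHom.ker (π m) = ⊥ := by
  refine ⟨fun m i => BrauerAlgebra.z m N i, fun m i c => BrauerAlgebra.isZ_iff_eq m i c,
    fun m => AffineBrauerAlgebra.toBrauer m n N, fun m => ⟨fun k hk => ?_, fun k hk => ?_,
      AffineBrauerAlgebra.toBrauer_y m, fun i _ => ?_⟩, ?_⟩
  · rw [AffineBrauerAlgebra.toBrauer_ofBrauer, AffineBrauerAlgebra.shift_s]; rfl
  · rw [AffineBrauerAlgebra.toBrauer_ofBrauer, AffineBrauerAlgebra.shift_sbar]; rfl
  · rw [AffineBrauerAlgebra.toBrauer_w, BrauerAlgebra.incl_eq_inc]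
  · rw [eq_bot_iff]
    intro u hu
    rw [Submodule.mem_iInf] at hu
    exact Aff.eq_zero_of_proj_eq_zero (N := N) (u := u) hu
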